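/- Let $G=SL^{\pm}(2,\mathbb R)$ be the group of real $2\times 2$ matrices of determinant $\pm1$, and put $k_\theta=\begin{pmatrix}\cos\theta&-\sin\theta\\ \sin\theta&\cos\theta\end{pmatrix}$, $K=\{k_\theta\}$, $M=\{\pm I\}$, $n_x=\begin{pmatrix}1&x\\0&1\end{pmatrix}$, $d_a=\mathrm{diag}(a,|a|^{-1})$ for $a\in\mathbb R\setminus\{0\}$. For $\lambda\in\mathbb R$ let $\mathcal P(i\lambda,+)_e$ be the space of functions $f$ on $G$ with $f(gp)=|p_{11}|^{1+i\lambda}f(g)$ for all lower triangular $p\in G$ and $f|_K\in L^2(K)$, with the $L^2(K)$-topology; a vector is smooth if $f|_K$ is smooth. For $s\in\mathbb C$ let $\mathcal P(2s-1,+)^\infty_e$ be the space of functions $\phi_s$ on $G$ with $\phi_s(gp)=|p_{11}|^{-2s}\phi_s(g)$ for all upper triangular $p\in G$ and with $\phi=\phi_s|_K$ smooth (so $\phi\in C^\infty(K/M)$), with the $C^\infty$-topology of $\phi$. $G$ acts on these spaces by left translation. Write $\tilde f(\theta)=f(k_{\theta-\pi/2})$, that is, $f(n_x)=(1+x^2)^{-\frac{1+i\lambda}2}\tilde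 f(\cot^{-1}x)$, and $\phi(\theta)=\phi(k_\theta)$. For a smooth vector $f$ let $Wh_f(g)=\lim_{R\to\infty}\int_{-R}^R f(gn_x)e^{-2\pi i x}\,dx$, and for smooth vectors $f_1,f_2$ let $$Tr_{\mathbb R}^{RS}(f_1,f_2,\phi_s)=\frac1{2\pi}\int_0^{2\pi}\int_{\mathbb R\setminus\{0\}}Wh_{f_1}(k_\theta d_a)\,\overline{Wh_{f_2}(k_\theta d_a)}\,\phi_s(k_\theta d_a)\,|a|^2\,\frac{da}{|a|}\,d\theta .$$ Let $\lambda_1,\lambda_2\in\mathbb R$, $\Re(s)\in(0,1)$, $u=s-\frac{i\lambda_1-i\lambda_2}2$, $G_0(u)=2(2\pi)^{-u}\Gamma(u)\cos\frac{\pi u}2$, and $$H_{f_1,f_2,\phi}(\theta_1,\theta_2)=\frac1{2\pi}\int_0^{2\pi}\phi(\theta)\,\tilde f_1(\theta_1+\theta)\,\overline{\tilde f_2(\theta_2+\theta)}\,d\theta ,$$ $$T(f_1,f_2,\phi_s)=\frac{G_0(u)}8\int_0^{2\pi}\!\int_0^{2\pi}|\sin(\theta_1-\theta_2)|^{-u}|\sin\theta_1|^{-1+u+i\lambda_1}|\sin\theta_2|^{-1+u-i\lambda_2}H_{f_1,f_2,\phi}(\theta_1,\theta_2)\,d\theta_1\,d\theta_2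 .$$ (1) For all $f_i\in\mathcal P(i\lambda_i,+)_e$ and $\phi_s\in\mathcal P(2s-1,+)^\infty_e$, the integral defining $H$ converges absolutely for every $(\theta_1,\theta_2)$, and the double integral converges absolutely. (2) $T$ is a jointly continuous trilinear form (complex linear in $f_1$ and $\phi_s$, conjugate linear in $f_2$) on $\mathcal P(i\lambda_1,+)_e\times\mathcal P(i\lambda_2,+)_e\times\mathcal P(2s-1,+)^\infty_e$; left translation by $G$ preserves each of the three spaces, and $T$ is $G$-equivariant (invariant under the simultaneous left translation of the three arguments). (3) For smooth $f_1,f_2$ the limits defining $Wh_{f_i}$ exist, the integral $Tr_{\mathbb R}^{RS}(f_1,f_2,\phi_s)$ converges absolutely, and $Tr_{\mathbb R}^{RS}(f_1,f_2,\phi_s)=T(f_1,f_2,\phi_s)$. -/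

import Mathlib

open Real Set Filter Topology MeasureTheory
open scoped ContDiff ComplexConjugate

/-- The group `SL^±(2, ℝ)` of real `2 × 2` matrices of determinant `1` or `-1`. -/
def SLpm : Subgroup (GL (Fin 2) ℝ) where
  carrier := {g | (g : Matrix (Fin 2) (Fin 2) ℝ).det = 1 ∨ (g : Matrix (Fin 2) (Fin 2) ℝ).det = -1}
  mul_mem' := by
    rintro a b (ha | ha) (hb | hb) <;> simp [Matrix.det_mul, ha, hb]
  one_mem' := by simp
  inv_mem' := by
    rintro a (ha | ha) <;> simp [Matrix.det_nonsing_inv, ha, Ring.inverse_eq_inv']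

namespace SLpm

/-- The `(i, j)` entry of an element of `SL^±(2, ℝ)`. -/
def entry (g : SLpm) (i j : Fin 2) : ℝ := (g : GL (Fin 2) ℝ) i j

/-- The element of `SL^±(2, ℝ)` with a given matrix of determinant `±1`. -/
noncomputable def ofMatrix (m : Matrix (Fin 2) (Fin 2) ℝ) (h : m.det = 1 ∨ m.det = -1) : SLpm :=
  ⟨Matrix.GeneralLinearGroup.mkOfDetNeZero m (by rcases h with h | h <;> simp [h]), h⟩

/-- The rotation `k_θ` of `K = SO(2)`. -/
noncomputable def rot (θ : ℝ) : SLpm :=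
  ofMatrix !![cos θ, -sin θ; sin θ, cos θ]
    (Or.inl (by rw [Matrix.det_fin_two_of]; nlinarith [sin_sq_add_cos_sq θ]))

/-- The unipotent element `n_t` of `N`. -/
noncomputable def unip (t : ℝ) : SLpm :=
  ofMatrix !![1, t; 0, 1] (Or.inl (by simp [Matrix.det_fin_two_of]))

open Classical in
/-- The element `diag(a, |a|⁻¹)` of `A^± = A ⊔ I₋A`, where `I₋ = diag(-1, 1)`, with coordinate
`a ∈ ℝ ∖ {0}`; the value at `a = 0` is irrelevant. -/
noncomputable def diag (a : ℝ) : SLpm :=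
  if h : a ≠ 0 then
    ofMatrix !![a, 0; 0, |a|⁻¹] (by
      rw [Matrix.det_fin_two_of]
      rcases lt_or_gt_of_ne h with h' | h'
      · right; rw [abs_of_neg h']; field_simp; ring
      · left; rw [abs_of_pos h']; field_simp; ring)
  else 1

end SLpm

open SLpm

/-- Lebesgue measure `dθ` on one period of the circle `K`. -/
noncomputable def periodMeasure : Measure ℝ := volume.restrict (Ioc 0 (2 * π))

/-- The functions on `G = SL^±(2, ℝ)` in the unitary principal series `𝒫(iℓ, +)_e`, modelled on
`G / P̄` with `P̄` the lower triangular subgroup: `F (g p) = |p₁₁| ^ (iℓ + 1) F g` for `p ∈ P̄`, and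
`F` is square integrable on `K`. The condition for `p = -I` is the parity `+`, and for `p = I₋` it
is the even action `f(x) ↦ f(-x)` of `I₋` in the noncompact picture `f(x) = F(n_x)`. -/
def unitarySeriesSubmodule (l : ℝ) : Submodule ℂ (SLpm → ℂ) where
  carrier := {F | (∀ g p : SLpm, entry p 0 1 = 0 →
      F (g * p) = ((|entry p 0 0| : ℝ) : ℂ) ^ (Complex.I * l + 1) * F g) ∧
    MemLp (fun θ => F (rot θ)) 2 periodMeasure}
  add_mem' := by
    rintro F F' ⟨h, hm⟩ ⟨h', hm'⟩
    exact ⟨fun g p hp => by simp [h g p hp, h' g p hp, mul_add], hm.add hm'⟩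
  zero_mem' := ⟨fun g p _ => by simp, MemLp.zero⟩
  smul_mem' := by
    rintro c F ⟨h, hm⟩
    exact ⟨fun g p hp => by simp [h g p hp, mul_left_comm], hm.const_smul c⟩

/-- The space `𝒫(iℓ, +)_e`. Its elements are functions that are not identified when they agree
almost everywhere; the topology below is that of the Hilbert (semi)norm, so that a continuous
complex valued function on this space is the same thing as one on the Hilbert space. -/
def UnitarySeries (l : ℝ) : Type := unitarySeriesSubmodule l

namespace UnitarySeries

noncomputable instance (l : ℝ) : AddCommGroup (UnitarySeries l) :=
  inferInstanceAs (AddCommGroup (unitarySeriesSubmodule l))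

noncomputable instance (l : ℝ) : Module ℂ (UnitarySeries l) :=
  inferInstanceAs (Module ℂ (unitarySeriesSubmodule l))

instance (l : ℝ) : CoeFun (UnitarySeries l) (fun _ => SLpm → ℂ) := ⟨fun F => F.1⟩

/-- The topology of the Hilbert norm, which is the `L²` norm on `K` up to a constant. -/
noncomputable instance (l : ℝ) : TopologicalSpace (UnitarySeries l) :=
  TopologicalSpace.induced (fun F => (F.2.2.toLp : Lp ℂ 2 periodMeasure)) inferInstance

/-- Smooth vectors: the restriction to `K` is smooth. -/
def IsSmooth {l : ℝ} (F : UnitarySeries l) : Prop := ContDiff ℝ ∞ (fun θ => F (rot θ))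

end UnitarySeries

/-- The functions on `G = SL^±(2, ℝ)` in `𝒫(u, +)_e^∞`, modelled on `G / P` with `P` the upper
triangular subgroup: `Φ (g p) = |p₁₁| ^ (-(u + 1)) Φ g` for `p ∈ P`, and `Φ` is smooth on `K`.
For `u = 2s - 1` these are the functions `φ_s(kan) = φ(k) |a| ^ (-2s)` with `φ ∈ C^∞(K/M)`. -/
def smoothSeriesSubmodule (u : ℂ) : Submodule ℂ (SLpm → ℂ) where
  carrier := {Φ | (∀ g p : SLpm, entry p 1 0 = 0 →
      Φ (g * p) = ((|entry p 0 0| : ℝ) : ℂ) ^ (-(u + 1)) * Φ g) ∧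
    ContDiff ℝ ∞ (fun θ => Φ (rot θ))}
  add_mem' := by
    rintro F F' ⟨h, hm⟩ ⟨h', hm'⟩
    exact ⟨fun g p hp => by simp [h g p hp, h' g p hp, mul_add], hm.add hm'⟩
  zero_mem' := ⟨fun g p _ => by simp, contDiff_const⟩
  smul_mem' := by
    rintro c F ⟨h, hm⟩
    exact ⟨fun g p hp => by simp [h g p hp, mul_left_comm], contDiff_const.smul hm⟩

/-- The space `𝒫(u, +)_e^∞` modelled on `G / P`. -/
def SmoothSeries (u : ℂ) : Type := smoothSeriesSubmodule u

namespace SmoothSeries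

noncomputable instance (u : ℂ) : AddCommGroup (SmoothSeries u) :=
  inferInstanceAs (AddCommGroup (smoothSeriesSubmodule u))

noncomputable instance (u : ℂ) : Module ℂ (SmoothSeries u) :=
  inferInstanceAs (Module ℂ (smoothSeriesSubmodule u))

instance (u : ℂ) : CoeFun (SmoothSeries u) (fun _ => SLpm → ℂ) := ⟨fun F => F.1⟩

/-- The Fréchet topology of `C^∞(K/M)`: uniform convergence on `K` of all derivatives. -/
noncomputable instance (u : ℂ) : TopologicalSpace (SmoothSeries u) :=
  TopologicalSpace.induced
    (fun Φ => fun n : ℕ => UniformFun.ofFun (iteratedDeriv n (fun θ => Φ (rot θ))))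
    (inferInstance : TopologicalSpace (ℕ → UniformFun ℝ ℂ))

end SmoothSeries

/-- The noncompact picture `f(x) = F(n_x)` of a function on `G`. -/
noncomputable def noncompactPicture (F : SLpm → ℂ) (x : ℝ) : ℂ := F (unip x)

/-- The compact picture `f̃`, with the angle normalized by `θ = cot⁻¹ x`: for `F` in `𝒫(iℓ, +)` one
has `F(n_x) = (1 + x²) ^ (-(1 + iℓ)/2) f̃(cot⁻¹ x)`, because `n_{cot θ} ∈ k_{θ - π/2} P̄`. -/
noncomputable def compactPicture (F : SLpm → ℂ) (θ : ℝ) : ℂ := F (rot (θ - π / 2))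

/-- Left translation, the action of `G` on all these function spaces. -/
def leftTranslate (g : SLpm) (F : SLpm → ℂ) : SLpm → ℂ := fun h => F (g⁻¹ * h)

/-- `∫_{-R}^{R} f(x) e^{-2πix} dx` for `f` the noncompact picture of `F`. -/
noncomputable def truncatedWhittaker (F : SLpm → ℂ) (R : ℝ) : ℂ :=
  ∫ x in (-R)..R, noncompactPicture F x * Complex.exp (-2 * π * Complex.I * x)

/-- The pairing of `F` with the Whittaker vector `e^{-2πix}`. The noncompact picture of a smooth
vector decays only like `1 / |x|`, and the integral is an improper one. -/
noncomputable def whittakerFunctional (F : SLpm → ℂ) : ℂ :=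
  limUnder atTop (truncatedWhittaker F)

/-- The Whittaker function `Wh_F(g) = ⟨F, π*(g) ψ⟩ = ⟨π(g)⁻¹ F, ψ⟩`. -/
noncomputable def Wh (F : SLpm → ℂ) (g : SLpm) : ℂ := whittakerFunctional (leftTranslate g⁻¹ F)

/-- The integrand of the Rankin–Selberg integral over `G / N`, in the coordinates `(θ, a)` of
`K × A^±` and with the density of `dk |a|² da/|a|`, `dk = dθ / 2π`. -/
noncomputable def rsIntegrand (F₁ F₂ Φ : SLpm → ℂ) (p : ℝ × ℝ) : ℂ :=
  Wh F₁ (rot p.1 * diag p.2) * conj (Wh F₂ (rot p.1 * diag p.2)) * Φ (rot p.1 * diag p.2) *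
    ((|p.2| ^ 2 / |p.2| / (2 * π) : ℝ) : ℂ)

/-- The coordinate domain of `K A^± ≅ G / N`, up to the null set `a = 0`. -/
def rsDomain : Set (ℝ × ℝ) := Ioc 0 (2 * π) ×ˢ univ

/-- The Archimedean Rankin–Selberg integral of Whittaker functions. -/
noncomputable def rankinSelberg (F₁ F₂ Φ : SLpm → ℂ) : ℂ :=
  ∫ p in rsDomain, rsIntegrand F₁ F₂ Φ p

/-- `G₀(u) = 2 (2π)^{-u} Γ(u) cos(πu/2)`. -/
noncomputable def G₀ (u : ℂ) : ℂ :=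
  2 * (2 * π : ℂ) ^ (-u) * Complex.Gamma u * Complex.cos (π * u / 2)

/-- `u = s - (iℓ₁ - iℓ₂)/2`. -/
noncomputable def uParam (l₁ l₂ : ℝ) (s : ℂ) : ℂ := s - (Complex.I * l₁ - Complex.I * l₂) / 2

/-- The integrand of `H`. -/
noncomputable def convIntegrand (F₁ F₂ Φ : SLpm → ℂ) (θ₁ θ₂ θ : ℝ) : ℂ :=
  Φ (rot θ) * compactPicture F₁ (θ₁ + θ) * conj (compactPicture F₂ (θ₂ + θ))

/-- `H(θ₁, θ₂) = (1/2π) ∫ φ(θ) f̃₁(θ₁ + θ) conj f̃₂(θ₂ + θ) dθ`. -/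
noncomputable def convH (F₁ F₂ Φ : SLpm → ℂ) (θ₁ θ₂ : ℝ) : ℂ :=
  1 / (2 * π) * ∫ θ in (0 : ℝ)..(2 * π), convIntegrand F₁ F₂ Φ θ₁ θ₂ θ

/-- The integrand of the double integral over the circle. -/
noncomputable def circleIntegrand (l₁ l₂ : ℝ) (s : ℂ) (F₁ F₂ Φ : SLpm → ℂ) (θ₁ θ₂ : ℝ) : ℂ :=
  ((|sin (θ₁ - θ₂)| : ℝ) : ℂ) ^ (-uParam l₁ l₂ s) *
    ((|sin θ₁| : ℝ) : ℂ) ^ (-1 + uParam l₁ l₂ s + Complex.I * l₁) *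
    ((|sin θ₂| : ℝ) : ℂ) ^ (-1 + uParam l₁ l₂ s - Complex.I * l₂) *
    convH F₁ F₂ Φ θ₁ θ₂

/-!
By the Iwasawa decomposition a homogeneous function on `G` is determined by its restriction to `K`
or, off a null set, to the unipotent group `n_x`; the two pictures are related by `θ = cot⁻¹ x`.

Absolute convergence and continuity of `T` are Cauchy–Schwarz for `f₁` and `f₂` in the variable
`θ`, uniformly in `(θ₁, θ₂)`, together with the integrability of
`|sin (θ₁ - θ₂)|^(-σ) |sin θ₁|^(σ-1) |sin θ₂|^(σ-1)` for `0 < σ < 1`.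

For equivariance the substitution by `cot` turns the circle kernel into the Riesz kernel
`|x - y|^(-u)`. The pairing of the functions `f₁(g n_x)` and `f₂(g n_y)` against it is a function
of `g` that is homogeneous under upper triangular matrices, and its product with `φ_s` has the
degree `-2` for which integration over `K` is invariant under left translation by all of `G`.

On smooth vectors, `Wh_f(k_θ d_a)` is a power of `|a|` times the Fourier transform of
`x ↦ f(k_θ n_x)` at `t = (a|a|)⁻¹`. The inner integral over `a` becomes
`∫ |t|^(u-1) f̂₁(t) conj f̂₂(t) dt`, and the functional equation of the Riesz kernel (its Fourier
transform is `G₀(u) |t|^(u-1)`, proved by writing both powers as Mellin transforms of Gaussians)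
identifies it with `G₀(u)` times the pairing above. As `f(k_θ n_x)` decays only like `1/|x|`, that
identity is first proved for the truncations to `[-R, R]`; an integration by parts, uniform in `R`,
gives the domination needed for `R → ∞`.
-/

/-! ### The group `SL^±(2, ℝ)` and its Iwasawa coordinates -/

namespace SLpm

theorem ext_entry {g h : SLpm} (H : ∀ i j, entry g i j = entry h i j) : g = h :=
  Subtype.ext <| Units.ext <| Matrix.ext H

theorem entry_mul (g h : SLpm) (i j : Fin 2) :
    entry (g * h) i j = entry g i 0 * entry h 0 j + entry g i 1 * entry h 1 j := by
  simp [entry, Matrix.mul_apply, Fin.sum_univ_two]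

@[simp] theorem entry_ofMatrix (m : Matrix (Fin 2) (Fin 2) ℝ) (h) (i j : Fin 2) :
    entry (ofMatrix m h) i j = m i j := rfl

@[simp] theorem entry_one (i j : Fin 2) : entry 1 i j = if i = j then 1 else 0 := by
  simp [entry, Matrix.one_apply]

theorem entry_diag {a : ℝ} (ha : a ≠ 0) (i j : Fin 2) :
    entry (diag a) i j = !![a, 0; 0, |a|⁻¹] i j := by
  simp [diag, ha]

theorem det_entry (g : SLpm) :
    entry g 0 0 * entry g 1 1 - entry g 0 1 * entry g 1 0 = 1 ∨
    entry g 0 0 * entry g 1 1 - entry g 0 1 * entry g 1 0 = -1 := by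
  simpa [SLpm, Matrix.det_fin_two, entry] using g.2

theorem abs_entry_one_one {p : SLpm} (hp : entry p 0 1 * entry p 1 0 = 0) :
    |entry p 1 1| = |entry p 0 0|⁻¹ := by
  have hdet := det_entry p
  rw [hp, sub_zero] at hdet
  refine eq_inv_of_mul_eq_one_right ?_
  rw [← abs_mul]
  rcases hdet with h | h <;> simp [h]

theorem rot_add (α β : ℝ) : rot (α + β) = rot α * rot β := by
  refine ext_entry fun i j => ?_
  fin_cases i <;> fin_cases j <;> simp [entry_mul, rot, cos_add, sin_add] <;> ring

theorem rot_zero : rot 0 = 1 := by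
  refine ext_entry fun i j => ?_
  fin_cases i <;> fin_cases j <;> simp [rot]

theorem rot_neg (α : ℝ) : rot (-α) = (rot α)⁻¹ := by
  rw [eq_inv_iff_mul_eq_one, ← rot_add, neg_add_cancel, rot_zero]

theorem rot_add_two_pi (α : ℝ) : rot (α + 2 * π) = rot α := by
  refine ext_entry fun i j => ?_
  fin_cases i <;> fin_cases j <;> simp [rot]

theorem unip_add (x y : ℝ) : unip (x + y) = unip x * unip y := by
  refine ext_entry fun i j => ?_
  fin_cases i <;> fin_cases j <;> simp [entry_mul, unip, add_comm]

theorem unip_zero : unip 0 = 1 := by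
  refine ext_entry fun i j => ?_
  fin_cases i <;> fin_cases j <;> simp [unip]

theorem unip_neg (x : ℝ) : unip (-x) = (unip x)⁻¹ := by
  rw [eq_inv_iff_mul_eq_one, ← unip_add, neg_add_cancel, unip_zero]

theorem diag_mul_unip {a : ℝ} (ha : a ≠ 0) (x : ℝ) :
    diag a * unip x = unip (a * |a| * x) * diag a := by
  refine ext_entry fun i j => ?_
  have : |a| ≠ 0 := abs_ne_zero.2 ha
  fin_cases i <;> fin_cases j <;> simp [entry_mul, unip, entry_diag ha, mul_right_comm _ x, this]

theorem diag_inv {a : ℝ} (ha : a ≠ 0) : (diag a)⁻¹ = diag a⁻¹ := by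
  rw [inv_eq_iff_mul_eq_one]
  refine ext_entry fun i j => ?_
  fin_cases i <;> fin_cases j <;>
    simp [entry_mul, entry_diag ha, entry_diag (inv_ne_zero ha), ha]

theorem eq_diag_mul_unip {p : SLpm} {a : ℝ} (ha : a ≠ 0) (h00 : entry p 0 0 = a)
    (h10 : entry p 1 0 = 0) (h11 : entry p 1 1 = |a|⁻¹) :
    p = diag a * unip (entry p 0 1 / a) := by
  refine ext_entry fun i j => ?_
  fin_cases i <;> fin_cases j <;> simp [entry_mul, entry_diag ha, unip, h00, h10, h11]
  field_simp

/-- The first column of an element of `SL^±(2, ℝ)`, as a complex number, so that left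
multiplication by `k_θ` is multiplication by `e^{iθ}` and the polar coordinates of the column are
the `K` and `A` coordinates of the Iwasawa decomposition. -/
noncomputable def firstCol (g : SLpm) : ℂ := ⟨entry g 0 0, entry g 1 0⟩

theorem firstCol_ne_zero (g : SLpm) : firstCol g ≠ 0 := by
  intro h
  have h00 : entry g 0 0 = 0 := congrArg Complex.re h
  have h10 : entry g 1 0 = 0 := congrArg Complex.im h
  rcases det_entry g with h | h <;> simp [h00, h10] at h

theorem exists_eq_rot_mul_upper {g : SLpm} {r γ : ℝ}
    (h : firstCol g = r * Complex.exp (γ * Complex.I)) :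
    ∃ p : SLpm, g = rot γ * p ∧ entry p 1 0 = 0 ∧ entry p 0 0 = r := by
  have h00 : entry g 0 0 = r * cos γ := by
    simpa [Complex.exp_ofReal_mul_I_re, firstCol] using congrArg Complex.re h
  have h10 : entry g 1 0 = r * sin γ := by
    simpa [Complex.exp_ofReal_mul_I_im, firstCol] using congrArg Complex.im h
  refine ⟨rot (-γ) * g, by rw [rot_neg, mul_inv_cancel_left], ?_, ?_⟩
  · simp only [entry_mul, rot, h00, h10, entry_ofMatrix, sin_neg, cos_neg, Matrix.of_apply,
      Matrix.cons_val]
    ring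
  · simp only [entry_mul, rot, h00, h10, entry_ofMatrix, sin_neg, cos_neg, Matrix.of_apply,
      Matrix.cons_val]
    linear_combination r * sin_sq_add_cos_sq γ

theorem exists_rot_mul_diag_mul_unip (g : SLpm) :
    ∃ θ a x : ℝ, a ≠ 0 ∧ g = rot θ * diag a * unip x := by
  set z := firstCol g
  set r := ‖z‖
  have hr : 0 < r := norm_pos_iff.2 (firstCol_ne_zero g)
  obtain ⟨p, hgp, h10, h00⟩ := exists_eq_rot_mul_upper (Complex.norm_mul_exp_arg_mul_I z).symm
  have h11 : |entry p 1 1| = r⁻¹ := by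
    rw [abs_entry_one_one (by simp [h10]), h00, abs_of_pos hr]
  rcases eq_or_eq_neg_of_abs_eq h11 with h11 | h11
  · have hp := eq_diag_mul_unip hr.ne' h00 h10 (by rw [h11, abs_of_pos hr])
    exact ⟨z.arg, r, _, hr.ne', by rw [mul_assoc, ← hp, hgp]⟩
  · have hp := eq_diag_mul_unip (p := rot (-π) * p) (neg_ne_zero.2 hr.ne')
      (by simp [entry_mul, rot, h00, r]) (by simp [entry_mul, rot, h10])
      (by simp [entry_mul, rot, h11, abs_of_pos hr])
    refine ⟨z.arg + π, -r, entry (rot (-π) * p) 0 1 / -r, neg_ne_zero.2 hr.ne', ?_⟩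
    rw [mul_assoc, ← hp, rot_add, rot_neg, mul_assoc, mul_inv_cancel_left, hgp]

theorem induction_generators {P : SLpm → Prop} (hmul : ∀ g h, P g → P h → P (g * h))
    (hrot : ∀ θ, P (rot θ)) (hdiag : ∀ a, a ≠ 0 → P (diag a)) (hunip : ∀ x, P (unip x))
    (g : SLpm) : P g := by
  obtain ⟨θ, a, x, ha, rfl⟩ := exists_rot_mul_diag_mul_unip g
  exact hmul _ _ (hmul _ _ (hrot θ) (hdiag a ha)) (hunip x)

theorem exists_unip_eq_rot_mul_lower (x : ℝ) :
    ∃ p : SLpm, unip x = rot (-arctan x) * p ∧ entry p 0 1 = 0 ∧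
      entry p 0 0 = (√(1 + x ^ 2))⁻¹ := by
  refine ⟨rot (arctan x) * unip x, by rw [rot_neg, inv_mul_cancel_left], ?_, ?_⟩
  · simp [entry_mul, rot, unip, cos_arctan, sin_arctan, div_eq_inv_mul]
  · simp [entry_mul, rot, unip, cos_arctan]

theorem entry_weyl_conj (p : SLpm) :
    entry ((rot (π / 2))⁻¹ * p * rot (π / 2)) 0 0 = entry p 1 1 ∧
    entry ((rot (π / 2))⁻¹ * p * rot (π / 2)) 0 1 = -entry p 1 0 ∧
    entry ((rot (π / 2))⁻¹ * p * rot (π / 2)) 1 0 = -entry p 0 1 := by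
  rw [← rot_neg]
  refine ⟨?_, ?_, ?_⟩ <;> simp [entry_mul, rot]

theorem contDiff_firstCol_mul_rot (g : SLpm) : ContDiff ℝ ∞ (fun θ => firstCol (g * rot θ)) := by
  have hcol (θ : ℝ) : firstCol (g * rot θ) =
      Complex.equivRealProdCLM.symm
        (entry g 0 0 * cos θ + entry g 0 1 * sin θ, entry g 1 0 * cos θ + entry g 1 1 * sin θ) := by
    apply Complex.ext <;> simp [firstCol, entry_mul, rot]
  simp_rw [hcol]
  exact Complex.equivRealProdCLM.symm.contDiff.comp (ContDiff.prodMk (by fun_prop) (by fun_prop))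

end SLpm

@[simp] theorem leftTranslate_apply (g : SLpm) (F : SLpm → ℂ) (h : SLpm) :
    leftTranslate g F h = F (g⁻¹ * h) := rfl

theorem leftTranslate_mul (g h : SLpm) (F : SLpm → ℂ) :
    leftTranslate (g * h) F = leftTranslate g (leftTranslate h F) := by
  funext x
  simp [mul_assoc]

theorem ofReal_inv_cpow {x : ℝ} (hx : 0 ≤ x) (c : ℂ) :
    ((x⁻¹ : ℝ) : ℂ) ^ c = (x : ℂ) ^ (-c) := by
  rw [Complex.ofReal_inv, Complex.inv_cpow, Complex.cpow_neg]
  rw [Complex.arg_ofReal_of_nonneg hx]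
  exact pi_pos.ne

/-- Homogeneity of degree `c` under the lower triangular subgroup: these are the sections over
`G / P̄` that make up the series of the compact and noncompact pictures `f̃` and `f(x)`. -/
def IsLowerHomogeneous (c : ℂ) (F : SLpm → ℂ) : Prop :=
  ∀ g p : SLpm, entry p 0 1 = 0 → F (g * p) = ((|entry p 0 0| : ℝ) : ℂ) ^ c * F g

/-- Homogeneity of degree `c` under the upper triangular subgroup: these are the sections over
`G / P` to which `φ_s` belongs. -/
def IsUpperHomogeneous (c : ℂ) (F : SLpm → ℂ) : Prop :=
  ∀ g p : SLpm, entry p 1 0 = 0 → F (g * p) = ((|entry p 0 0| : ℝ) : ℂ) ^ c * F g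

namespace IsUpperHomogeneous

variable {c : ℂ} {Φ : SLpm → ℂ}

theorem translate (hΦ : IsUpperHomogeneous c Φ) (g : SLpm) :
    IsUpperHomogeneous c (leftTranslate g Φ) := fun h p hp => by
  simp [← mul_assoc, hΦ _ p hp]

theorem comp_mul_weyl (hΦ : IsUpperHomogeneous c Φ) :
    IsLowerHomogeneous (-c) (fun g => Φ (g * rot (π / 2))) := by
  intro g p hp
  obtain ⟨h00, -, h10⟩ := entry_weyl_conj p
  have h := hΦ (g * rot (π / 2)) _ (h10.trans (by simp [hp]))
  rw [h00, abs_entry_one_one (by simp [hp]), ofReal_inv_cpow (abs_nonneg _)] at h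
  rw [← h]
  group

theorem apply_eq_of_firstCol_eq (hΦ : IsUpperHomogeneous c Φ) {g : SLpm} {γ : ℝ}
    (hγ : firstCol g = ‖firstCol g‖ * Complex.exp (γ * Complex.I)) :
    Φ g = Complex.exp (Real.log ‖firstCol g‖ * c) * Φ (rot γ) := by
  have hr : 0 < ‖firstCol g‖ := norm_pos_iff.2 (firstCol_ne_zero g)
  obtain ⟨p, hgp, h10, h00⟩ := exists_eq_rot_mul_upper hγ
  conv_lhs => rw [hgp]
  rw [hΦ _ _ h10, h00, abs_of_pos hr, Complex.cpow_def_of_ne_zero (by exact_mod_cast hr.ne'),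
    Complex.ofReal_log hr.le]

end IsUpperHomogeneous

theorem norm_mul_exp_arg_add_arg_div {z w : ℂ} (hw : w ≠ 0) :
    z = ‖z‖ * Complex.exp ((w.arg + (z / w).arg : ℝ) * Complex.I) := by
  have hnorm : (‖z‖ : ℂ) = ‖w‖ * ‖z / w‖ := by
    rw [norm_div]
    push_cast
    rw [mul_div_cancel₀ _ (by simpa using hw)]
  calc z = w * (z / w) := (mul_div_cancel₀ _ hw).symm
    _ = ‖w‖ * Complex.exp (w.arg * Complex.I) *
        (‖z / w‖ * Complex.exp ((z / w).arg * Complex.I)) := by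
      rw [Complex.norm_mul_exp_arg_mul_I, Complex.norm_mul_exp_arg_mul_I]
    _ = _ := by
      rw [hnorm, Complex.ofReal_add, add_mul, Complex.exp_add]
      ring

theorem contDiffAt_arg_div_self {E : Type*} [NormedAddCommGroup E] [NormedSpace ℝ E]
    {n : WithTop ℕ∞} {z : E → ℂ} {x₀ : E} (hz : ContDiffAt ℝ n z x₀) (h₀ : z x₀ ≠ 0) :
    ContDiffAt ℝ n (fun x => (z x / z x₀).arg) x₀ := by
  have hlog : ContDiffAt ℝ n Complex.log (z x₀ / z x₀) :=
    (Complex.contDiffAt_log (by simp [h₀])).restrict_scalars ℝ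
  simp_rw [← Complex.log_im]
  exact Complex.imCLM.contDiff.contDiffAt.comp x₀
    (hlog.comp x₀ (f := fun x => z x / z x₀) (hz.div_const _))

/-- Near each angle the Iwasawa angle of `g k_θ` has a smooth branch, because it is the argument of
the first column. -/
theorem IsUpperHomogeneous.contDiff_mul_rot {c : ℂ} {Φ : SLpm → ℂ} (hΦ : IsUpperHomogeneous c Φ)
    (hs : ContDiff ℝ ∞ (fun θ => Φ (rot θ))) (g : SLpm) :
    ContDiff ℝ ∞ (fun θ => Φ (g * rot θ)) := by
  rw [contDiff_iff_contDiffAt]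
  intro θ₀
  set z : ℝ → ℂ := fun θ => firstCol (g * rot θ)
  have hz : ContDiffAt ℝ ∞ z θ₀ := (contDiff_firstCol_mul_rot g).contDiffAt
  have hz0 (θ : ℝ) : z θ ≠ 0 := firstCol_ne_zero _
  have hΦz (θ : ℝ) : Φ (g * rot θ) =
      Complex.exp (Real.log ‖z θ‖ * c) * Φ (rot ((z θ₀).arg + (z θ / z θ₀).arg)) :=
    hΦ.apply_eq_of_firstCol_eq (norm_mul_exp_arg_add_arg_div (hz0 θ₀))
  simp_rw [hΦz]
  refine ContDiffAt.mul (ContDiffAt.cexp (ContDiffAt.mul ?_ contDiffAt_const)) ?_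
  · exact Complex.ofRealCLM.contDiff.contDiffAt.comp θ₀ (f := fun θ => Real.log ‖z θ‖)
      ((hz.norm ℝ (hz0 _)).log (norm_ne_zero_iff.2 (hz0 _)))
  · exact hs.contDiffAt.comp θ₀ (f := fun θ => (z θ₀).arg + (z θ / z θ₀).arg)
      (contDiffAt_const.add (contDiffAt_arg_div_self hz (hz0 _)))

namespace IsLowerHomogeneous

variable {c : ℂ} {F : SLpm → ℂ}

theorem translate (hF : IsLowerHomogeneous c F) (g : SLpm) :
    IsLowerHomogeneous c (leftTranslate g F) := fun h p hp => by
  simp [← mul_assoc, hF _ p hp]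

theorem comp_mul_weyl (hF : IsLowerHomogeneous c F) :
    IsUpperHomogeneous (-c) (fun g => F (g * rot (π / 2))) := by
  intro g p hp
  obtain ⟨h00, h01, -⟩ := entry_weyl_conj p
  have h := hF (g * rot (π / 2)) _ (h01.trans (by simp [hp]))
  rw [h00, abs_entry_one_one (by simp [hp]), ofReal_inv_cpow (abs_nonneg _)] at h
  rw [← h]
  group

theorem apply_mul_rot_add_pi (hF : IsLowerHomogeneous c F) (g : SLpm) (θ : ℝ) :
    F (g * rot (θ + π)) = F (g * rot θ) := by
  rw [rot_add, ← mul_assoc, hF _ (rot π) (by simp [rot])]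
  simp [rot]

theorem periodic_rot (hF : IsLowerHomogeneous c F) : Function.Periodic (fun θ => F (rot θ)) π :=
  fun θ => by simpa using hF.apply_mul_rot_add_pi 1 θ

theorem apply_mul_unip (hF : IsLowerHomogeneous c F) (g : SLpm) (x : ℝ) :
    F (g * unip x) = ((√(1 + x ^ 2) : ℝ) : ℂ) ^ (-c) * F (g * rot (-arctan x)) := by
  obtain ⟨p, hp, h01, h00⟩ := exists_unip_eq_rot_mul_lower x
  rw [hp, ← mul_assoc, hF _ _ h01, h00, abs_of_nonneg (by positivity),
    ofReal_inv_cpow (by positivity)]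

theorem apply_unip (hF : IsLowerHomogeneous c F) (x : ℝ) :
    F (unip x) = ((√(1 + x ^ 2) : ℝ) : ℂ) ^ (-c) * F (rot (-arctan x)) := by
  simpa using hF.apply_mul_unip 1 x

theorem apply_mul_diag_mul_unip (hF : IsLowerHomogeneous c F) (g : SLpm) {a : ℝ} (ha : a ≠ 0)
    (x : ℝ) : F (g * diag a * unip x) = ((|a| : ℝ) : ℂ) ^ c * F (g * unip (a * |a| * x)) := by
  rw [mul_assoc, diag_mul_unip ha, ← mul_assoc, hF _ (diag a) (by simp [entry_diag ha])]
  simp [entry_diag ha]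

theorem contDiff_mul_rot (hF : IsLowerHomogeneous c F) (hs : ContDiff ℝ ∞ (fun θ => F (rot θ)))
    (g : SLpm) : ContDiff ℝ ∞ (fun θ => F (g * rot θ)) := by
  have hs' : ContDiff ℝ ∞ (fun θ => F (rot θ * rot (π / 2))) := by
    simp_rw [← rot_add]
    exact hs.comp (contDiff_id.add contDiff_const)
  have hshift (θ : ℝ) : F (g * rot θ) = F (g * rot (θ - π / 2) * rot (π / 2)) := by
    rw [mul_assoc, ← rot_add, sub_add_cancel]
  simp_rw [hshift]
  exact (hF.comp_mul_weyl.contDiff_mul_rot hs' g).comp (contDiff_id.sub contDiff_const)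

end IsLowerHomogeneous

/-! ### Compact and noncompact pictures -/

section Periodic

variable {E : Type*} [NormedAddCommGroup E] {f : ℝ → E} {T : ℝ}

theorem exists_norm_le_of_periodic (hf : Function.Periodic f T) (hT : 0 < T) (hc : Continuous f) :
    ∃ S, 0 ≤ S ∧ ∀ θ, ‖f θ‖ ≤ S := by
  obtain ⟨S, hS⟩ := (isCompact_Icc (a := 0) (b := T)).exists_bound_of_continuousOn hc.continuousOn
  have hS' (θ : ℝ) : ‖f θ‖ ≤ S := by
    obtain ⟨y, hy, h⟩ := hf.exists_mem_Ico₀ hT θ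
    rw [h]
    exact hS y ⟨hy.1, hy.2.le⟩
  exact ⟨S, (norm_nonneg _).trans (hS' 0), hS'⟩

theorem measurePreserving_add_left_Ioc (c a b : ℝ) :
    MeasurePreserving (fun x => c + x) (volume.restrict (Ioc a b))
      (volume.restrict (Ioc (c + a) (c + b))) := by
  simpa using (measurePreserving_add_left volume c).restrict_preimage
    (measurableSet_Ioc (a := c + a) (b := c + b))

theorem aestronglyMeasurable_of_periodic (hf : Function.Periodic f T) (hT : 0 < T) {a : ℝ}
    (hm : AEStronglyMeasurable f (volume.restrict (Ioc a (a + T)))) : AEStronglyMeasurable f := by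
  rw [← Measure.restrict_univ (μ := volume), ← iUnion_Ioc_add_zsmul hT a,
    aestronglyMeasurable_iUnion_iff]
  intro n
  have hshift := measurePreserving_add_left_Ioc (-(n • T)) (a + n • T) (a + (n + 1) • T)
  rw [neg_add_cancel_comm_assoc, show -(n • T) + (a + (n + 1) • T) = a + T by
    rw [add_smul, one_smul]; ring] at hshift
  refine (hm.comp_measurePreserving hshift).congr (Eventually.of_forall fun x => ?_)
  simpa [neg_add_eq_sub] using hf.sub_zsmul_eq n

theorem memLp_Ioc_of_periodic (hf : Function.Periodic f T) (hT : 0 < T) {p : ENNReal} (hp₀ : p ≠ 0)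
    (hp : p ≠ ⊤) {a : ℝ} (hm : MemLp f p (volume.restrict (Ioc a (a + T)))) (b c : ℝ) :
    MemLp f p (volume.restrict (Ioc b c)) := by
  have hmeas := aestronglyMeasurable_of_periodic hf hT hm.1
  have hnorm : Function.Periodic (fun x => ‖f x‖ ^ p.toReal) T := fun x => by simp only [hf x]
  rw [← integrable_norm_rpow_iff hmeas.restrict hp₀ hp] at hm ⊢
  exact (hnorm.intervalIntegrable hT.ne'
    ((intervalIntegrable_iff_integrableOn_Ioc_of_le (by linarith)).2 hm) b c).1

end Periodic

section PeriodMeasure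

variable {E : Type*} [NormedAddCommGroup E] {f : ℝ → E}

instance : IsFiniteMeasure periodMeasure := by
  unfold periodMeasure
  infer_instance

theorem aestronglyMeasurable_of_periodMeasure (hf : Function.Periodic f (2 * π))
    (hm : AEStronglyMeasurable f periodMeasure) : AEStronglyMeasurable f :=
  aestronglyMeasurable_of_periodic hf two_pi_pos (a := 0) (by simpa [periodMeasure] using hm)

theorem memLp_periodMeasure_comp_add (hf : Function.Periodic f (2 * π)) {p : ENNReal}
    (hp₀ : p ≠ 0) (hp : p ≠ ⊤) (hm : MemLp f p periodMeasure) (a : ℝ) :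
    MemLp (fun θ => f (a + θ)) p periodMeasure :=
  (memLp_Ioc_of_periodic hf two_pi_pos hp₀ hp (a := 0) (by simpa [periodMeasure] using hm)
    (a + 0) (a + 2 * π)).comp_measurePreserving (measurePreserving_add_left_Ioc a 0 (2 * π))

theorem integrable_periodMeasure_comp_add (hf : Function.Periodic f (2 * π))
    (hi : Integrable f periodMeasure) (a : ℝ) :
    Integrable (fun θ => f (a + θ)) periodMeasure := by
  rw [← memLp_one_iff_integrable] at hi ⊢
  exact memLp_periodMeasure_comp_add hf one_ne_zero ENNReal.one_ne_top hi a

variable [NormedSpace ℝ E]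

theorem integral_periodMeasure (f : ℝ → E) :
    ∫ θ, f θ ∂periodMeasure = ∫ θ in 0..2 * π, f θ := by
  rw [intervalIntegral.integral_of_le two_pi_pos.le, periodMeasure]

theorem integral_periodMeasure_comp_add (hf : Function.Periodic f (2 * π)) (a : ℝ) :
    ∫ θ, f (a + θ) ∂periodMeasure = ∫ θ, f θ ∂periodMeasure := by
  rw [integral_periodMeasure, integral_periodMeasure, intervalIntegral.integral_comp_add_left]
  simpa using hf.intervalIntegral_add_eq a 0

theorem periodic_comp_rot {X : Type*} (F : SLpm → X) :
    Function.Periodic (fun θ => F (rot θ)) (2 * π) :=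
  fun θ => by simp only [rot_add_two_pi]

end PeriodMeasure

section Arctan

variable {E : Type*} [NormedAddCommGroup E]

theorem measurableEmbedding_neg_arctan : MeasurableEmbedding (fun x : ℝ => -arctan x) :=
  (by fun_prop : Continuous fun x : ℝ => -arctan x).measurableEmbedding
    fun _ _ h => arctan_injective (neg_injective h)

theorem image_neg_arctan : (fun x : ℝ => -arctan x) '' univ = Ioo (-(π / 2)) (π / 2) := by
  rw [← Function.comp_def Neg.neg arctan, image_comp, image_univ, range_arctan]
  simp

theorem hasDerivWithinAt_neg_arctan (x : ℝ) :
    HasDerivWithinAt (fun x : ℝ => -arctan x) (-(1 / (1 + x ^ 2))) univ x :=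
  (hasDerivAt_arctan x).neg.hasDerivWithinAt

theorem abs_deriv_neg_arctan (x : ℝ) : |-(1 / (1 + x ^ 2))| = (1 + x ^ 2)⁻¹ := by
  rw [abs_neg, one_div, abs_of_pos (by positivity)]

theorem integrableOn_iff_integrable_comp_neg_arctan [NormedSpace ℝ E] (h : ℝ → E) :
    IntegrableOn h (Ioo (-(π / 2)) (π / 2)) ↔
      Integrable (fun x : ℝ => (1 + x ^ 2)⁻¹ • h (-arctan x)) := by
  rw [← image_neg_arctan, integrableOn_image_iff_integrableOn_abs_deriv_smul MeasurableSet.univ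
    (fun x _ => hasDerivWithinAt_neg_arctan x) measurableEmbedding_neg_arctan.injective.injOn,
    integrableOn_univ]
  simp only [abs_deriv_neg_arctan]

theorem integral_eq_integral_comp_neg_arctan [NormedSpace ℝ E] (h : ℝ → E) :
    ∫ θ in -(π / 2)..π / 2, h θ = ∫ x : ℝ, (1 + x ^ 2)⁻¹ • h (-arctan x) := by
  rw [intervalIntegral.integral_of_le (by linarith [pi_pos]), integral_Ioc_eq_integral_Ioo,
    ← image_neg_arctan, integral_image_eq_integral_abs_deriv_smul MeasurableSet.univ
      (fun x _ => hasDerivWithinAt_neg_arctan x) measurableEmbedding_neg_arctan.injective.injOn]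
  simp only [abs_deriv_neg_arctan, Measure.restrict_univ]

theorem aestronglyMeasurable_iff_comp_neg_arctan (h : ℝ → E) :
    AEStronglyMeasurable h (volume.restrict (Ioo (-(π / 2)) (π / 2))) ↔
      AEStronglyMeasurable (fun x : ℝ => h (-arctan x)) := by
  have hmap := map_withDensity_abs_det_fderiv_eq_addHaar volume MeasurableSet.univ.nullMeasurableSet
    (fun x _ => (hasDerivWithinAt_neg_arctan x).hasFDerivWithinAt)
    measurableEmbedding_neg_arctan.injective.injOn
  simp only [ContinuousLinearMap.det_toSpanSingleton, abs_deriv_neg_arctan, image_neg_arctan,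
    Measure.restrict_univ] at hmap
  rw [← hmap, measurableEmbedding_neg_arctan.aestronglyMeasurable_map_iff]
  refine ⟨fun H => H.mono_ac (withDensity_absolutelyContinuous' (by fun_prop) ?_),
    fun H => H.mono_ac (withDensity_absolutelyContinuous _ _)⟩
  refine Eventually.of_forall fun x => ?_
  rw [ne_eq, ENNReal.ofReal_eq_zero, not_le]
  positivity

theorem memLp_periodMeasure_iff_of_periodic_pi {f : ℝ → E} (hf : Function.Periodic f π)
    {p : ENNReal} (hp₀ : p ≠ 0) (hp : p ≠ ⊤) :
    MemLp f p periodMeasure ↔ MemLp f p (volume.restrict (Ioo (-(π / 2)) (π / 2))) := by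
  have hf₂ : Function.Periodic f (2 * π) := by simpa using hf.nat_mul 2
  rw [periodMeasure, Measure.restrict_congr_set (Ioo_ae_eq_Ioc (μ := volume))]
  constructor <;> intro H
  · exact memLp_Ioc_of_periodic hf₂ two_pi_pos hp₀ hp (a := 0) (by rwa [zero_add]) _ _
  · exact memLp_Ioc_of_periodic hf pi_pos hp₀ hp (a := -(π / 2))
      (by rwa [show -(π / 2) + π = π / 2 by ring]) _ _

theorem integral_two_pi_of_periodic_pi [NormedSpace ℝ E] {f : ℝ → E} (hf : Function.Periodic f π) :
    ∫ θ in 0..2 * π, f θ = (2 : ℝ) • ∫ x : ℝ, (1 + x ^ 2)⁻¹ • f (-arctan x) := by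
  have hπ : -(π / 2) + π = π / 2 := by ring
  rw [← integral_eq_integral_comp_neg_arctan]
  by_cases hi : IntervalIntegrable f volume 0 π
  · have h2π := hf.intervalIntegral_add_zsmul_eq 2 0 (hf.intervalIntegrable₀ pi_pos.ne' hi)
    rw [hf.intervalIntegral_add_eq 0 (-(π / 2)), hπ] at h2π
    simpa [two_smul, two_mul] using h2π
  · rw [intervalIntegral.integral_undef, intervalIntegral.integral_undef, smul_zero]
    · exact fun h => hi (hf.intervalIntegrable pi_pos.ne' (t := -(π / 2)) (by rwa [hπ]) 0 π)
    · refine fun h => hi (h.mono_set ?_)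
      rw [uIcc_of_le pi_pos.le, uIcc_of_le two_pi_pos.le]
      exact Icc_subset_Icc le_rfl (by linarith [pi_pos])

end Arctan

theorem norm_ofReal_sqrt_cpow (c : ℂ) (x : ℝ) :
    ‖((√(1 + x ^ 2) : ℝ) : ℂ) ^ c‖ = √(1 + x ^ 2) ^ c.re :=
  Complex.norm_cpow_eq_rpow_re_of_pos (by positivity) c

theorem continuous_ofReal_sqrt_cpow (c : ℂ) :
    Continuous (fun x : ℝ => ((√(1 + x ^ 2) : ℝ) : ℂ) ^ c) := by
  refine Continuous.cpow (by fun_prop) continuous_const fun x => Or.inl ?_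
  rw [Complex.ofReal_re]
  positivity

namespace IsLowerHomogeneous

variable {c : ℂ} {F : SLpm → ℂ}

theorem aestronglyMeasurable_unip_iff (hF : IsLowerHomogeneous c F) :
    AEStronglyMeasurable (fun x => F (unip x)) ↔
      AEStronglyMeasurable (fun x => F (rot (-arctan x))) := by
  have hinv (x : ℝ) : F (rot (-arctan x)) = ((√(1 + x ^ 2) : ℝ) : ℂ) ^ c * F (unip x) := by
    have hne : ((√(1 + x ^ 2) : ℝ) : ℂ) ≠ 0 := by
      norm_cast
      positivity
    rw [hF.apply_unip, ← mul_assoc, ← Complex.cpow_add _ _ hne, add_neg_cancel, Complex.cpow_zero,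
      one_mul]
  constructor <;> intro H
  · simp_rw [hinv]
    exact (continuous_ofReal_sqrt_cpow c).aestronglyMeasurable.mul H
  · simp_rw [hF.apply_unip]
    exact (continuous_ofReal_sqrt_cpow (-c)).aestronglyMeasurable.mul H

theorem norm_sq_apply_unip (hc : c.re = 1) (hF : IsLowerHomogeneous c F) (x : ℝ) :
    ‖F (unip x)‖ ^ 2 = (1 + x ^ 2)⁻¹ • ‖F (rot (-arctan x))‖ ^ 2 := by
  rw [hF.apply_unip, norm_mul, norm_ofReal_sqrt_cpow, Complex.neg_re, hc, Real.rpow_neg_one,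
    mul_pow, inv_pow, Real.sq_sqrt (by positivity), smul_eq_mul]

theorem memLp_rot_iff_unip (hc : c.re = 1) (hF : IsLowerHomogeneous c F) :
    MemLp (fun θ => F (rot θ)) 2 periodMeasure ↔ MemLp (fun x => F (unip x)) 2 := by
  have hmeas : AEStronglyMeasurable (fun θ => F (rot θ))
      (volume.restrict (Ioo (-(π / 2)) (π / 2))) ↔ AEStronglyMeasurable (fun x => F (unip x)) :=
    (aestronglyMeasurable_iff_comp_neg_arctan _).trans hF.aestronglyMeasurable_unip_iff.symm
  have hint : IntegrableOn (fun θ => ‖F (rot θ)‖ ^ 2) (Ioo (-(π / 2)) (π / 2)) ↔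
      Integrable (fun x => ‖F (unip x)‖ ^ 2) := by
    simp_rw [hF.norm_sq_apply_unip hc]
    exact integrableOn_iff_integrable_comp_neg_arctan _
  rw [memLp_periodMeasure_iff_of_periodic_pi hF.periodic_rot two_ne_zero ENNReal.ofNat_ne_top]
  constructor <;> intro H
  · rw [memLp_two_iff_integrable_sq_norm (hmeas.1 H.1), ← hint]
    exact (memLp_two_iff_integrable_sq_norm H.1).1 H
  · rw [memLp_two_iff_integrable_sq_norm (hmeas.2 H.1), ← IntegrableOn, hint]
    exact (memLp_two_iff_integrable_sq_norm H.1).1 H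

theorem leftTranslate_diag_apply_unip (hF : IsLowerHomogeneous c F) {a : ℝ} (ha : a ≠ 0) (x : ℝ) :
    leftTranslate (diag a) F (unip x) =
      ((|a⁻¹| : ℝ) : ℂ) ^ c * F (unip (a⁻¹ * |a⁻¹| * x)) := by
  simpa [diag_inv ha] using hF.apply_mul_diag_mul_unip 1 (inv_ne_zero ha) x

end IsLowerHomogeneous

theorem leftTranslate_unip_apply_unip (F : SLpm → ℂ) (y x : ℝ) :
    leftTranslate (unip y) F (unip x) = F (unip (-y + x)) := by
  rw [leftTranslate_apply, ← unip_neg, ← unip_add]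

theorem leftTranslate_rot_apply_rot (F : SLpm → ℂ) (α θ : ℝ) :
    leftTranslate (rot α) F (rot θ) = F (rot (-α + θ)) := by
  rw [leftTranslate_apply, ← rot_neg, ← rot_add]

theorem memLp_comp_mul_left {E : Type*} [NormedAddCommGroup E] {p : ENNReal} {f : ℝ → E}
    (hf : MemLp f p) {b : ℝ} (hb : b ≠ 0) : MemLp (fun x => f (b * x)) p := by
  have hscale : MemLp f p (Measure.map (b * ·) volume) := by
    rw [Real.map_volume_mul_left hb]
    exact hf.smul_measure ENNReal.ofReal_ne_top
  exact hscale.comp_of_map (by fun_prop)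

theorem memLp_rot_leftTranslate {c : ℂ} (hc : c.re = 1) (g : SLpm) {F : SLpm → ℂ}
    (hF : IsLowerHomogeneous c F) (hm : MemLp (fun θ => F (rot θ)) 2 periodMeasure) :
    MemLp (fun θ => leftTranslate g F (rot θ)) 2 periodMeasure := by
  induction g using induction_generators generalizing F with
  | hmul g h hg hh =>
    rw [leftTranslate_mul]
    exact hg (hF.translate h) (hh hF hm)
  | hrot α =>
    simp_rw [leftTranslate_rot_apply_rot]
    exact memLp_periodMeasure_comp_add (periodic_comp_rot F) two_ne_zero ENNReal.ofNat_ne_top hm _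
  | hdiag a ha =>
    rw [(hF.translate _).memLp_rot_iff_unip hc]
    simp_rw [hF.leftTranslate_diag_apply_unip ha]
    exact (memLp_comp_mul_left ((hF.memLp_rot_iff_unip hc).1 hm) (by simp [ha])).const_mul _
  | hunip y =>
    rw [(hF.translate _).memLp_rot_iff_unip hc]
    simp_rw [leftTranslate_unip_apply_unip]
    exact ((hF.memLp_rot_iff_unip hc).1 hm).comp_measurePreserving
      (measurePreserving_add_left volume (-y))

theorem IsLowerHomogeneous.integral_rot_eq_integral_unip {Ψ : SLpm → ℂ}
    (hΨ : IsLowerHomogeneous 2 Ψ) :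
    ∫ θ in 0..2 * π, Ψ (rot θ) = 2 * ∫ x : ℝ, Ψ (unip x) := by
  have hdensity (x : ℝ) : Ψ (unip x) = (1 + x ^ 2)⁻¹ • Ψ (rot (-arctan x)) := by
    rw [hΨ.apply_unip, Complex.cpow_neg, Complex.real_smul]
    norm_cast
    rw [Real.sq_sqrt (by positivity)]
  rw [integral_two_pi_of_periodic_pi hΨ.periodic_rot, Complex.real_smul]
  simp_rw [hdensity]
  norm_cast

/-- Homogeneity of degree `2` makes `Ψ` a density on `G / P̄`. -/
theorem IsLowerHomogeneous.integral_leftTranslate_rot (g : SLpm) {Ψ : SLpm → ℂ}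
    (hΨ : IsLowerHomogeneous 2 Ψ) :
    ∫ θ in 0..2 * π, leftTranslate g Ψ (rot θ) = ∫ θ in 0..2 * π, Ψ (rot θ) := by
  induction g using induction_generators generalizing Ψ with
  | hmul g h hg hh => rw [leftTranslate_mul, hg (hΨ.translate h), hh hΨ]
  | hrot α =>
    simp_rw [leftTranslate_rot_apply_rot, ← integral_periodMeasure]
    exact integral_periodMeasure_comp_add (periodic_comp_rot Ψ) (-α)
  | hdiag a ha =>
    rw [(hΨ.translate _).integral_rot_eq_integral_unip, hΨ.integral_rot_eq_integral_unip]
    simp_rw [hΨ.leftTranslate_diag_apply_unip ha]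
    rw [integral_const_mul, Measure.integral_comp_mul_left (fun x => Ψ (unip x)), Complex.real_smul,
      ← mul_assoc (_ ^ _)]
    have hjac : ((|a⁻¹| : ℝ) : ℂ) ^ (2 : ℂ) * (|(a⁻¹ * |a⁻¹|)⁻¹| : ℝ) = 1 := by
      have : |a| ≠ 0 := abs_ne_zero.2 ha
      simp only [abs_inv, abs_mul, abs_abs]
      norm_cast
      field_simp
    rw [hjac, one_mul]
  | hunip y =>
    rw [(hΨ.translate _).integral_rot_eq_integral_unip, hΨ.integral_rot_eq_integral_unip]
    simp_rw [leftTranslate_unip_apply_unip]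
    rw [integral_add_left_eq_self (fun x => Ψ (unip x)) (-y)]

theorem IsUpperHomogeneous.integral_leftTranslate_rot {Ψ : SLpm → ℂ}
    (hΨ : IsUpperHomogeneous (-2) Ψ) (g : SLpm) :
    ∫ θ in 0..2 * π, leftTranslate g Ψ (rot θ) = ∫ θ in 0..2 * π, Ψ (rot θ) := by
  have hweyl (Ψ' : SLpm → ℂ) :
      ∫ θ in 0..2 * π, Ψ' (rot θ) = ∫ θ in 0..2 * π, Ψ' (rot θ * rot (π / 2)) := by
    simp_rw [← rot_add, ← integral_periodMeasure, add_comm _ (π / 2)]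
    exact (integral_periodMeasure_comp_add (periodic_comp_rot Ψ') (π / 2)).symm
  have hlower : IsLowerHomogeneous 2 (fun h => Ψ (h * rot (π / 2))) := by
    simpa using hΨ.comp_mul_weyl
  rw [hweyl, hweyl, ← hlower.integral_leftTranslate_rot g]
  simp only [leftTranslate_apply, mul_assoc]

/-- Left translation as a representation on a translation invariant space of functions. -/
def leftTranslateRep (S : Submodule ℂ (SLpm → ℂ)) (hS : ∀ g, ∀ F ∈ S, leftTranslate g F ∈ S) :
    Representation ℂ SLpm S where
  toFun g :=
    { toFun := fun F => ⟨leftTranslate g F, hS g F F.2⟩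
      map_add' := fun _ _ => rfl
      map_smul' := fun _ _ => rfl }
  map_one' := LinearMap.ext fun F => Subtype.ext <| by
    funext x
    change F.1 (1⁻¹ * x) = F.1 x
    rw [inv_one, one_mul]
  map_mul' g h := LinearMap.ext fun F => Subtype.ext (leftTranslate_mul g h F.1)

theorem UnitarySeries.isLowerHomogeneous {l : ℝ} (f : UnitarySeries l) :
    IsLowerHomogeneous (Complex.I * l + 1) f := f.2.1

theorem SmoothSeries.isUpperHomogeneous {u : ℂ} (φ : SmoothSeries u) :
    IsUpperHomogeneous (-(u + 1)) φ := φ.2.1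

/-- The representation of `G` on `𝒫(iℓ, +)_e`. -/
noncomputable def unitaryRep (l : ℝ) : Representation ℂ SLpm (UnitarySeries l) :=
  leftTranslateRep (unitarySeriesSubmodule l) fun g _ hF =>
    ⟨IsLowerHomogeneous.translate hF.1 g, memLp_rot_leftTranslate (by simp) g hF.1 hF.2⟩

/-- The representation of `G` on `𝒫(u, +)_e^∞`. -/
noncomputable def smoothRep (u : ℂ) : Representation ℂ SLpm (SmoothSeries u) :=
  leftTranslateRep (smoothSeriesSubmodule u) fun g _ hF =>
    ⟨IsUpperHomogeneous.translate hF.1 g, IsUpperHomogeneous.contDiff_mul_rot hF.1 hF.2 g⁻¹⟩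

/-! ### The circle kernel -/

section Kernel

theorem integrable_abs_sin_rpow {a : ℝ} (ha : a < 1) :
    Integrable (fun θ => |sin θ| ^ (-a)) periodMeasure := by
  have hperiodic (T : ℝ) (hT : ∀ θ, |cos (θ + T)| = |cos θ|) :
      Function.Periodic (fun θ => |cos θ| ^ (-a)) T := fun θ => by simp only [hT]
  have hcos : IntegrableOn (fun θ => |cos θ| ^ (-a)) (Ioo (-(π / 2)) (π / 2)) := by
    rw [integrableOn_iff_integrable_comp_neg_arctan]
    have hdecay := integrable_rpow_neg_one_add_norm_sq (E := ℝ) (μ := volume) (r := 2 - a)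
      (by simp; linarith)
    refine hdecay.congr (Eventually.of_forall fun x => ?_)
    have hx : 0 < 1 + x ^ 2 := by positivity
    simp only [cos_neg, cos_arctan, norm_eq_abs, sq_abs, smul_eq_mul]
    rw [abs_of_pos (by positivity), one_div, Real.inv_rpow (by positivity),
      Real.rpow_neg (by positivity), inv_inv, Real.sqrt_eq_rpow, ← Real.rpow_mul hx.le,
      ← Real.rpow_neg_one, ← Real.rpow_add hx]
    ring_nf
  have hcos' : Integrable (fun θ => |cos θ| ^ (-a)) periodMeasure := by
    refine (intervalIntegrable_iff_integrableOn_Ioc_of_le two_pi_pos.le).1 <|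
      (hperiodic π (by simp)).intervalIntegrable pi_pos.ne' (t := -(π / 2)) ?_ 0 (2 * π)
    rwa [show -(π / 2) + π = π / 2 by ring,
      intervalIntegrable_iff_integrableOn_Ioo_of_le (by linarith [pi_pos])]
  refine (integrable_periodMeasure_comp_add (hperiodic (2 * π) (by simp)) hcos'
    (-(π / 2))).congr (Eventually.of_forall fun θ => ?_)
  simp only [neg_add_eq_sub, cos_sub_pi_div_two]

theorem rpow_mul_rpow_mul_rpow_le_sum {A B C σ : ℝ} (hA : 0 ≤ A) (hB : 0 ≤ B) (hC : 0 ≤ C)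
    (h₀ : 0 < σ) (h₁ : σ ≤ 2 / 3) :
    A ^ (-σ) * B ^ (-(1 - σ)) * C ^ (-(1 - σ)) ≤
      B ^ (-(1 - σ / 2)) * C ^ (-(1 - σ / 2)) + A ^ (-(1 - σ / 2)) * C ^ (-(1 - σ / 2)) +
        A ^ (-(1 - σ / 2)) * B ^ (-(1 - σ / 2)) := by
  set p := 1 - σ / 2 with hp
  have hp₀ : 0 < p := by linarith
  -- Weighted AM-GM; the weights are forced by comparing the exponents of `A`, `B` and `C`.
  obtain ⟨w, v, hw, hv, hw₁, hv₁, hsum, hpv, hpw⟩ : ∃ w v : ℝ, 0 ≤ w ∧ 0 ≤ v ∧ w ≤ 1 ∧ v ≤ 1 ∧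
      w + v + v = 1 ∧ p * v + p * v = σ ∧ p * w + p * v = 1 - σ := by
    refine ⟨(p - σ) / p, σ / (2 * p), div_nonneg (by linarith) hp₀.le, by positivity, ?_, ?_,
      ?_, ?_, ?_⟩
    · rw [div_le_one hp₀]; linarith
    · rw [div_le_one (by positivity)]; linarith
    all_goals field_simp; try ring
  have hsplit {X x y z : ℝ} (hX : 0 ≤ X) (hz : 0 < z) (h : p * x + p * y = z) :
      X ^ (-z) = (X ^ (-p)) ^ x * (X ^ (-p)) ^ y := by
    rw [← Real.rpow_mul hX, ← Real.rpow_mul hX, ← Real.rpow_add' hX (by linarith)]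
    congr 1
    linarith
  have hAMGM := Real.geom_mean_le_arith_mean3_weighted hw hv hv
    (p₁ := B ^ (-p) * C ^ (-p)) (p₂ := A ^ (-p) * C ^ (-p)) (p₃ := A ^ (-p) * B ^ (-p))
    (by positivity) (by positivity) (by positivity) hsum
  have hσ : 0 < 1 - σ := by linarith
  calc A ^ (-σ) * B ^ (-(1 - σ)) * C ^ (-(1 - σ))
      = (B ^ (-p) * C ^ (-p)) ^ w * (A ^ (-p) * C ^ (-p)) ^ v * (A ^ (-p) * B ^ (-p)) ^ v := by
        rw [hsplit hA h₀ hpv, hsplit hB hσ hpw, hsplit hC hσ hpw]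
        simp only [Real.mul_rpow (Real.rpow_nonneg hA _) (Real.rpow_nonneg hB _),
          Real.mul_rpow (Real.rpow_nonneg hA _) (Real.rpow_nonneg hC _),
          Real.mul_rpow (Real.rpow_nonneg hB _) (Real.rpow_nonneg hC _)]
        ring
    _ ≤ _ := hAMGM
    _ ≤ _ := add_le_add_three (mul_le_of_le_one_left (by positivity) hw₁)
        (mul_le_of_le_one_left (by positivity) hv₁) (mul_le_of_le_one_left (by positivity) hv₁)

theorem integrable_mul_comp_sub {f g : ℝ → ℝ} (hfm : Measurable f)
    (hfp : Function.Periodic f (2 * π)) (hfe : ∀ x, f (-x) = f x)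
    (hf : Integrable f periodMeasure) (hg : Integrable g periodMeasure) :
    Integrable (fun p : ℝ × ℝ => g p.1 * f (p.1 - p.2)) (periodMeasure.prod periodMeasure) := by
  have hsub (x y : ℝ) : f (x - y) = f (-x + y) := by rw [← hfe, neg_sub, neg_add_eq_sub]
  have hm : AEStronglyMeasurable (fun p : ℝ × ℝ => g p.1 * f (p.1 - p.2))
      (periodMeasure.prod periodMeasure) :=
    hg.1.comp_fst.mul (hfm.comp (measurable_fst.sub measurable_snd)).aestronglyMeasurable
  refine (integrable_prod_iff hm).2 ⟨Eventually.of_forall fun x => ?_, ?_⟩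
  · simp only [hsub]
    exact (integrable_periodMeasure_comp_add hfp hf (-x)).const_mul _
  · have hnorm : Function.Periodic (fun x => ‖f x‖) (2 * π) := fun x => by simp only [hfp x]
    simp_rw [norm_mul, integral_const_mul, hsub, integral_periodMeasure_comp_add hnorm]
    exact hg.norm.mul_const _

theorem integrable_abs_sin_rpow_mul_abs_sin_rpow {a b : ℝ} (ha : a < 1) (hb : b < 1) :
    Integrable (fun p : ℝ × ℝ => |sin p.1| ^ (-a) * |sin p.2| ^ (-b))
      (periodMeasure.prod periodMeasure) :=
  (integrable_abs_sin_rpow ha).mul_prod (integrable_abs_sin_rpow hb)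

theorem integrable_abs_sin_sub_rpow_mul_fst {a b : ℝ} (ha : a < 1) (hb : b < 1) :
    Integrable (fun p : ℝ × ℝ => |sin (p.1 - p.2)| ^ (-a) * |sin p.1| ^ (-b))
      (periodMeasure.prod periodMeasure) := by
  refine (integrable_mul_comp_sub (f := fun θ => |sin θ| ^ (-a)) (g := fun θ => |sin θ| ^ (-b))
    (by fun_prop) (fun θ => by simp) (fun θ => by simp) (integrable_abs_sin_rpow ha)
    (integrable_abs_sin_rpow hb)).congr (Eventually.of_forall fun p => mul_comm _ _)

theorem integrable_abs_sin_sub_rpow_mul_snd {a b : ℝ} (ha : a < 1) (hb : b < 1) :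
    Integrable (fun p : ℝ × ℝ => |sin (p.1 - p.2)| ^ (-a) * |sin p.2| ^ (-b))
      (periodMeasure.prod periodMeasure) := by
  refine (integrable_abs_sin_sub_rpow_mul_fst ha hb).swap.congr (Eventually.of_forall fun p => ?_)
  simp only [Function.comp_apply, Prod.fst_swap, Prod.snd_swap, ← neg_sub p.1 p.2, sin_neg, abs_neg]

theorem integrable_abs_sin_rpow_kernel {σ : ℝ} (h₀ : 0 < σ) (h₁ : σ < 1) :
    Integrable (fun p : ℝ × ℝ => |sin (p.1 - p.2)| ^ (-σ) * |sin p.1| ^ (-(1 - σ)) *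
      |sin p.2| ^ (-(1 - σ))) (periodMeasure.prod periodMeasure) := by
  have hm : AEStronglyMeasurable (fun p : ℝ × ℝ => |sin (p.1 - p.2)| ^ (-σ) *
      |sin p.1| ^ (-(1 - σ)) * |sin p.2| ^ (-(1 - σ))) (periodMeasure.prod periodMeasure) :=
    Measurable.aestronglyMeasurable (by fun_prop)
  rcases le_or_gt σ (2 / 3) with h | h
  · have hp : 1 - σ / 2 < 1 := by linarith
    refine (((integrable_abs_sin_rpow_mul_abs_sin_rpow hp hp).add
      (integrable_abs_sin_sub_rpow_mul_snd hp hp)).add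
      (integrable_abs_sin_sub_rpow_mul_fst hp hp)).mono' hm (Eventually.of_forall fun p => ?_)
    rw [norm_of_nonneg (by positivity)]
    exact rpow_mul_rpow_mul_rpow_le_sum (abs_nonneg _) (abs_nonneg _) (abs_nonneg _) h₀ h
  · have hp : 2 * (1 - σ) < 1 := by linarith
    refine ((integrable_abs_sin_sub_rpow_mul_fst h₁ hp).add
      (integrable_abs_sin_sub_rpow_mul_snd h₁ hp)).mono' hm (Eventually.of_forall fun p => ?_)
    have hsq (x : ℝ) : |sin x| ^ (-(2 * (1 - σ))) = (|sin x| ^ (-(1 - σ))) ^ 2 := by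
      rw [← Real.rpow_mul_natCast (abs_nonneg _)]
      congr 1
      push_cast
      ring
    rw [norm_of_nonneg (by positivity), Pi.add_apply, hsq, hsq, ← mul_add, mul_assoc]
    gcongr
    nlinarith [two_mul_le_add_sq (|sin p.1| ^ (-(1 - σ))) (|sin p.2| ^ (-(1 - σ))),
      sq_nonneg (|sin p.1| ^ (-(1 - σ))), sq_nonneg (|sin p.2| ^ (-(1 - σ)))]

/-- The kernel `|sin(θ₁ - θ₂)|^{-u} |sin θ₁|^{-1+u+iℓ₁} |sin θ₂|^{-1+u-iℓ₂}` against which the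
trilinear form integrates, as a function of the pair `(θ₁, θ₂)`. -/
noncomputable def circleKernel (l₁ l₂ : ℝ) (s : ℂ) (p : ℝ × ℝ) : ℂ :=
  ((|sin (p.1 - p.2)| : ℝ) : ℂ) ^ (-uParam l₁ l₂ s) *
    ((|sin p.1| : ℝ) : ℂ) ^ (-1 + uParam l₁ l₂ s + Complex.I * l₁) *
    ((|sin p.2| : ℝ) : ℂ) ^ (-1 + uParam l₁ l₂ s - Complex.I * l₂)

theorem uParam_re (l₁ l₂ : ℝ) (s : ℂ) : (uParam l₁ l₂ s).re = s.re := by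
  simp [uParam]

theorem norm_circleKernel (l₁ l₂ : ℝ) {s : ℂ} (hs₀ : 0 < s.re) (hs₁ : s.re < 1) (p : ℝ × ℝ) :
    ‖circleKernel l₁ l₂ s p‖ = |sin (p.1 - p.2)| ^ (-s.re) * |sin p.1| ^ (-(1 - s.re)) *
      |sin p.2| ^ (-(1 - s.re)) := by
  have hnorm (x : ℝ) {c : ℂ} {r : ℝ} (hc : c.re = r) (hr : r ≠ 0) :
      ‖((|sin x| : ℝ) : ℂ) ^ c‖ = |sin x| ^ r := by
    rw [Complex.norm_cpow_eq_rpow_re_of_nonneg (abs_nonneg _) (hc ▸ hr), hc]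
  rw [circleKernel, norm_mul, norm_mul, hnorm _ (r := -s.re) (by simp [uParam_re]) (by linarith),
    hnorm _ (r := -(1 - s.re)) (by simp [uParam_re]; ring) (by linarith),
    hnorm _ (r := -(1 - s.re)) (by simp [uParam_re]; ring) (by linarith)]

theorem measurable_circleKernel (l₁ l₂ : ℝ) (s : ℂ) : Measurable (circleKernel l₁ l₂ s) := by
  unfold circleKernel
  fun_prop

theorem integrable_circleKernel (l₁ l₂ : ℝ) {s : ℂ} (hs₀ : 0 < s.re) (hs₁ : s.re < 1) :
    Integrable (circleKernel l₁ l₂ s) (periodMeasure.prod periodMeasure) := by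
  rw [← integrable_norm_iff (measurable_circleKernel l₁ l₂ s).aestronglyMeasurable]
  simp_rw [norm_circleKernel l₁ l₂ hs₀ hs₁]
  exact integrable_abs_sin_rpow_kernel hs₀ hs₁

end Kernel

/-! ### The trilinear form -/

namespace UnitarySeries

variable {l : ℝ} (f f' : UnitarySeries l)

theorem coe_add : (f + f').1 = f.1 + f'.1 := rfl

theorem coe_smul (c : ℂ) : (c • f).1 = c • f.1 := rfl

theorem memLp_rot : MemLp (fun θ => f (rot θ)) 2 periodMeasure := f.2.2

theorem aestronglyMeasurable_rot : AEStronglyMeasurable (fun θ => f (rot θ)) :=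
  aestronglyMeasurable_of_periodMeasure (periodic_comp_rot f.1) f.memLp_rot.1

theorem compactPicture_add (a θ : ℝ) : compactPicture f (a + θ) = f (rot (a - π / 2 + θ)) := by
  rw [compactPicture, sub_add_eq_add_sub]

theorem memLp_compactPicture (a : ℝ) :
    MemLp (fun θ => compactPicture f (a + θ)) 2 periodMeasure := by
  simp_rw [compactPicture_add]
  exact memLp_periodMeasure_comp_add (periodic_comp_rot f.1) two_ne_zero ENNReal.ofNat_ne_top
    f.memLp_rot _

/-- The norm of `L²(K)`, which is the Hilbert norm of `𝒫(iℓ, +)_e` with respect to `dθ`. -/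
noncomputable def hilbertNorm : ℝ :=
  (∫ θ, ‖f (rot θ)‖ ^ (2 : ℝ) ∂periodMeasure) ^ (1 / (2 : ℝ))

theorem hilbertNorm_eq_norm_toLp :
    f.hilbertNorm = ‖(f.2.2.toLp : Lp ℂ 2 periodMeasure)‖ := by
  rw [Lp.norm_toLp, f.memLp_rot.eLpNorm_eq_integral_rpow_norm (by simp) (by simp),
    ENNReal.toReal_ofReal (by positivity)]
  simp [hilbertNorm]

theorem hilbertNorm_compactPicture (a : ℝ) :
    (∫ θ, ‖compactPicture f (a + θ)‖ ^ (2 : ℝ) ∂periodMeasure) ^ (1 / (2 : ℝ)) =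
      f.hilbertNorm := by
  simp_rw [compactPicture_add]
  rw [hilbertNorm,
    integral_periodMeasure_comp_add (periodic_comp_rot fun g => ‖f g‖ ^ (2 : ℝ)) (a - π / 2)]

theorem tendsto_hilbertNorm_sub : Tendsto (fun f' => (f' - f).hilbertNorm) (𝓝 f) (𝓝 0) := by
  have htoLp : Continuous (fun f : UnitarySeries l => (f.2.2.toLp : Lp ℂ 2 periodMeasure)) :=
    continuous_induced_dom
  simp_rw [hilbertNorm_eq_norm_toLp]
  exact tendsto_iff_norm_sub_tendsto_zero.1 (htoLp.tendsto f)

end UnitarySeries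

namespace SmoothSeries

variable {v : ℂ} (φ φ' : SmoothSeries v)

theorem coe_add : (φ + φ').1 = φ.1 + φ'.1 := rfl

theorem coe_smul (c : ℂ) : (c • φ).1 = c • φ.1 := rfl

theorem continuous_rot : Continuous (fun θ => φ (rot θ)) := φ.2.2.continuous

/-- The norm of `C(K)`, one of the seminorms that define the topology of `𝒫(u, +)_e^∞`. -/
noncomputable def supNorm : ℝ := ⨆ θ, ‖φ (rot θ)‖

theorem norm_apply_rot_le_supNorm (θ : ℝ) : ‖φ (rot θ)‖ ≤ φ.supNorm := by
  obtain ⟨S, -, hS⟩ := exists_norm_le_of_periodic (periodic_comp_rot φ.1) two_pi_pos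
    φ.continuous_rot
  exact le_ciSup ⟨S, forall_mem_range.2 hS⟩ θ

theorem tendsto_supNorm_sub : Tendsto (fun φ' => (φ' - φ).supNorm) (𝓝 φ) (𝓝 0) := by
  have hderiv : Continuous (fun φ : SmoothSeries v => fun n : ℕ =>
      UniformFun.ofFun (iteratedDeriv n (fun θ => φ (rot θ)))) := continuous_induced_dom
  have hunif := ((continuous_apply 0).comp hderiv).tendsto φ
  rw [UniformFun.tendsto_iff_tendstoUniformly, Metric.tendstoUniformly_iff] at hunif
  refine Metric.tendsto_nhds.2 fun ε hε => ?_
  filter_upwards [hunif (ε / 2) (half_pos hε)] with φ' hφ'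
  have hdist (θ : ℝ) : ‖φ' (rot θ) - φ (rot θ)‖ ≤ ε / 2 := by
    rw [norm_sub_rev]
    simpa [dist_eq_norm] using (hφ' θ).le
  have hle : (φ' - φ).supNorm ≤ ε / 2 := ciSup_le hdist
  have hnonneg : 0 ≤ (φ' - φ).supNorm := Real.iSup_nonneg fun _ => norm_nonneg _
  rw [dist_zero_right, norm_of_nonneg hnonneg]
  linarith

end SmoothSeries

section TripleIntegral

variable {l₁ l₂ : ℝ} {v : ℂ} (f₁ : UnitarySeries l₁) (f₂ : UnitarySeries l₂) (φ : SmoothSeries v)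

theorem integrable_convIntegrand (θ₁ θ₂ : ℝ) :
    Integrable (convIntegrand f₁ f₂ φ θ₁ θ₂) periodMeasure := by
  have hprod := (f₁.memLp_compactPicture θ₁).integrable_mul (f₂.memLp_compactPicture θ₂).star
  refine (hprod.bdd_mul φ.continuous_rot.aestronglyMeasurable
    (Eventually.of_forall φ.norm_apply_rot_le_supNorm)).congr (Eventually.of_forall fun θ => ?_)
  simp [convIntegrand, mul_assoc]

theorem integral_norm_convIntegrand_le (θ₁ θ₂ : ℝ) :
    ∫ θ, ‖convIntegrand f₁ f₂ φ θ₁ θ₂ θ‖ ∂periodMeasure ≤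
      f₁.hilbertNorm * f₂.hilbertNorm * φ.supNorm := by
  have h₁ := f₁.memLp_compactPicture θ₁
  have h₂ := f₂.memLp_compactPicture θ₂
  have hholder := integral_mul_norm_le_Lp_mul_Lq (μ := periodMeasure) Real.HolderConjugate.two_two
    (f := fun θ => compactPicture f₁ (θ₁ + θ)) (g := fun θ => compactPicture f₂ (θ₂ + θ))
    (by simpa using h₁) (by simpa using h₂)
  rw [f₁.hilbertNorm_compactPicture, f₂.hilbertNorm_compactPicture] at hholder
  refine le_trans ?_ (mul_le_mul_of_nonneg_right hholder
    ((norm_nonneg _).trans (φ.norm_apply_rot_le_supNorm 0)))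
  rw [← integral_mul_const]
  refine integral_mono (integrable_convIntegrand f₁ f₂ φ θ₁ θ₂).norm
    ((h₁.norm.integrable_mul h₂.norm).mul_const _) fun θ => ?_
  simp only [convIntegrand, norm_mul, RCLike.norm_conj, mul_assoc]
  rw [← mul_assoc ‖compactPicture _ _‖, mul_comm _ φ.supNorm]
  gcongr
  exact φ.norm_apply_rot_le_supNorm θ

/-- The integrand `kernel(θ₁, θ₂) φ(θ) f̃₁(θ₁ + θ) conj f̃₂(θ₂ + θ)` of the trilinear form, as a
function of `((θ₁, θ₂), θ)`. -/
noncomputable def tripleIntegrand (s : ℂ) (p : (ℝ × ℝ) × ℝ) : ℂ :=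
  circleKernel l₁ l₂ s p.1 * convIntegrand f₁ f₂ φ p.1.1 p.1.2 p.2

theorem aestronglyMeasurable_compactPicture_add {l : ℝ} (f : UnitarySeries l) :
    AEStronglyMeasurable (fun p : ℝ × ℝ => compactPicture f (p.1 + p.2))
      (periodMeasure.prod periodMeasure) := by
  have hf : AEStronglyMeasurable (compactPicture f) :=
    f.aestronglyMeasurable_rot.comp_measurePreserving (measurePreserving_sub_right volume (π / 2))
  rw [periodMeasure, Measure.prod_restrict]
  exact (hf.comp_quasiMeasurePreserving (Measure.quasiMeasurePreserving_snd.comp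
    (measurePreserving_prod_add volume volume).quasiMeasurePreserving)).restrict

theorem aestronglyMeasurable_tripleIntegrand (s : ℂ) :
    AEStronglyMeasurable (tripleIntegrand f₁ f₂ φ s)
      ((periodMeasure.prod periodMeasure).prod periodMeasure) := by
  have hpicture {l : ℝ} (f : UnitarySeries l) {q : ℝ × ℝ → ℝ}
      (hq : Measure.QuasiMeasurePreserving q (periodMeasure.prod periodMeasure) periodMeasure) :
      AEStronglyMeasurable (fun p : (ℝ × ℝ) × ℝ => compactPicture f (q p.1 + p.2))
        ((periodMeasure.prod periodMeasure).prod periodMeasure) :=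
    (aestronglyMeasurable_compactPicture_add f).comp_quasiMeasurePreserving
      (f := fun p : (ℝ × ℝ) × ℝ => (q p.1, p.2))
      (QuasiMeasurePreserving.prodMap hq (Measure.QuasiMeasurePreserving.id _))
  have hkernel := (measurable_circleKernel l₁ l₂ s).aestronglyMeasurable
    (μ := periodMeasure.prod periodMeasure)
  have hφ := φ.continuous_rot.aestronglyMeasurable (μ := periodMeasure)
  exact hkernel.comp_fst.mul ((hφ.comp_snd.mul (hpicture f₁ Measure.quasiMeasurePreserving_fst)).mul
    (hpicture f₂ Measure.quasiMeasurePreserving_snd).star)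

variable {s : ℂ}

theorem integral_norm_tripleIntegrand_le (p : ℝ × ℝ) :
    ∫ θ, ‖tripleIntegrand f₁ f₂ φ s (p, θ)‖ ∂periodMeasure ≤
      ‖circleKernel l₁ l₂ s p‖ * (f₁.hilbertNorm * f₂.hilbertNorm * φ.supNorm) := by
  simp only [tripleIntegrand, norm_mul, integral_const_mul]
  gcongr
  exact integral_norm_convIntegrand_le f₁ f₂ φ _ _

theorem integrable_tripleIntegrand (hs₀ : 0 < s.re) (hs₁ : s.re < 1) :
    Integrable (tripleIntegrand f₁ f₂ φ s)
      ((periodMeasure.prod periodMeasure).prod periodMeasure) := by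
  have hm := aestronglyMeasurable_tripleIntegrand f₁ f₂ φ s
  refine (integrable_prod_iff hm).2 ⟨Eventually.of_forall fun p =>
    (integrable_convIntegrand f₁ f₂ φ p.1 p.2).const_mul (circleKernel l₁ l₂ s p), ?_⟩
  refine ((integrable_circleKernel l₁ l₂ hs₀ hs₁).norm.mul_const
    (f₁.hilbertNorm * f₂.hilbertNorm * φ.supNorm)).mono' hm.norm.integral_prod_right'
    (Eventually.of_forall fun p => ?_)
  rw [norm_of_nonneg (by positivity)]
  exact integral_norm_tripleIntegrand_le f₁ f₂ φ p

theorem integral_tripleIntegrand_snd (s : ℂ) (p : ℝ × ℝ) :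
    ∫ θ, tripleIntegrand f₁ f₂ φ s (p, θ) ∂periodMeasure =
      2 * π * circleIntegrand l₁ l₂ s f₁ f₂ φ p.1 p.2 := by
  have hπ : (π : ℂ) ≠ 0 := Complex.ofReal_ne_zero.2 pi_ne_zero
  simp only [tripleIntegrand, integral_const_mul, circleIntegrand, convH, integral_periodMeasure,
    circleKernel]
  field_simp

theorem integrable_circleIntegrand (hs₀ : 0 < s.re) (hs₁ : s.re < 1) :
    Integrable (fun p : ℝ × ℝ => circleIntegrand l₁ l₂ s f₁ f₂ φ p.1 p.2)
      (periodMeasure.prod periodMeasure) := by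
  have hmarginal := (integrable_tripleIntegrand f₁ f₂ φ hs₀ hs₁).integral_prod_left
  simp only [integral_tripleIntegrand_snd] at hmarginal
  have hπ : (2 * π : ℂ) ≠ 0 := by simp
  simpa only [inv_mul_cancel_left₀ hπ] using hmarginal.const_mul (2 * π : ℂ)⁻¹

/-- The integral over three circles; divided by `2π` it is the double integral of the
theorem. -/
noncomputable def tripleIntegral (s : ℂ) : ℂ :=
  ∫ p, tripleIntegrand f₁ f₂ φ s p ∂((periodMeasure.prod periodMeasure).prod periodMeasure)

theorem tripleIntegral_eq (hs₀ : 0 < s.re) (hs₁ : s.re < 1) :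
    tripleIntegral f₁ f₂ φ s = 2 * π * ∫ θ₂ in (0 : ℝ)..(2 * π), ∫ θ₁ in (0 : ℝ)..(2 * π),
      circleIntegrand l₁ l₂ s f₁ f₂ φ θ₁ θ₂ := by
  rw [tripleIntegral, integral_prod _ (integrable_tripleIntegrand f₁ f₂ φ hs₀ hs₁)]
  simp only [integral_tripleIntegrand_snd, integral_const_mul]
  rw [integral_prod_symm _ (integrable_circleIntegrand f₁ f₂ φ hs₀ hs₁)]
  simp only [integral_periodMeasure]

theorem norm_tripleIntegral_le (hs₀ : 0 < s.re) (hs₁ : s.re < 1) :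
    ‖tripleIntegral f₁ f₂ φ s‖ ≤
      (∫ p, ‖circleKernel l₁ l₂ s p‖ ∂(periodMeasure.prod periodMeasure)) *
        (f₁.hilbertNorm * f₂.hilbertNorm * φ.supNorm) := by
  have hi := (integrable_tripleIntegrand f₁ f₂ φ hs₀ hs₁).norm
  refine (norm_integral_le_integral_norm _).trans ?_
  rw [integral_prod _ hi, ← integral_mul_const]
  exact integral_mono hi.integral_prod_left
    ((integrable_circleKernel l₁ l₂ hs₀ hs₁).norm.mul_const _)
    (integral_norm_tripleIntegrand_le f₁ f₂ φ)

variable (f₁' : UnitarySeries l₁) (f₂' : UnitarySeries l₂) (φ' : SmoothSeries v)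

theorem tripleIntegral_add_left (hs₀ : 0 < s.re) (hs₁ : s.re < 1) :
    tripleIntegral (f₁ + f₁') f₂ φ s = tripleIntegral f₁ f₂ φ s + tripleIntegral f₁' f₂ φ s := by
  rw [tripleIntegral, tripleIntegral, tripleIntegral, ← integral_add
    (integrable_tripleIntegrand _ _ _ hs₀ hs₁) (integrable_tripleIntegrand _ _ _ hs₀ hs₁)]
  congr with p
  simp only [tripleIntegrand, convIntegrand, compactPicture, UnitarySeries.coe_add, Pi.add_apply]
  ring

theorem tripleIntegral_add_mid (hs₀ : 0 < s.re) (hs₁ : s.re < 1) :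
    tripleIntegral f₁ (f₂ + f₂') φ s = tripleIntegral f₁ f₂ φ s + tripleIntegral f₁ f₂' φ s := by
  rw [tripleIntegral, tripleIntegral, tripleIntegral, ← integral_add
    (integrable_tripleIntegrand _ _ _ hs₀ hs₁) (integrable_tripleIntegrand _ _ _ hs₀ hs₁)]
  congr with p
  simp only [tripleIntegrand, convIntegrand, compactPicture, UnitarySeries.coe_add, Pi.add_apply,
    map_add]
  ring

theorem tripleIntegral_add_right (hs₀ : 0 < s.re) (hs₁ : s.re < 1) :
    tripleIntegral f₁ f₂ (φ + φ') s = tripleIntegral f₁ f₂ φ s + tripleIntegral f₁ f₂ φ' s := by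
  rw [tripleIntegral, tripleIntegral, tripleIntegral, ← integral_add
    (integrable_tripleIntegrand _ _ _ hs₀ hs₁) (integrable_tripleIntegrand _ _ _ hs₀ hs₁)]
  congr with p
  simp only [tripleIntegrand, convIntegrand, SmoothSeries.coe_add, Pi.add_apply]
  ring

theorem tripleIntegral_smul_left (c : ℂ) :
    tripleIntegral (c • f₁) f₂ φ s = c * tripleIntegral f₁ f₂ φ s := by
  rw [tripleIntegral, tripleIntegral, ← integral_const_mul]
  congr with p
  simp only [tripleIntegrand, convIntegrand, compactPicture, UnitarySeries.coe_smul, Pi.smul_apply,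
    smul_eq_mul]
  ring

theorem tripleIntegral_smul_mid (c : ℂ) :
    tripleIntegral f₁ (c • f₂) φ s = conj c * tripleIntegral f₁ f₂ φ s := by
  rw [tripleIntegral, tripleIntegral, ← integral_const_mul]
  congr with p
  simp only [tripleIntegrand, convIntegrand, compactPicture, UnitarySeries.coe_smul, Pi.smul_apply,
    smul_eq_mul, map_mul]
  ring

theorem tripleIntegral_smul_right (c : ℂ) :
    tripleIntegral f₁ f₂ (c • φ) s = c * tripleIntegral f₁ f₂ φ s := by
  rw [tripleIntegral, tripleIntegral, ← integral_const_mul]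
  congr with p
  simp only [tripleIntegrand, convIntegrand, SmoothSeries.coe_smul, Pi.smul_apply, smul_eq_mul]
  ring

end TripleIntegral

/-- Expanding around `(x₀, y₀, z₀)` bounds the increment of `T` by
`C ((a + N₁ x₀) (b + N₂ y₀) (c + N₃ z₀) - N₁ x₀ * N₂ y₀ * N₃ z₀)` with `a = N₁ (x - x₀)`, and so
on. -/
theorem continuous_of_trilinear_bound {X Y Z : Type*} [AddCommGroup X] [Module ℂ X]
    [TopologicalSpace X] [AddCommGroup Y] [Module ℂ Y] [TopologicalSpace Y] [AddCommGroup Z]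
    [Module ℂ Z] [TopologicalSpace Z] (T : X →ₗ[ℂ] Y →ₗ⋆[ℂ] Z →ₗ[ℂ] ℂ) {C : ℝ} {N₁ : X → ℝ}
    {N₂ : Y → ℝ} {N₃ : Z → ℝ} (h₁ : ∀ x₀, Tendsto (fun x => N₁ (x - x₀)) (𝓝 x₀) (𝓝 0))
    (h₂ : ∀ y₀, Tendsto (fun y => N₂ (y - y₀)) (𝓝 y₀) (𝓝 0))
    (h₃ : ∀ z₀, Tendsto (fun z => N₃ (z - z₀)) (𝓝 z₀) (𝓝 0))
    (hT : ∀ x y z, ‖T x y z‖ ≤ C * (N₁ x * N₂ y * N₃ z)) :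
    Continuous (fun p : X × Y × Z => T p.1 p.2.1 p.2.2) := by
  refine continuous_iff_continuousAt.2 fun ⟨x₀, y₀, z₀⟩ => ?_
  refine tendsto_iff_norm_sub_tendsto_zero.2 <| squeeze_zero (fun _ => norm_nonneg _)
    (g := fun p => C * ((N₁ (p.1 - x₀) + N₁ x₀) * (N₂ (p.2.1 - y₀) + N₂ y₀) *
      (N₃ (p.2.2 - z₀) + N₃ z₀) - N₁ x₀ * N₂ y₀ * N₃ z₀)) (fun ⟨x, y, z⟩ => ?_) ?_
  · have hexpand : T x y z - T x₀ y₀ z₀ =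
        T (x - x₀) (y - y₀) (z - z₀) + T (x - x₀) (y - y₀) z₀ + T (x - x₀) y₀ (z - z₀) +
          T x₀ (y - y₀) (z - z₀) + T (x - x₀) y₀ z₀ + T x₀ (y - y₀) z₀ + T x₀ y₀ (z - z₀) := by
      simp only [map_sub, LinearMap.sub_apply]
      ring
    rw [hexpand]
    refine (norm_add_le_of_le (norm_add_le_of_le (norm_add_le_of_le (norm_add_le_of_le
      (norm_add_le_of_le (norm_add_le_of_le (hT _ _ _) (hT _ _ _)) (hT _ _ _)) (hT _ _ _))
      (hT _ _ _)) (hT _ _ _)) (hT _ _ _)).trans_eq ?_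
    ring
  · have hx := ((h₁ x₀).comp (continuous_fst.tendsto (x₀, y₀, z₀))).add_const (N₁ x₀)
    have hy := ((h₂ y₀).comp (continuous_snd.fst.tendsto (x₀, y₀, z₀))).add_const (N₂ y₀)
    have hz := ((h₃ z₀).comp (continuous_snd.snd.tendsto (x₀, y₀, z₀))).add_const (N₃ z₀)
    simpa using (((hx.mul hy).mul hz).sub_const (N₁ x₀ * N₂ y₀ * N₃ z₀)).const_mul C

section TrilinearForm

variable {l₁ l₂ : ℝ} {v s : ℂ}

/-- The trilinear form `T` of the theorem. The factor `G₀ / (16π)` is `G₀ / 8` times the `1 / 2π`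
that normalizes `H`. -/
noncomputable def trilinearForm (l₁ l₂ : ℝ) (v : ℂ) {s : ℂ} (hs₀ : 0 < s.re) (hs₁ : s.re < 1) :
    UnitarySeries l₁ →ₗ[ℂ] UnitarySeries l₂ →ₗ⋆[ℂ] SmoothSeries v →ₗ[ℂ] ℂ :=
  LinearMap.mk₂'ₛₗ (RingHom.id ℂ) (starRingEnd ℂ)
    (fun f₁ f₂ =>
      { toFun := fun φ => G₀ (uParam l₁ l₂ s) / (16 * π) * tripleIntegral f₁ f₂ φ s
        map_add' := fun φ φ' => by rw [tripleIntegral_add_right _ _ _ _ hs₀ hs₁, mul_add]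
        map_smul' := fun c φ => by
          rw [tripleIntegral_smul_right, RingHom.id_apply, smul_eq_mul, mul_left_comm] })
    (fun f₁ f₁' f₂ => LinearMap.ext fun φ => by
      simp [tripleIntegral_add_left _ _ _ _ hs₀ hs₁, mul_add])
    (fun c f₁ f₂ => LinearMap.ext fun φ => by
      simp [tripleIntegral_smul_left, mul_left_comm])
    (fun f₁ f₂ f₂' => LinearMap.ext fun φ => by
      simp [tripleIntegral_add_mid _ _ _ _ hs₀ hs₁, mul_add])
    (fun c f₁ f₂ => LinearMap.ext fun φ => by
      simp [tripleIntegral_smul_mid, mul_left_comm])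

variable (hs₀ : 0 < s.re) (hs₁ : s.re < 1) (f₁ : UnitarySeries l₁) (f₂ : UnitarySeries l₂)
  (φ : SmoothSeries v)

theorem trilinearForm_apply : trilinearForm l₁ l₂ v hs₀ hs₁ f₁ f₂ φ =
    G₀ (uParam l₁ l₂ s) / (16 * π) * tripleIntegral f₁ f₂ φ s := rfl

theorem trilinearForm_eq : trilinearForm l₁ l₂ v hs₀ hs₁ f₁ f₂ φ =
    G₀ (uParam l₁ l₂ s) / 8 * ∫ θ₂ in (0 : ℝ)..(2 * π), ∫ θ₁ in (0 : ℝ)..(2 * π),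
      circleIntegrand l₁ l₂ s f₁ f₂ φ θ₁ θ₂ := by
  have hπ : (π : ℂ) ≠ 0 := Complex.ofReal_ne_zero.2 pi_ne_zero
  rw [trilinearForm_apply, tripleIntegral_eq f₁ f₂ φ hs₀ hs₁]
  field_simp
  ring

theorem norm_trilinearForm_le : ‖trilinearForm l₁ l₂ v hs₀ hs₁ f₁ f₂ φ‖ ≤
    (‖G₀ (uParam l₁ l₂ s) / (16 * π)‖ *
      ∫ p, ‖circleKernel l₁ l₂ s p‖ ∂(periodMeasure.prod periodMeasure)) *
        (f₁.hilbertNorm * f₂.hilbertNorm * φ.supNorm) := by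
  rw [trilinearForm_apply, norm_mul, mul_assoc]
  gcongr
  exact norm_tripleIntegral_le f₁ f₂ φ hs₀ hs₁

theorem continuous_trilinearForm :
    Continuous (fun p : UnitarySeries l₁ × UnitarySeries l₂ × SmoothSeries v =>
      trilinearForm l₁ l₂ v hs₀ hs₁ p.1 p.2.1 p.2.2) :=
  continuous_of_trilinear_bound _ UnitarySeries.tendsto_hilbertNorm_sub
    UnitarySeries.tendsto_hilbertNorm_sub SmoothSeries.tendsto_supNorm_sub
    (norm_trilinearForm_le hs₀ hs₁)

end TrilinearForm

/-! ### Equivariance -/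

theorem conj_ofReal_cpow {x : ℝ} (hx : 0 ≤ x) (c : ℂ) :
    conj ((x : ℂ) ^ c) = (x : ℂ) ^ conj c := by
  rw [Complex.cpow_conj, Complex.conj_ofReal]
  rw [Complex.arg_ofReal_of_nonneg hx]
  exact pi_pos.ne

theorem integral_comp_mul_add (f : ℝ → ℂ) (α β : ℝ) :
    ∫ x, f (α * x + β) = ((|α|⁻¹ : ℝ) : ℂ) * ∫ x, f x := by
  rw [Measure.integral_comp_mul_left (fun x => f (x + β)), integral_add_right_eq_self f,
    Complex.real_smul, abs_inv]

/-- The pairing `∬ |x - y|^{-u} a(x) conj b(y) dx dy` on the line. Applied to noncompact pictures it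
is the `G`-covariant form into which `T` unfolds. -/
noncomputable def rieszPairing (u : ℂ) (a b : ℝ → ℂ) : ℂ :=
  ∫ y : ℝ, ∫ x : ℝ, ((|x - y| : ℝ) : ℂ) ^ (-u) * a x * conj (b y)

section RieszPairing

variable (u : ℂ) (a b : ℝ → ℂ)

theorem rieszPairing_const_mul (c d : ℂ) :
    rieszPairing u (fun x => c * a x) (fun y => d * b y) = c * conj d * rieszPairing u a b := by
  simp_rw [rieszPairing, ← integral_const_mul, map_mul]
  congr! 4
  ring

theorem rieszPairing_comp_mul_add {α : ℝ} (hα : α ≠ 0) (β : ℝ) :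
    rieszPairing u (fun x => a (α * x + β)) (fun y => b (α * y + β)) =
      ((|α| : ℝ) : ℂ) ^ (u - 2) * rieszPairing u a b := by
  have hα' : ((|α| : ℝ) : ℂ) ≠ 0 := by simpa using hα
  have hkernel (x y : ℝ) : ((|x - y| : ℝ) : ℂ) ^ (-u) =
      ((|α| : ℝ) : ℂ) ^ u * ((|(α * x + β) - (α * y + β)| : ℝ) : ℂ) ^ (-u) := by
    rw [add_sub_add_right_eq_sub, ← mul_sub, abs_mul, Complex.ofReal_mul,
      Complex.mul_cpow_ofReal_nonneg (abs_nonneg _) (abs_nonneg _), ← mul_assoc,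
      ← Complex.cpow_add _ _ hα', add_neg_cancel, Complex.cpow_zero, one_mul]
  let k (x y : ℝ) : ℂ := ((|x - y| : ℝ) : ℂ) ^ (-u) * a x * conj (b y)
  calc rieszPairing u (fun x => a (α * x + β)) (fun y => b (α * y + β))
      = ((|α| : ℝ) : ℂ) ^ u * ∫ y, ∫ x, k (α * x + β) (α * y + β) := by
        simp_rw [rieszPairing, ← integral_const_mul, k, ← mul_assoc, ← hkernel]
    _ = ((|α| : ℝ) : ℂ) ^ u * (((|α|⁻¹ : ℝ) : ℂ) ^ 2 * rieszPairing u a b) := by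
        have hinner (y : ℝ) := integral_comp_mul_add (fun x => k x (α * y + β)) α β
        simp_rw [hinner, integral_const_mul]
        rw [integral_comp_mul_add (fun y => ∫ x, k x y), ← mul_assoc _ _ (∫ y, _), ← pow_two]
        rfl
    _ = ((|α| : ℝ) : ℂ) ^ (u - 2) * rieszPairing u a b := by
        rw [Complex.cpow_sub _ _ hα', Complex.cpow_ofNat, Complex.ofReal_inv]
        ring

end RieszPairing

theorem integral_two_pi_eq_integral_cot {E : Type*} [NormedAddCommGroup E] [NormedSpace ℝ E]
    {f : ℝ → E} (hf : Function.Periodic f π) :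
    ∫ θ in 0..2 * π, f θ = (2 : ℝ) • ∫ x : ℝ, (1 + x ^ 2)⁻¹ • f (π / 2 - arctan x) := by
  have hshift : Function.Periodic (fun θ => f (π / 2 + θ)) π := fun θ => by
    simp only [← add_assoc, hf (π / 2 + θ)]
  have h2π : Function.Periodic f (2 * π) := by simpa using hf.nat_mul 2
  simp_rw [sub_eq_add_neg, ← integral_two_pi_of_periodic_pi hshift, ← integral_periodMeasure]
  exact (integral_periodMeasure_comp_add h2π (π / 2)).symm

section Cotangent

variable (x y : ℝ)

theorem abs_sin_pi_div_two_sub_arctan : |sin (π / 2 - arctan x)| = (√(1 + x ^ 2))⁻¹ := by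
  rw [sin_pi_div_two_sub, cos_arctan, one_div, abs_of_nonneg (by positivity)]

theorem abs_sin_arctan_sub_arctan :
    |sin (arctan y - arctan x)| = |x - y| * ((√(1 + x ^ 2))⁻¹ * (√(1 + y ^ 2))⁻¹) := by
  have hsin : sin (arctan y - arctan x) =
      -(x - y) * ((√(1 + x ^ 2))⁻¹ * (√(1 + y ^ 2))⁻¹) := by
    rw [sin_sub, sin_arctan, cos_arctan, sin_arctan, cos_arctan]
    field_simp
    ring
  rw [hsin, abs_mul, abs_neg, abs_of_nonneg (by positivity : 0 ≤ (√(1 + x ^ 2))⁻¹ * _)]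

theorem ofReal_inv_one_add_sq_mul_cpow (c : ℂ) :
    (((1 + x ^ 2)⁻¹ : ℝ) : ℂ) * ((√(1 + x ^ 2) : ℝ) : ℂ) ^ c =
      ((√(1 + x ^ 2) : ℝ) : ℂ) ^ (c - 2) := by
  have hsqrt : (√(1 + x ^ 2) : ℂ) ≠ 0 := by
    exact_mod_cast (by positivity : √(1 + x ^ 2) ≠ 0)
  rw [Complex.cpow_sub _ _ hsqrt, Complex.cpow_ofNat, ← Complex.ofReal_pow,
    Real.sq_sqrt (by positivity), Complex.ofReal_inv]
  ring

theorem circleKernel_cot (l₁ l₂ : ℝ) (s : ℂ) :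
    (((1 + x ^ 2)⁻¹ : ℝ) : ℂ) * (((1 + y ^ 2)⁻¹ : ℝ) : ℂ) *
      circleKernel l₁ l₂ s (π / 2 - arctan x, π / 2 - arctan y) =
    ((|x - y| : ℝ) : ℂ) ^ (-uParam l₁ l₂ s) *
      ((√(1 + x ^ 2) : ℝ) : ℂ) ^ (-(Complex.I * l₁ + 1)) *
      conj (((√(1 + y ^ 2) : ℝ) : ℂ) ^ (-(Complex.I * l₂ + 1))) := by
  have hX₀ : 0 < √(1 + x ^ 2) := by positivity
  have hY₀ : 0 < √(1 + y ^ 2) := by positivity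
  have hX (c d : ℂ) := Complex.cpow_add c d (Complex.ofReal_ne_zero.2 hX₀.ne')
  have hY (c d : ℂ) := Complex.cpow_add c d (Complex.ofReal_ne_zero.2 hY₀.ne')
  have hXjac := ofReal_inv_one_add_sq_mul_cpow x (- -uParam l₁ l₂ s +
    -(-1 + uParam l₁ l₂ s + Complex.I * l₁))
  have hYjac := ofReal_inv_one_add_sq_mul_cpow y (- -uParam l₁ l₂ s +
    -(-1 + uParam l₁ l₂ s - Complex.I * l₂))
  have hXexp : - -uParam l₁ l₂ s + -(-1 + uParam l₁ l₂ s + Complex.I * l₁) - 2 =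
      -(Complex.I * l₁ + 1) := by ring
  have hYexp : - -uParam l₁ l₂ s + -(-1 + uParam l₁ l₂ s - Complex.I * l₂) - 2 =
      conj (-(Complex.I * l₂ + 1)) := by simp; ring
  rw [hXexp, hX] at hXjac
  rw [hYexp, hY] at hYjac
  rw [conj_ofReal_cpow hY₀.le, ← hXjac, ← hYjac]
  simp only [circleKernel, sub_sub_sub_cancel_left, abs_sin_arctan_sub_arctan,
    abs_sin_pi_div_two_sub_arctan]
  rw [Complex.ofReal_mul, Complex.mul_cpow_ofReal_nonneg (abs_nonneg _) (by positivity),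
    Complex.ofReal_mul, Complex.mul_cpow_ofReal_nonneg (by positivity) (by positivity)]
  simp only [ofReal_inv_cpow hX₀.le, ofReal_inv_cpow hY₀.le]
  ring

end Cotangent

theorem circleKernel_add_pi_fst (l₁ l₂ : ℝ) (s : ℂ) (θ₁ θ₂ : ℝ) :
    circleKernel l₁ l₂ s (θ₁ + π, θ₂) = circleKernel l₁ l₂ s (θ₁, θ₂) := by
  simp only [circleKernel, add_sub_right_comm, sin_add_pi, abs_neg]

theorem circleKernel_add_pi_snd (l₁ l₂ : ℝ) (s : ℂ) (θ₁ θ₂ : ℝ) :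
    circleKernel l₁ l₂ s (θ₁, θ₂ + π) = circleKernel l₁ l₂ s (θ₁, θ₂) := by
  simp only [circleKernel, ← sub_sub, sin_sub_pi, sin_add_pi, abs_neg]

namespace IsLowerHomogeneous

variable {c : ℂ} {F : SLpm → ℂ}

theorem compactPicture_add_pi (hF : IsLowerHomogeneous c F) (θ : ℝ) :
    compactPicture F (θ + π) = compactPicture F θ := by
  rw [compactPicture, compactPicture, add_sub_right_comm]
  exact hF.periodic_rot (θ - π / 2)

theorem apply_mul_upper_mul_unip (hF : IsLowerHomogeneous c F) (g : SLpm) {p : SLpm}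
    (hp : entry p 1 0 = 0) (x : ℝ) :
    F (g * p * unip x) = ((|entry p 0 0| : ℝ) : ℂ) ^ c *
      F (g * unip (entry p 0 0 / entry p 1 1 * x + entry p 0 1 / entry p 1 1)) := by
  have hp₁ : entry p 1 1 ≠ 0 := fun h => by simpa [hp, h] using det_entry p
  set t := entry p 0 0 / entry p 1 1 * x + entry p 0 1 / entry p 1 1 with ht
  have hupper : entry ((unip t)⁻¹ * p * unip x) 0 1 = 0 := by
    rw [← unip_neg]
    simp [entry_mul, unip, hp, ht]
    field_simp
    ring
  have hdiag : entry ((unip t)⁻¹ * p * unip x) 0 0 = entry p 0 0 := by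
    rw [← unip_neg]
    simp [entry_mul, unip, hp]
  rw [← hdiag, ← hF _ _ hupper]
  congr 1
  group

end IsLowerHomogeneous

section Unfolding

variable {l₁ l₂ : ℝ} {s : ℂ} {F₁ F₂ : SLpm → ℂ}

theorem integral_circleKernel_mul_compactPicture (h₁ : IsLowerHomogeneous (Complex.I * l₁ + 1) F₁)
    (h₂ : IsLowerHomogeneous (Complex.I * l₂ + 1) F₂) (θ : ℝ) :
    ∫ θ₂ in 0..2 * π, ∫ θ₁ in 0..2 * π, circleKernel l₁ l₂ s (θ₁, θ₂) *
      (compactPicture F₁ (θ₁ + θ) * conj (compactPicture F₂ (θ₂ + θ))) =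
    4 * rieszPairing (uParam l₁ l₂ s) (fun x => F₁ (rot θ * unip x))
      (fun y => F₂ (rot θ * unip y)) := by
  have hperiodic₁ (θ₂ : ℝ) : Function.Periodic (fun θ₁ => circleKernel l₁ l₂ s (θ₁, θ₂) *
      (compactPicture F₁ (θ₁ + θ) * conj (compactPicture F₂ (θ₂ + θ)))) π := fun θ₁ => by
    simp only [circleKernel_add_pi_fst, add_right_comm _ π, h₁.compactPicture_add_pi]
  have hperiodic₂ : Function.Periodic (fun θ₂ => ∫ θ₁ in 0..2 * π, circleKernel l₁ l₂ s (θ₁, θ₂) *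
      (compactPicture F₁ (θ₁ + θ) * conj (compactPicture F₂ (θ₂ + θ)))) π := fun θ₂ => by
    simp only [circleKernel_add_pi_snd, add_right_comm _ π, h₂.compactPicture_add_pi]
  have hpicture (F : SLpm → ℂ) (x : ℝ) :
      compactPicture F (π / 2 - arctan x + θ) = F (rot θ * rot (-arctan x)) := by
    rw [compactPicture, ← rot_add]
    ring_nf
  rw [integral_two_pi_eq_integral_cot hperiodic₂]
  simp_rw [fun θ₂ => integral_two_pi_eq_integral_cot (hperiodic₁ θ₂)]
  rw [rieszPairing, ← integral_const_mul, ← integral_smul]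
  refine integral_congr_ae (Eventually.of_forall fun y => ?_)
  simp only [smul_smul]
  rw [← integral_smul, ← integral_const_mul]
  refine integral_congr_ae (Eventually.of_forall fun x => ?_)
  have hkernel := circleKernel_cot x y l₁ l₂ s
  simp only [hpicture, h₁.apply_mul_unip, h₂.apply_mul_unip, map_mul, Complex.real_smul]
  push_cast at hkernel ⊢
  linear_combination
    4 * F₁ (rot θ * rot (-arctan x)) * conj (F₂ (rot θ * rot (-arctan y))) * hkernel

theorem tripleIntegral_eq_integral_rieszPairing {v : ℂ} (f₁ : UnitarySeries l₁)
    (f₂ : UnitarySeries l₂) (φ : SmoothSeries v) (hs₀ : 0 < s.re) (hs₁ : s.re < 1) :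
    tripleIntegral f₁ f₂ φ s = 4 * ∫ θ in 0..2 * π, φ (rot θ) *
      rieszPairing (uParam l₁ l₂ s) (fun x => f₁ (rot θ * unip x))
        (fun y => f₂ (rot θ * unip y)) := by
  have hint := integrable_tripleIntegrand f₁ f₂ φ hs₀ hs₁
  rw [tripleIntegral, integral_prod_symm _ hint, ← integral_periodMeasure, ← integral_const_mul]
  refine integral_congr_ae ?_
  filter_upwards [hint.prod_left_ae] with θ hθ
  rw [integral_prod_symm _ hθ, mul_left_comm,
    ← integral_circleKernel_mul_compactPicture f₁.isLowerHomogeneous f₂.isLowerHomogeneous θ]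
  simp_rw [integral_periodMeasure, ← intervalIntegral.integral_const_mul, tripleIntegrand,
    convIntegrand]
  congr! 4
  ring

theorem rieszPairing_mul_upper (h₁ : IsLowerHomogeneous (Complex.I * l₁ + 1) F₁)
    (h₂ : IsLowerHomogeneous (Complex.I * l₂ + 1) F₂) (g : SLpm) {p : SLpm}
    (hp : entry p 1 0 = 0) :
    rieszPairing (uParam l₁ l₂ s) (fun x => F₁ (g * p * unip x)) (fun y => F₂ (g * p * unip y)) =
      ((|entry p 0 0| : ℝ) : ℂ) ^ (2 * s - 2) *
        rieszPairing (uParam l₁ l₂ s) (fun x => F₁ (g * unip x)) (fun y => F₂ (g * unip y)) := by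
  have hp₀ : entry p 0 0 ≠ 0 := fun h => by simpa [hp, h] using det_entry p
  have hp₀' : ((|entry p 0 0| : ℝ) : ℂ) ≠ 0 := by simpa using hp₀
  have hp₁ : entry p 1 1 ≠ 0 := fun h => by simpa [hp, h] using det_entry p
  have hscale : |entry p 0 0 / entry p 1 1| = |entry p 0 0| * |entry p 0 0| := by
    rw [abs_div, abs_entry_one_one (by simp [hp]), div_inv_eq_mul]
  simp_rw [h₁.apply_mul_upper_mul_unip g hp, h₂.apply_mul_upper_mul_unip g hp]
  rw [rieszPairing_const_mul, rieszPairing_comp_mul_add _ (fun x => F₁ (g * unip x))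
    (fun y => F₂ (g * unip y)) (div_ne_zero hp₀ hp₁), hscale, Complex.ofReal_mul,
    Complex.mul_cpow_ofReal_nonneg (abs_nonneg _) (abs_nonneg _), conj_ofReal_cpow (abs_nonneg _),
    ← mul_assoc]
  simp_rw [← Complex.cpow_add _ _ hp₀']
  congr 2
  simp [uParam]
  ring

theorem isUpperHomogeneous_mul_rieszPairing {Φ : SLpm → ℂ}
    (h₁ : IsLowerHomogeneous (Complex.I * l₁ + 1) F₁)
    (h₂ : IsLowerHomogeneous (Complex.I * l₂ + 1) F₂) (hΦ : IsUpperHomogeneous (-(2 * s)) Φ) :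
    IsUpperHomogeneous (-2) (fun g => Φ g * rieszPairing (uParam l₁ l₂ s)
      (fun x => F₁ (g * unip x)) (fun y => F₂ (g * unip y))) := by
  intro g p hp
  have hp₀ : ((|entry p 0 0| : ℝ) : ℂ) ≠ 0 := by
    have : entry p 0 0 ≠ 0 := fun h => by simpa [hp, h] using det_entry p
    simpa using this
  simp only [rieszPairing_mul_upper h₁ h₂ g hp, hΦ g p hp]
  rw [show (-2 : ℂ) = -(2 * s) + (2 * s - 2) by ring, Complex.cpow_add _ _ hp₀]
  ring

theorem tripleIntegral_leftTranslate (f₁ : UnitarySeries l₁) (f₂ : UnitarySeries l₂)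
    (φ : SmoothSeries (2 * s - 1)) (hs₀ : 0 < s.re) (hs₁ : s.re < 1) (g : SLpm) :
    tripleIntegral (unitaryRep l₁ g f₁) (unitaryRep l₂ g f₂) (smoothRep (2 * s - 1) g φ) s =
      tripleIntegral f₁ f₂ φ s := by
  have hφ : IsUpperHomogeneous (-(2 * s)) φ := by simpa using φ.isUpperHomogeneous
  rw [tripleIntegral_eq_integral_rieszPairing _ _ _ hs₀ hs₁,
    tripleIntegral_eq_integral_rieszPairing _ _ _ hs₀ hs₁,
    ← (isUpperHomogeneous_mul_rieszPairing f₁.isLowerHomogeneous f₂.isLowerHomogeneous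
      hφ).integral_leftTranslate_rot g]
  simp only [leftTranslate_apply, mul_assoc]
  rfl

end Unfolding

section Fourier

open scoped FourierTransform

/-! ### The functional equation of the Riesz kernel -/

theorem G₀_eq_Gammaℝ_div {u : ℂ} (h₀ : 0 < u.re) :
    G₀ u = Complex.Gammaℝ u / Complex.Gammaℝ (1 - u) := by
  have hpole (n : ℕ) : u ≠ -(2 * n + 1) := by
    rintro rfl
    norm_num at h₀
    linarith [n.cast_nonneg (α := ℝ)]
  rw [Complex.Gammaℝ_div_Gammaℝ_one_sub hpole, G₀, Complex.Gammaℂ_def]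

section Gaussian

variable {z : ℂ}

theorem integral_cpow_mul_gaussian (hz : 0 < z.re) {d : ℝ} (hd : d ≠ 0) :
    ∫ τ : ℝ in Ioi 0, (τ : ℂ) ^ (z / 2 - 1) * Complex.exp (-π * τ * d ^ 2) =
      Complex.Gammaℝ z * ((|d| : ℝ) : ℂ) ^ (-z) := by
  have hr : 0 < π * d ^ 2 := by positivity
  have hd' : 0 < |d| := abs_pos.2 hd
  have hscale : (1 / ((π * d ^ 2 : ℝ) : ℂ)) ^ (z / 2) =
      (π : ℂ) ^ (-z / 2) * ((|d| : ℝ) : ℂ) ^ (-z) := by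
    rw [one_div, ← Complex.ofReal_inv, ofReal_inv_cpow hr.le, ← sq_abs, pow_two,
      Complex.ofReal_mul, Complex.mul_cpow_ofReal_nonneg pi_pos.le (by positivity),
      Complex.ofReal_mul, Complex.mul_cpow_ofReal_nonneg hd'.le hd'.le,
      ← Complex.cpow_add _ _ (by exact_mod_cast hd'.ne')]
    congr 2 <;> ring
  have hexp (τ : ℝ) : (-π * τ * d ^ 2 : ℂ) = -((π * d ^ 2 : ℝ) * τ) := by push_cast; ring
  simp_rw [hexp]
  rw [Complex.integral_cpow_mul_exp_neg_mul_Ioi (by simpa using hz) hr, hscale, Complex.Gammaℝ_def]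
  ring

theorem integrableOn_cpow_mul_gaussian (hz : 0 < z.re) {d : ℝ} (hd : d ≠ 0) :
    IntegrableOn (fun τ : ℝ => (τ : ℂ) ^ (z / 2 - 1) * Complex.exp (-π * τ * d ^ 2)) (Ioi 0) := by
  refine Integrable.of_integral_ne_zero ?_
  rw [integral_cpow_mul_gaussian hz hd]
  exact mul_ne_zero (Complex.Gammaℝ_ne_zero_of_re_pos hz)
    (Complex.cpow_ne_zero_iff.2 (.inl (by simpa using hd)))

theorem integral_norm_cpow_mul_gaussian (hz : 0 < z.re) {d : ℝ} (hd : d ≠ 0) :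
    ∫ τ : ℝ in Ioi 0, ‖(τ : ℂ) ^ (z / 2 - 1) * Complex.exp (-π * τ * d ^ 2)‖ =
      ‖Complex.Gammaℝ z.re‖ * ‖((|d| : ℝ) : ℂ) ^ (-z)‖ := by
  have hnorm {τ : ℝ} (hτ : τ ∈ Ioi 0) :
      ((‖(τ : ℂ) ^ (z / 2 - 1) * Complex.exp (-π * τ * d ^ 2)‖ : ℝ) : ℂ) =
        (τ : ℂ) ^ ((z.re : ℂ) / 2 - 1) * Complex.exp (-π * τ * d ^ 2) := by
    have hre : (-π * τ * d ^ 2 : ℂ).re = -π * τ * d ^ 2 := by norm_cast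
    rw [norm_mul, Complex.norm_cpow_eq_rpow_re_of_pos hτ, Complex.norm_exp, hre]
    simp [Complex.ofReal_cpow (le_of_lt hτ)]
  have hcast := integral_cpow_mul_gaussian (z := z.re) (by simpa using hz) hd
  rw [← setIntegral_congr_fun measurableSet_Ioi fun τ hτ => hnorm hτ,
    integral_complex_ofReal] at hcast
  rw [← norm_of_nonneg (integral_nonneg fun _ => norm_nonneg _), ← Complex.norm_real, hcast,
    norm_mul]
  congr 1
  simp [Complex.norm_cpow_eq_rpow_re_of_pos (abs_pos.2 hd)]

variable {X : Type*} [MeasurableSpace X] {ν : Measure X} {d : X → ℝ} {A : X → ℂ}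

theorem integrable_cpow_mul_gaussian_prod (hz : 0 < z.re) (hd : Measurable d)
    (hd₀ : ∀ᵐ x ∂ν, d x ≠ 0) (hA : AEStronglyMeasurable A ν)
    (hi : Integrable (fun x => ((|d x| : ℝ) : ℂ) ^ (-z) * A x) ν) :
    Integrable (fun p : X × ℝ => (p.2 : ℂ) ^ (z / 2 - 1) *
      Complex.exp (-π * p.2 * d p.1 ^ 2) * A p.1) (ν.prod (volume.restrict (Ioi 0))) := by
  have hmeas : AEStronglyMeasurable (fun p : X × ℝ => (p.2 : ℂ) ^ (z / 2 - 1) *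
      Complex.exp (-π * p.2 * d p.1 ^ 2) * A p.1) (ν.prod (volume.restrict (Ioi 0))) :=
    (by fun_prop : Measurable _).aestronglyMeasurable.mul hA.comp_fst
  rw [integrable_prod_iff hmeas]
  constructor
  · filter_upwards [hd₀] with x hx
    exact (integrableOn_cpow_mul_gaussian hz hx).mul_const (A x)
  · refine (hi.norm.const_mul ‖Complex.Gammaℝ z.re‖).congr ?_
    filter_upwards [hd₀] with x hx
    simp only [norm_mul _ (A x), integral_mul_const]
    rw [integral_norm_cpow_mul_gaussian hz hx, mul_assoc]

theorem Gammaℝ_mul_integral_abs_cpow_mul [SFinite ν] (hz : 0 < z.re) (hd : Measurable d)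
    (hd₀ : ∀ᵐ x ∂ν, d x ≠ 0) (hA : AEStronglyMeasurable A ν)
    (hi : Integrable (fun x => ((|d x| : ℝ) : ℂ) ^ (-z) * A x) ν) :
    Complex.Gammaℝ z * ∫ x, ((|d x| : ℝ) : ℂ) ^ (-z) * A x ∂ν =
      ∫ τ : ℝ in Ioi 0, (τ : ℂ) ^ (z / 2 - 1) *
        ∫ x, Complex.exp (-π * τ * d x ^ 2) * A x ∂ν := by
  calc Complex.Gammaℝ z * ∫ x, ((|d x| : ℝ) : ℂ) ^ (-z) * A x ∂ν
      = ∫ x, (∫ τ : ℝ in Ioi 0,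
          (τ : ℂ) ^ (z / 2 - 1) * Complex.exp (-π * τ * d x ^ 2) * A x) ∂ν := by
        rw [← integral_const_mul]
        refine integral_congr_ae ?_
        filter_upwards [hd₀] with x hx
        rw [integral_mul_const, integral_cpow_mul_gaussian hz hx, mul_assoc]
    _ = ∫ τ : ℝ in Ioi 0, ∫ x,
          (τ : ℂ) ^ (z / 2 - 1) * Complex.exp (-π * τ * d x ^ 2) * A x ∂ν :=
        integral_integral_swap (integrable_cpow_mul_gaussian_prod hz hd hd₀ hA hi)
    _ = ∫ τ : ℝ in Ioi 0, (τ : ℂ) ^ (z / 2 - 1) *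
          ∫ x, Complex.exp (-π * τ * d x ^ 2) * A x ∂ν := by
        simp only [mul_assoc, integral_const_mul]

end Gaussian

section FourierPairing

variable {f₁ f₂ : ℝ → ℂ}

theorem integrable_mul_conj_prod (h₁ : Integrable f₁) (h₂ : Integrable f₂) :
    Integrable (fun p : ℝ × ℝ => f₁ p.1 * conj (f₂ p.2)) :=
  h₁.mul_prod (Complex.conjCLE.integrable_comp_iff.2 h₂)

theorem continuous_fourier {f : ℝ → ℂ} (hf : Integrable f) : Continuous (𝓕 f) :=
  VectorFourier.fourierIntegral_continuous continuous_fourierChar (by fun_prop) hf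

theorem fourier_mul_conj_fourier (f₁ f₂ : ℝ → ℂ) (t : ℝ) :
    𝓕 f₁ t * conj (𝓕 f₂ t) =
      ∫ p : ℝ × ℝ, (𝐞 (-(t * (p.1 - p.2))) : ℂ) * (f₁ p.1 * conj (f₂ p.2)) := by
  rw [fourier_real_eq, fourier_real_eq, ← integral_conj, ← integral_prod_mul]
  congr 1
  funext p
  have hchar : (𝐞 (-(t * (p.1 - p.2))) : ℂ) = 𝐞 (-(p.1 * t)) * conj (𝐞 (-(p.2 * t)) : ℂ) := by
    rw [← Circle.coe_inv_eq_conj, ← AddChar.map_neg_eq_inv, ← Circle.coe_mul,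
      ← AddChar.map_add_eq_mul]
    congr 3
    ring
  simp only [Circle.smul_def, smul_eq_mul, map_mul]
  rw [hchar, mul_mul_mul_comm]

theorem integral_gaussian_mul_fourierChar {τ : ℝ} (hτ : 0 < τ) (d : ℝ) :
    ∫ t : ℝ, Complex.exp (-π * τ * t ^ 2) * (𝐞 (-(t * d)) : ℂ) =
      (τ : ℂ) ^ (-(1 / 2) : ℂ) * Complex.exp (-π * (τ⁻¹ : ℝ) * d ^ 2) := by
  have hgauss := congrFun (fourier_gaussian_pi (b := τ) (by simpa using hτ)) d
  rw [fourier_real_eq] at hgauss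
  simp_rw [Circle.smul_def, smul_eq_mul, mul_comm (𝐞 _ : ℂ)] at hgauss
  rw [hgauss, Complex.cpow_neg, Complex.ofReal_inv, ← div_eq_mul_inv, one_div ((τ : ℂ) ^ _)]

theorem integral_gaussian_mul_fourier (h₁ : Integrable f₁) (h₂ : Integrable f₂) {τ : ℝ}
    (hτ : 0 < τ) :
    ∫ t : ℝ, Complex.exp (-π * τ * t ^ 2) * (𝓕 f₁ t * conj (𝓕 f₂ t)) =
      (τ : ℂ) ^ (-(1 / 2) : ℂ) * ∫ p : ℝ × ℝ,
        Complex.exp (-π * (τ⁻¹ : ℝ) * ((p.1 - p.2 : ℝ) : ℂ) ^ 2) * (f₁ p.1 * conj (f₂ p.2)) := by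
  have hgauss : Integrable (fun t : ℝ => Complex.exp (-π * τ * t ^ 2)) := by
    simpa [neg_mul] using integrable_cexp_neg_mul_sq (b := π * τ) (by norm_cast; positivity)
  have hint : Integrable (fun q : ℝ × (ℝ × ℝ) => Complex.exp (-π * τ * q.1 ^ 2) *
      (f₁ q.2.1 * conj (f₂ q.2.2)) * (𝐞 (-(q.1 * (q.2.1 - q.2.2))) : ℂ))
      (volume.prod volume) := by
    refine (hgauss.mul_prod (integrable_mul_conj_prod h₁ h₂)).mul_bdd (c := 1) ?_ ?_
    · exact (by fun_prop : Continuous _).aestronglyMeasurable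
    · exact Eventually.of_forall fun q => (Circle.norm_coe _).le
  calc ∫ t : ℝ, Complex.exp (-π * τ * t ^ 2) * (𝓕 f₁ t * conj (𝓕 f₂ t))
      = ∫ t : ℝ, ∫ p : ℝ × ℝ, Complex.exp (-π * τ * t ^ 2) * (f₁ p.1 * conj (f₂ p.2)) *
          (𝐞 (-(t * (p.1 - p.2))) : ℂ) := by
        simp_rw [fourier_mul_conj_fourier, ← integral_const_mul, mul_assoc, mul_comm (𝐞 _ : ℂ),
          mul_assoc]
    _ = ∫ p : ℝ × ℝ, ∫ t : ℝ, Complex.exp (-π * τ * t ^ 2) * (f₁ p.1 * conj (f₂ p.2)) *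
          (𝐞 (-(t * (p.1 - p.2))) : ℂ) := integral_integral_swap hint
    _ = _ := by
        simp_rw [mul_right_comm _ (_ * conj _), integral_mul_const,
          integral_gaussian_mul_fourierChar hτ, mul_assoc, integral_const_mul]

theorem ae_sub_ne_zero : ∀ᵐ p : ℝ × ℝ, p.1 - p.2 ≠ 0 := by
  have hmeas : MeasurableSet {p : ℝ × ℝ | p.1 - p.2 ≠ 0} :=
    (measurableSet_eq_fun (by fun_prop) measurable_const).compl
  refine (Measure.ae_prod_mem_iff_ae_ae_mem hmeas).2 (Eventually.of_forall fun x => ?_)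
  filter_upwards [Measure.ae_ne volume x] with y hy
  exact sub_ne_zero.2 hy.symm

/-- Both sides are superpositions of Gaussians, which the Fourier transform exchanges by
`τ ↦ τ⁻¹`. -/
theorem integral_abs_cpow_mul_fourier {u : ℂ} (h₀ : 0 < u.re) (h₁ : u.re < 1)
    (hf₁ : Integrable f₁) (hf₂ : Integrable f₂)
    (hfreq : Integrable (fun t : ℝ => ((|t| : ℝ) : ℂ) ^ (u - 1) * (𝓕 f₁ t * conj (𝓕 f₂ t))))
    (hspace : Integrable (fun p : ℝ × ℝ => ((|p.1 - p.2| : ℝ) : ℂ) ^ (-u) *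
      (f₁ p.1 * conj (f₂ p.2)))) :
    ∫ t : ℝ, ((|t| : ℝ) : ℂ) ^ (u - 1) * (𝓕 f₁ t * conj (𝓕 f₂ t)) =
      G₀ u * ∫ p : ℝ × ℝ, ((|p.1 - p.2| : ℝ) : ℂ) ^ (-u) * (f₁ p.1 * conj (f₂ p.2)) := by
  have hz : 0 < (1 - u).re := by simpa using h₁
  have hfreq_meas : AEStronglyMeasurable (fun t => 𝓕 f₁ t * conj (𝓕 f₂ t)) :=
    ((continuous_fourier hf₁).mul
      (Complex.continuous_conj.comp (continuous_fourier hf₂))).aestronglyMeasurable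
  have hfreq_gauss := Gammaℝ_mul_integral_abs_cpow_mul hz (d := fun t : ℝ => t) measurable_id
    (Measure.ae_ne volume 0) hfreq_meas (by simpa only [neg_sub] using hfreq)
  have hspace_gauss := Gammaℝ_mul_integral_abs_cpow_mul h₀ (d := fun p : ℝ × ℝ => p.1 - p.2)
    (by fun_prop) ae_sub_ne_zero (integrable_mul_conj_prod hf₁ hf₂).1 hspace
  rw [neg_sub] at hfreq_gauss
  rw [G₀_eq_Gammaℝ_div h₀, div_mul_eq_mul_div, eq_div_iff (Complex.Gammaℝ_ne_zero_of_re_pos hz),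
    mul_comm _ (Complex.Gammaℝ (1 - u)), hspace_gauss, hfreq_gauss,
    ← integral_comp_rpow_Ioi _ (p := -1) (by norm_num)]
  refine setIntegral_congr_fun measurableSet_Ioi fun τ hτ => ?_
  have hτ : 0 < τ := hτ
  have hτC : (τ : ℂ) ≠ 0 := by exact_mod_cast hτ.ne'
  simp only [Real.rpow_neg_one]
  rw [integral_gaussian_mul_fourier hf₁ hf₂ (inv_pos.2 hτ), inv_inv, ← mul_assoc,
    Complex.real_smul, ← mul_assoc, ofReal_inv_cpow hτ.le, ofReal_inv_cpow hτ.le, abs_neg,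
    abs_one, one_mul, Complex.ofReal_cpow hτ.le,
    ← Complex.cpow_add _ _ hτC, ← Complex.cpow_add _ _ hτC]
  congr 2
  push_cast
  ring

end FourierPairing

theorem lintegral_comp_cot (h : ℝ → ENNReal) :
    ∫⁻ θ in Ioo 0 π, h θ = ∫⁻ x : ℝ, ENNReal.ofReal (1 + x ^ 2)⁻¹ * h (π / 2 - arctan x) := by
  have himage : (fun x : ℝ => π / 2 - arctan x) '' univ = Ioo 0 π := by
    calc (fun x : ℝ => π / 2 - arctan x) '' univ
        = (π / 2 - ·) '' range arctan := by rw [image_univ, ← range_comp]; rfl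
      _ = Ioo (π / 2 - π / 2) (π / 2 - -(π / 2)) := by rw [range_arctan, image_const_sub_Ioo]
      _ = Ioo 0 π := by rw [sub_self, sub_neg_eq_add, add_halves]
  have hsubst := lintegral_image_eq_lintegral_abs_deriv_mul MeasurableSet.univ
    (fun x _ => ((hasDerivAt_arctan x).const_sub (π / 2)).hasDerivWithinAt)
    (fun x _ y _ hxy => arctan_injective (by simpa using hxy)) h
  simpa only [himage, abs_deriv_neg_arctan, Measure.restrict_univ] using hsubst

section LineKernel

theorem abs_sub_rpow_mul_eq_abs_sin_kernel (σ x y : ℝ) :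
    |x - y| ^ (-σ) * ((√(1 + x ^ 2))⁻¹ * (√(1 + y ^ 2))⁻¹) =
      (1 + x ^ 2)⁻¹ * ((1 + y ^ 2)⁻¹ *
        (|sin ((π / 2 - arctan x) - (π / 2 - arctan y))| ^ (-σ) *
          |sin (π / 2 - arctan x)| ^ (-(1 - σ)) * |sin (π / 2 - arctan y)| ^ (-(1 - σ)))) := by
  have hpow {r : ℝ} (hr : 0 < r) : r⁻¹ ^ (-σ) * r⁻¹ ^ (-(1 - σ)) = r := by
    rw [← rpow_add (inv_pos.2 hr), show -σ + -(1 - σ) = -1 by ring, rpow_neg_one, inv_inv]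
  have hsq (x : ℝ) : (1 + x ^ 2)⁻¹ = (√(1 + x ^ 2))⁻¹ ^ 2 := by
    rw [inv_pow, sq_sqrt (by positivity)]
  have hX : 0 < √(1 + x ^ 2) := by positivity
  have hY : 0 < √(1 + y ^ 2) := by positivity
  rw [sub_sub_sub_cancel_left, abs_sin_arctan_sub_arctan, abs_sin_pi_div_two_sub_arctan,
    abs_sin_pi_div_two_sub_arctan, mul_rpow (abs_nonneg _) (by positivity),
    mul_rpow (by positivity) (by positivity), hsq x, hsq y]
  set X := √(1 + x ^ 2)
  set Y := √(1 + y ^ 2)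
  calc |x - y| ^ (-σ) * (X⁻¹ * Y⁻¹)
      = X⁻¹ ^ 2 * (Y⁻¹ ^ 2 * (|x - y| ^ (-σ) * X * Y)) := by field_simp
    _ = X⁻¹ ^ 2 * (Y⁻¹ ^ 2 * (|x - y| ^ (-σ) * (X⁻¹ ^ (-σ) * X⁻¹ ^ (-(1 - σ))) *
          (Y⁻¹ ^ (-σ) * Y⁻¹ ^ (-(1 - σ))))) := by rw [hpow hX, hpow hY]
    _ = _ := by ring

theorem integrable_abs_sub_rpow_mul_inv_sqrt {σ : ℝ} (h₀ : 0 < σ) (h₁ : σ < 1) :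
    Integrable (fun p : ℝ × ℝ => |p.1 - p.2| ^ (-σ) *
      ((√(1 + p.1 ^ 2))⁻¹ * (√(1 + p.2 ^ 2))⁻¹)) := by
  let k (α β : ℝ) : ENNReal :=
    ‖|sin (α - β)| ^ (-σ) * |sin α| ^ (-(1 - σ)) * |sin β| ^ (-(1 - σ))‖ₑ
  have hk : Measurable (Function.uncurry k) := by unfold k Function.uncurry; fun_prop
  have hpoint (x y : ℝ) : ‖|x - y| ^ (-σ) * ((√(1 + x ^ 2))⁻¹ * (√(1 + y ^ 2))⁻¹)‖ₑ =
      ENNReal.ofReal (1 + x ^ 2)⁻¹ * (ENNReal.ofReal (1 + y ^ 2)⁻¹ *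
        k (π / 2 - arctan x) (π / 2 - arctan y)) := by
    rw [abs_sub_rpow_mul_eq_abs_sin_kernel, enorm_mul, enorm_mul,
      Real.enorm_of_nonneg (by positivity : 0 ≤ (1 + x ^ 2)⁻¹),
      Real.enorm_of_nonneg (by positivity : 0 ≤ (1 + y ^ 2)⁻¹)]
  have hcircle : volume.restrict (Ioo 0 π) ≤ periodMeasure :=
    Measure.restrict_mono_set _ fun x hx => ⟨hx.1, by linarith [hx.2, pi_pos]⟩
  refine ⟨Measurable.aestronglyMeasurable (by fun_prop), ?_⟩
  calc ∫⁻ p : ℝ × ℝ, ‖|p.1 - p.2| ^ (-σ) * ((√(1 + p.1 ^ 2))⁻¹ * (√(1 + p.2 ^ 2))⁻¹)‖ₑ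
      = ∫⁻ x : ℝ, ENNReal.ofReal (1 + x ^ 2)⁻¹ * ∫⁻ y : ℝ, ENNReal.ofReal (1 + y ^ 2)⁻¹ *
          k (π / 2 - arctan x) (π / 2 - arctan y) := by
        rw [Measure.volume_eq_prod, lintegral_prod _ (by fun_prop)]
        simp_rw [hpoint, lintegral_const_mul' _ _ ENNReal.ofReal_ne_top]
    _ = ∫⁻ α in Ioo 0 π, ∫⁻ β in Ioo 0 π, k α β := by
        simp_rw [lintegral_comp_cot]
    _ ≤ ∫⁻ α, ∫⁻ β, k α β ∂periodMeasure ∂periodMeasure :=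
        lintegral_mono' hcircle fun α => lintegral_mono' hcircle le_rfl
    _ = ∫⁻ p, Function.uncurry k p ∂periodMeasure.prod periodMeasure :=
        (lintegral_prod _ hk.aemeasurable).symm
    _ < ⊤ := (integrable_abs_sin_rpow_kernel h₀ h₁).2

end LineKernel

/-! ### Fourier transforms of functions that decay like `1/|x|` -/

theorem integrable_rpow_piecewise {p q : ℝ} (hp : -1 < p) (hq : q < -1) :
    Integrable (fun t : ℝ => if |t| ≤ 1 then |t| ^ p else |t| ^ q) := by
  set f : ℝ → ℝ := fun t => if |t| ≤ 1 then |t| ^ p else |t| ^ q with hf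
  have hsmall : IntegrableOn f (Ioc 0 1) := by
    have hpow := (intervalIntegrable_iff_integrableOn_Ioc_of_le zero_le_one).1
      (intervalIntegral.intervalIntegrable_rpow' (a := 0) (b := 1) hp)
    refine hpow.congr_fun (fun t ht => ?_) measurableSet_Ioc
    simp only [hf]
    rw [abs_of_pos ht.1, if_pos ht.2]
  have hlarge : IntegrableOn f (Ioi 1) := by
    refine (integrableOn_Ioi_rpow_of_lt hq zero_lt_one).congr_fun (fun t ht => ?_) measurableSet_Ioi
    have ht : 1 < t := ht
    simp only [hf]
    rw [abs_of_pos (by linarith), if_neg (by linarith)]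
  have hpos : Integrable ((Ioi 0).indicator f) := by
    rw [integrable_indicator_iff measurableSet_Ioi, ← Ioc_union_Ioi_eq_Ioi zero_le_one]
    exact hsmall.union hlarge
  refine (hpos.add hpos.comp_neg).congr ?_
  filter_upwards [Measure.ae_ne volume 0] with t ht
  rcases lt_or_gt_of_ne ht with h | h <;> simp [indicator, not_lt.2 h.le, h, hf]

section CharPrimitive

theorem norm_exp_I_mul_sub_one_le_rpow (y : ℝ) {α : ℝ} (hα₀ : 0 ≤ α) (hα₁ : α ≤ 1) :
    ‖Complex.exp (Complex.I * y) - 1‖ ≤ 2 * |y| ^ α := by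
  rcases le_or_gt |y| 1 with hy | hy
  · have hrpow : |y| ≤ |y| ^ α := by
      simpa using rpow_le_rpow_of_exponent_ge' (abs_nonneg y) hy hα₀ hα₁
    have hlip : ‖Complex.exp (Complex.I * y) - 1‖ ≤ |y| :=
      Real.norm_exp_I_mul_ofReal_sub_one_le
    linarith [abs_nonneg y]
  · have htwo : ‖Complex.exp (Complex.I * y) - 1‖ ≤ 2 := by
      refine (norm_sub_le _ _).trans ?_
      rw [mul_comm, Complex.norm_exp_ofReal_mul_I, norm_one]
      norm_num
    linarith [one_le_rpow hy.le hα₀]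

/-- The primitive of the character `x ↦ e^{-2πitx}` that vanishes at the origin. -/
noncomputable def charPrimitive (t x : ℝ) : ℂ :=
  (Complex.exp (-2 * π * Complex.I * (t * x)) - 1) / (-2 * π * Complex.I * t)

variable {t : ℝ}

theorem hasDerivAt_charPrimitive (ht : t ≠ 0) (x : ℝ) :
    HasDerivAt (charPrimitive t) (Complex.exp (-2 * π * Complex.I * (t * x))) x := by
  have hc : (-2 * π * Complex.I * t : ℂ) ≠ 0 := by simp [pi_ne_zero, ht]
  have hphase : HasDerivAt (fun x : ℝ => (-2 * π * Complex.I * (t * x) : ℂ))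
      (-2 * π * Complex.I * t) x := by
    simpa [mul_assoc] using
      ((hasDerivAt_id x).ofReal_comp.const_mul (t : ℂ)).const_mul (-2 * π * Complex.I)
  have hquot := (hphase.cexp.sub_const 1).div_const (-2 * π * Complex.I * t)
  rw [mul_div_cancel_right₀ _ hc] at hquot
  exact hquot

theorem continuous_charPrimitive (t : ℝ) : Continuous (charPrimitive t) := by
  unfold charPrimitive
  fun_prop

theorem norm_charPrimitive_le (ht : t ≠ 0) (x : ℝ) {α : ℝ} (hα₀ : 0 ≤ α) (hα₁ : α ≤ 1) :
    ‖charPrimitive t x‖ ≤ 2 * |t| ^ (α - 1) * |x| ^ α := by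
  have ht' : 0 < |t| := abs_pos.2 ht
  have hphase : (-2 * π * Complex.I * (t * x) : ℂ) =
      Complex.I * ((-2 * π * (t * x) : ℝ) : ℂ) := by push_cast; ring
  have hden : ‖(-2 * π * Complex.I * t : ℂ)‖ = 2 * π * |t| := by simp [abs_of_pos pi_pos]
  have habs : |-2 * π * (t * x)| = 2 * π * (|t| * |x|) := by
    rw [abs_mul, abs_mul, abs_mul, abs_neg, abs_of_pos pi_pos, abs_two]
  have hπ : (2 * π) ^ α ≤ 2 * π := by
    simpa using rpow_le_rpow_of_exponent_le (by linarith [pi_gt_three] : 1 ≤ 2 * π) hα₁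
  rw [charPrimitive, hphase, norm_div, hden, div_le_iff₀ (by positivity)]
  calc ‖Complex.exp (Complex.I * ((-2 * π * (t * x) : ℝ) : ℂ)) - 1‖
      ≤ 2 * |-2 * π * (t * x)| ^ α := norm_exp_I_mul_sub_one_le_rpow _ hα₀ hα₁
    _ = 2 * ((2 * π) ^ α * (|t| ^ α * |x| ^ α)) := by
        rw [habs, mul_rpow (by positivity) (by positivity), mul_rpow ht'.le (abs_nonneg _)]
    _ ≤ 2 * (2 * π * (|t| ^ α * |x| ^ α)) := by gcongr
    _ = 2 * |t| ^ (α - 1) * |x| ^ α * (2 * π * |t|) := by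
        rw [rpow_sub_one ht'.ne']
        field_simp

end CharPrimitive

section Weight

variable {α : ℝ}

theorem abs_rpow_le_one_add_sq_rpow (x : ℝ) (hα₀ : 0 ≤ α) :
    |x| ^ α ≤ (1 + x ^ 2) ^ (α / 2) := by
  calc |x| ^ α = (x ^ 2) ^ (α / 2) := by
        rw [← sq_abs, ← rpow_natCast, ← rpow_mul (abs_nonneg _)]
        congr 1
        push_cast
        ring
    _ ≤ (1 + x ^ 2) ^ (α / 2) := by gcongr; linarith

theorem integrable_one_add_sq_rpow (hα₁ : α < 1) :
    Integrable (fun x : ℝ => (1 + x ^ 2) ^ (-(2 - α) / 2)) := by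
  simpa using integrable_rpow_neg_one_add_norm_sq (E := ℝ) (μ := volume) (r := 2 - α)
    (by simp; linarith)

/-- The constant `K_α` in the bound `C K_α |t|^(α - 1)` for the truncated Fourier transforms of
functions with decay. -/
noncomputable def fourierConst (α : ℝ) : ℝ := 4 + 2 * ∫ x : ℝ, (1 + x ^ 2) ^ (-(2 - α) / 2)

end Weight

/-- The Fourier integral over `[-R, R]`. -/
noncomputable def truncFourier (f : ℝ → ℂ) (R t : ℝ) : ℂ :=
  ∫ x in (-R)..R, f x * Complex.exp (-2 * π * Complex.I * (t * x))

/-- The Fourier transform as an improper integral, for functions that are not integrable. -/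
noncomputable def limFourier (f : ℝ → ℂ) (t : ℝ) : ℂ :=
  limUnder atTop (fun R => truncFourier f R t)

/-- `f` is `C¹` and, with the constant `C`, has the decay at infinity of the noncompact picture of
a smooth vector: `f` like `1 / |x|` and `f'` like `1 / x²`. -/
structure HasDecay (f : ℝ → ℂ) (C : ℝ) : Prop where
  contDiff : ContDiff ℝ 1 f
  norm_le : ∀ x, ‖f x‖ ≤ C * (√(1 + x ^ 2))⁻¹
  norm_deriv_le : ∀ x, ‖deriv f x‖ ≤ C * (1 + x ^ 2)⁻¹

namespace HasDecay

variable {f : ℝ → ℂ} {C : ℝ}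

theorem nonneg (h : HasDecay f C) : 0 ≤ C := by
  simpa using (norm_nonneg _).trans (h.norm_le 0)

theorem continuous (h : HasDecay f C) : Continuous f := h.contDiff.continuous

theorem continuous_deriv (h : HasDecay f C) : Continuous (deriv f) :=
  h.contDiff.continuous_deriv le_rfl

theorem truncFourier_eq (h : HasDecay f C) {t : ℝ} (ht : t ≠ 0) (R : ℝ) :
    truncFourier f R t = f R * charPrimitive t R - f (-R) * charPrimitive t (-R) -
      ∫ x in (-R)..R, deriv f x * charPrimitive t x := by
  refine intervalIntegral.integral_mul_deriv_eq_deriv_mul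
    (fun x _ => (h.contDiff.differentiable one_ne_zero x).hasDerivAt)
    (fun x _ => hasDerivAt_charPrimitive ht x) (h.continuous_deriv.intervalIntegrable _ _) ?_
  exact (by fun_prop : Continuous _).intervalIntegrable _ _

theorem norm_mul_charPrimitive_le (h : HasDecay f C) {t : ℝ} (ht : t ≠ 0) {α : ℝ}
    (hα₀ : 0 ≤ α) (hα₁ : α < 1) (x : ℝ) :
    ‖f x * charPrimitive t x‖ ≤ C * (2 * |t| ^ (α - 1)) := by
  have hC := h.nonneg
  have hx : |x| ^ α ≤ √(1 + x ^ 2) := by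
    rw [sqrt_eq_rpow]
    exact (abs_rpow_le_one_add_sq_rpow x hα₀).trans
      (rpow_le_rpow_of_exponent_le (by nlinarith [sq_nonneg x]) (by linarith))
  rw [norm_mul]
  calc ‖f x‖ * ‖charPrimitive t x‖
      ≤ (C * (√(1 + x ^ 2))⁻¹) * (2 * |t| ^ (α - 1) * |x| ^ α) := by
        gcongr
        · exact h.norm_le x
        · exact norm_charPrimitive_le ht x hα₀ hα₁.le
    _ ≤ (C * (√(1 + x ^ 2))⁻¹) * (2 * |t| ^ (α - 1) * √(1 + x ^ 2)) := by gcongr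
    _ = C * (2 * |t| ^ (α - 1)) := by field_simp

theorem norm_deriv_mul_charPrimitive_le (h : HasDecay f C) {t : ℝ} (ht : t ≠ 0) {α : ℝ}
    (hα₀ : 0 ≤ α) (hα₁ : α < 1) (x : ℝ) :
    ‖deriv f x * charPrimitive t x‖ ≤ C * (2 * |t| ^ (α - 1)) * (1 + x ^ 2) ^ (-(2 - α) / 2) := by
  have hC := h.nonneg
  rw [norm_mul]
  calc ‖deriv f x‖ * ‖charPrimitive t x‖
      ≤ (C * (1 + x ^ 2)⁻¹) * (2 * |t| ^ (α - 1) * (1 + x ^ 2) ^ (α / 2)) := by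
        gcongr
        · exact h.norm_deriv_le x
        · refine (norm_charPrimitive_le ht x hα₀ hα₁.le).trans ?_
          gcongr
          exact abs_rpow_le_one_add_sq_rpow x hα₀
    _ = C * (2 * |t| ^ (α - 1)) * (1 + x ^ 2) ^ (-(2 - α) / 2) := by
        rw [show -(2 - α) / 2 = -1 + α / 2 by ring, rpow_add (by positivity), rpow_neg_one]
        ring

theorem integrable_deriv_mul_charPrimitive (h : HasDecay f C) {t : ℝ} (ht : t ≠ 0) :
    Integrable (fun x => deriv f x * charPrimitive t x) :=
  ((integrable_one_add_sq_rpow zero_lt_one).const_mul _).mono'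
    (h.continuous_deriv.mul (continuous_charPrimitive t)).aestronglyMeasurable
    (Eventually.of_forall (h.norm_deriv_mul_charPrimitive_le ht le_rfl zero_lt_one))

theorem norm_truncFourier_le (h : HasDecay f C) {t : ℝ} (ht : t ≠ 0) {α : ℝ}
    (hα₀ : 0 ≤ α) (hα₁ : α < 1) {R : ℝ} (hR : 0 ≤ R) :
    ‖truncFourier f R t‖ ≤ C * fourierConst α * |t| ^ (α - 1) := by
  have hC := h.nonneg
  have hboundary := h.norm_mul_charPrimitive_le ht hα₀ hα₁
  have hweight := (integrable_one_add_sq_rpow hα₁).const_mul (C * (2 * |t| ^ (α - 1)))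
  have hinterior : ‖∫ x in (-R)..R, deriv f x * charPrimitive t x‖ ≤
      C * (2 * |t| ^ (α - 1)) * ∫ x : ℝ, (1 + x ^ 2) ^ (-(2 - α) / 2) := by
    rw [intervalIntegral.integral_of_le (by linarith), ← integral_const_mul]
    refine (norm_integral_le_of_norm_le hweight.integrableOn (Eventually.of_forall
      (h.norm_deriv_mul_charPrimitive_le ht hα₀ hα₁))).trans ?_
    refine setIntegral_le_integral hweight (Eventually.of_forall fun x => ?_)
    simp only [Pi.zero_apply]
    positivity
  rw [h.truncFourier_eq ht]
  calc ‖f R * charPrimitive t R - f (-R) * charPrimitive t (-R) -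
        ∫ x in (-R)..R, deriv f x * charPrimitive t x‖
      ≤ ‖f R * charPrimitive t R‖ + ‖f (-R) * charPrimitive t (-R)‖ +
          ‖∫ x in (-R)..R, deriv f x * charPrimitive t x‖ :=
        (norm_sub_le _ _).trans (add_le_add_left (norm_sub_le _ _) _)
    _ ≤ C * (2 * |t| ^ (α - 1)) + C * (2 * |t| ^ (α - 1)) +
          C * (2 * |t| ^ (α - 1)) * ∫ x : ℝ, (1 + x ^ 2) ^ (-(2 - α) / 2) := by
        gcongr
        · exact hboundary R
        · exact hboundary (-R)
    _ = C * fourierConst α * |t| ^ (α - 1) := by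
        rw [fourierConst]
        ring

theorem tendsto_mul_charPrimitive (h : HasDecay f C) {t : ℝ} (ht : t ≠ 0) :
    Tendsto (fun x => f x * charPrimitive t x) (atBot ⊔ atTop) (𝓝 0) := by
  have hchar (x : ℝ) : ‖charPrimitive t x‖ ≤ 2 * |t| ^ ((0 : ℝ) - 1) := by
    simpa using norm_charPrimitive_le ht x le_rfl zero_le_one
  have hinv : Tendsto (fun x : ℝ => (√(1 + x ^ 2))⁻¹) (atBot ⊔ atTop) (𝓝 0) := by
    refine tendsto_inv_atTop_zero.comp (tendsto_atTop_mono (fun x => ?_)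
      (tendsto_abs_atBot_atTop.sup tendsto_abs_atTop_atTop))
    exact abs_le_sqrt (by linarith)
  have hzero := (hinv.const_mul C).mul_const (2 * |t| ^ ((0 : ℝ) - 1))
  rw [mul_zero, zero_mul] at hzero
  refine squeeze_zero_norm (fun x => ?_) hzero
  rw [norm_mul]
  exact mul_le_mul (h.norm_le x) (hchar x) (norm_nonneg _) ((norm_nonneg _).trans (h.norm_le x))

theorem tendsto_truncFourier (h : HasDecay f C) {t : ℝ} (ht : t ≠ 0) :
    Tendsto (fun R => truncFourier f R t) atTop (𝓝 (limFourier f t)) := by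
  have hboundary := h.tendsto_mul_charPrimitive ht
  have hlim : Tendsto (fun R => truncFourier f R t) atTop
      (𝓝 (0 - 0 - ∫ x, deriv f x * charPrimitive t x)) := by
    simp only [h.truncFourier_eq ht]
    exact ((hboundary.mono_left le_sup_right).sub
      ((hboundary.mono_left le_sup_left).comp tendsto_neg_atTop_atBot)).sub
      (intervalIntegral_tendsto_integral (h.integrable_deriv_mul_charPrimitive ht)
        tendsto_neg_atTop_atBot tendsto_id)
  rwa [limFourier, hlim.limUnder_eq]

theorem norm_limFourier_le (h : HasDecay f C) {t : ℝ} (ht : t ≠ 0) {α : ℝ}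
    (hα₀ : 0 ≤ α) (hα₁ : α < 1) : ‖limFourier f t‖ ≤ C * fourierConst α * |t| ^ (α - 1) :=
  le_of_tendsto (h.tendsto_truncFourier ht).norm
    ((eventually_ge_atTop 0).mono fun _ hR => h.norm_truncFourier_le ht hα₀ hα₁ hR)

theorem integrable_indicator (h : HasDecay f C) (R : ℝ) :
    Integrable ((Ioc (-R) R).indicator f) :=
  (integrable_indicator_iff measurableSet_Ioc).2
    (h.continuous.integrableOn_Icc.mono_set Ioc_subset_Icc_self)

end HasDecay

theorem truncFourier_eq_fourier (f : ℝ → ℂ) {R : ℝ} (hR : 0 ≤ R) :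
    truncFourier f R = 𝓕 ((Ioc (-R) R).indicator f) := by
  funext t
  rw [truncFourier, fourier_real_eq_integral_exp_smul,
    intervalIntegral.integral_of_le (by linarith), ← integral_indicator measurableSet_Ioc]
  congr 1
  funext x
  rw [indicator_mul_left, smul_eq_mul, mul_comm]
  congr 2
  push_cast
  ring

/-- Up to the decay constants, an integrable bound for `|t|^(u - 1)` times a product of two Fourier
transforms of functions with decay, where `σ = re u`. The bounds `|t|^(α - 1)` are used with
`α = 1 - σ / 4` for small and `α = 0` for large frequencies. -/
noncomputable def frequencyMajorant (σ t : ℝ) : ℝ :=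
  (fourierConst 0 ^ 2 + fourierConst (1 - σ / 4) ^ 2) *
    if |t| ≤ 1 then |t| ^ (σ / 2 - 1) else |t| ^ (σ - 3)

section FourierDecay

variable {u : ℂ}

theorem integrable_frequencyMajorant {σ : ℝ} (h₀ : 0 < σ) (h₁ : σ < 1) :
    Integrable (frequencyMajorant σ) :=
  (integrable_rpow_piecewise (by linarith) (by linarith)).const_mul _

theorem norm_abs_cpow_mul_mul_le {t : ℝ} (ht : t ≠ 0) {A B : ℂ} {a b : ℝ} (hA : ‖A‖ ≤ a)
    (hB : ‖B‖ ≤ b) : ‖((|t| : ℝ) : ℂ) ^ (u - 1) * (A * conj B)‖ ≤ |t| ^ (u.re - 1) * (a * b) := by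
  rw [norm_mul, norm_mul, RCLike.norm_conj, Complex.norm_cpow_eq_rpow_re_of_pos (abs_pos.2 ht),
    Complex.sub_re, Complex.one_re]
  have ha := (norm_nonneg _).trans hA
  gcongr

theorem norm_abs_cpow_mul_le_frequencyMajorant (h₀ : 0 < u.re) (h₁ : u.re < 1) {t : ℝ}
    (ht : t ≠ 0) {A B : ℂ} {C₁ C₂ : ℝ} (hC₁ : 0 ≤ C₁) (hC₂ : 0 ≤ C₂)
    (hA : ∀ α : ℝ, 0 ≤ α → α < 1 → ‖A‖ ≤ C₁ * fourierConst α * |t| ^ (α - 1))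
    (hB : ∀ α : ℝ, 0 ≤ α → α < 1 → ‖B‖ ≤ C₂ * fourierConst α * |t| ^ (α - 1)) :
    ‖((|t| : ℝ) : ℂ) ^ (u - 1) * (A * conj B)‖ ≤ C₁ * C₂ * frequencyMajorant u.re t := by
  have ht' : 0 < |t| := abs_pos.2 ht
  have hbound (α : ℝ) (hα₀ : 0 ≤ α) (hα₁ : α < 1) :
      ‖((|t| : ℝ) : ℂ) ^ (u - 1) * (A * conj B)‖ ≤
        C₁ * C₂ * (fourierConst α ^ 2 * |t| ^ (u.re - 1 + 2 * (α - 1))) := by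
    refine (norm_abs_cpow_mul_mul_le ht (hA α hα₀ hα₁) (hB α hα₀ hα₁)).trans_eq ?_
    rw [two_mul, rpow_add ht', rpow_add ht']
    ring
  rw [frequencyMajorant]
  split_ifs with hsmall
  · refine (hbound (1 - u.re / 4) (by linarith) (by linarith)).trans ?_
    rw [show u.re - 1 + 2 * (1 - u.re / 4 - 1) = u.re / 2 - 1 by ring]
    gcongr
    exact le_add_of_nonneg_left (sq_nonneg _)
  · refine (hbound 0 le_rfl zero_lt_one).trans ?_
    rw [show u.re - 1 + 2 * ((0 : ℝ) - 1) = u.re - 3 by ring]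
    gcongr
    exact le_add_of_nonneg_right (sq_nonneg _)

variable {f₁ f₂ : ℝ → ℂ} {C₁ C₂ : ℝ}

theorem norm_abs_cpow_mul_truncFourier_le (h₀ : 0 < u.re) (h₁ : u.re < 1) (hf₁ : HasDecay f₁ C₁)
    (hf₂ : HasDecay f₂ C₂) {R : ℝ} (hR : 0 ≤ R) {t : ℝ} (ht : t ≠ 0) :
    ‖((|t| : ℝ) : ℂ) ^ (u - 1) * (truncFourier f₁ R t * conj (truncFourier f₂ R t))‖ ≤
      C₁ * C₂ * frequencyMajorant u.re t :=
  norm_abs_cpow_mul_le_frequencyMajorant h₀ h₁ ht hf₁.nonneg hf₂.nonneg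
    (fun _ hα₀ hα₁ => hf₁.norm_truncFourier_le ht hα₀ hα₁ hR)
    (fun _ hα₀ hα₁ => hf₂.norm_truncFourier_le ht hα₀ hα₁ hR)

theorem aestronglyMeasurable_abs_cpow_mul_truncFourier (u : ℂ) (hf₁ : HasDecay f₁ C₁)
    (hf₂ : HasDecay f₂ C₂) {R : ℝ} (hR : 0 ≤ R) :
    AEStronglyMeasurable (fun t : ℝ => ((|t| : ℝ) : ℂ) ^ (u - 1) *
      (truncFourier f₁ R t * conj (truncFourier f₂ R t))) := by
  simp only [truncFourier_eq_fourier _ hR]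
  exact (by fun_prop : Measurable fun t : ℝ => ((|t| : ℝ) : ℂ) ^ (u - 1)).aestronglyMeasurable.mul
    ((continuous_fourier (hf₁.integrable_indicator R)).mul (Complex.continuous_conj.comp
      (continuous_fourier (hf₂.integrable_indicator R)))).aestronglyMeasurable

theorem tendsto_integral_abs_cpow_mul_truncFourier (h₀ : 0 < u.re) (h₁ : u.re < 1)
    (hf₁ : HasDecay f₁ C₁) (hf₂ : HasDecay f₂ C₂) :
    Tendsto (fun R => ∫ t : ℝ, ((|t| : ℝ) : ℂ) ^ (u - 1) *
        (truncFourier f₁ R t * conj (truncFourier f₂ R t))) atTop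
      (𝓝 (∫ t : ℝ, ((|t| : ℝ) : ℂ) ^ (u - 1) * (limFourier f₁ t * conj (limFourier f₂ t)))) := by
  have hne : ∀ᵐ t : ℝ, t ≠ 0 := Measure.ae_ne volume 0
  refine tendsto_integral_filter_of_dominated_convergence
    (fun t => C₁ * C₂ * frequencyMajorant u.re t) ?_ ?_
    ((integrable_frequencyMajorant h₀ h₁).const_mul _) ?_
  · filter_upwards [eventually_ge_atTop 0] with R hR
    exact aestronglyMeasurable_abs_cpow_mul_truncFourier u hf₁ hf₂ hR
  · filter_upwards [eventually_ge_atTop 0] with R hR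
    filter_upwards [hne] with t ht
    exact norm_abs_cpow_mul_truncFourier_le h₀ h₁ hf₁ hf₂ hR ht
  · filter_upwards [hne] with t ht
    exact ((hf₁.tendsto_truncFourier ht).mul ((Complex.continuous_conj.tendsto _).comp
      (hf₂.tendsto_truncFourier ht))).const_mul _

theorem norm_abs_sub_cpow_mul_le (h₀ : 0 < u.re) (hf₁ : HasDecay f₁ C₁) (hf₂ : HasDecay f₂ C₂)
    {x y : ℝ} {a b : ℂ} (ha : ‖a‖ ≤ ‖f₁ x‖) (hb : ‖b‖ ≤ ‖f₂ y‖) :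
    ‖((|x - y| : ℝ) : ℂ) ^ (-u) * (a * conj b)‖ ≤
      C₁ * C₂ * (|x - y| ^ (-u.re) * ((√(1 + x ^ 2))⁻¹ * (√(1 + y ^ 2))⁻¹)) := by
  have hu : (-u).re ≠ 0 := by simpa using h₀.ne'
  have ha' := ha.trans (hf₁.norm_le x)
  have hb' := hb.trans (hf₂.norm_le y)
  have hC₁ := hf₁.nonneg
  rw [norm_mul, norm_mul, RCLike.norm_conj,
    Complex.norm_cpow_eq_rpow_re_of_nonneg (abs_nonneg _) hu, Complex.neg_re]
  calc |x - y| ^ (-u.re) * (‖a‖ * ‖b‖)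
      ≤ |x - y| ^ (-u.re) * ((C₁ * (√(1 + x ^ 2))⁻¹) * (C₂ * (√(1 + y ^ 2))⁻¹)) := by gcongr
    _ = _ := by ring

theorem integrable_abs_sub_cpow_mul (h₀ : 0 < u.re) (h₁ : u.re < 1) (hf₁ : HasDecay f₁ C₁)
    (hf₂ : HasDecay f₂ C₂) {a b : ℝ → ℂ} (ha : AEStronglyMeasurable a)
    (hb : AEStronglyMeasurable b) (ha_le : ∀ x, ‖a x‖ ≤ ‖f₁ x‖) (hb_le : ∀ y, ‖b y‖ ≤ ‖f₂ y‖) :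
    Integrable (fun p : ℝ × ℝ => ((|p.1 - p.2| : ℝ) : ℂ) ^ (-u) * (a p.1 * conj (b p.2))) := by
  refine ((integrable_abs_sub_rpow_mul_inv_sqrt h₀ h₁).const_mul (C₁ * C₂)).mono' ?_
    (Eventually.of_forall fun p => norm_abs_sub_cpow_mul_le h₀ hf₁ hf₂ (ha_le _) (hb_le _))
  exact (by fun_prop : Measurable _).aestronglyMeasurable.mul
    (ha.comp_fst.mul (Complex.continuous_conj.comp_aestronglyMeasurable hb.comp_snd))

theorem tendsto_indicator_Ioc (f : ℝ → ℂ) (x : ℝ) :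
    Tendsto (fun R : ℝ => (Ioc (-R) R).indicator f x) atTop (𝓝 (f x)) := by
  refine tendsto_const_nhds.congr' ?_
  filter_upwards [eventually_gt_atTop |x|] with R hR
  have hx : x ∈ Ioc (-R) R := ⟨(abs_lt.1 hR).1, (abs_lt.1 hR).2.le⟩
  rw [indicator_of_mem hx]

theorem tendsto_integral_abs_sub_cpow_mul_indicator (h₀ : 0 < u.re) (h₁ : u.re < 1)
    (hf₁ : HasDecay f₁ C₁) (hf₂ : HasDecay f₂ C₂) :
    Tendsto (fun R => ∫ p : ℝ × ℝ, ((|p.1 - p.2| : ℝ) : ℂ) ^ (-u) *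
        ((Ioc (-R) R).indicator f₁ p.1 * conj ((Ioc (-R) R).indicator f₂ p.2))) atTop
      (𝓝 (rieszPairing u f₁ f₂)) := by
  have hpair : rieszPairing u f₁ f₂ =
      ∫ p : ℝ × ℝ, ((|p.1 - p.2| : ℝ) : ℂ) ^ (-u) * (f₁ p.1 * conj (f₂ p.2)) := by
    rw [Measure.volume_eq_prod, integral_prod_symm _ (integrable_abs_sub_cpow_mul h₀ h₁ hf₁ hf₂
      hf₁.continuous.aestronglyMeasurable hf₂.continuous.aestronglyMeasurable (fun _ => le_rfl)
      fun _ => le_rfl)]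
    simp only [rieszPairing, mul_assoc]
  rw [hpair]
  refine tendsto_integral_filter_of_dominated_convergence _ (Eventually.of_forall fun R => ?_)
    (Eventually.of_forall fun R => Eventually.of_forall fun p => ?_)
    ((integrable_abs_sub_rpow_mul_inv_sqrt h₀ h₁).const_mul (C₁ * C₂))
    (Eventually.of_forall fun p => ?_)
  · exact (integrable_abs_sub_cpow_mul h₀ h₁ hf₁ hf₂ (hf₁.integrable_indicator R).1
      (hf₂.integrable_indicator R).1 (fun _ => norm_indicator_le_norm_self _ _)
      fun _ => norm_indicator_le_norm_self _ _).1
  · exact norm_abs_sub_cpow_mul_le h₀ hf₁ hf₂ (norm_indicator_le_norm_self _ _)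
      (norm_indicator_le_norm_self _ _)
  · exact ((tendsto_indicator_Ioc f₁ p.1).mul ((Complex.continuous_conj.tendsto _).comp
      (tendsto_indicator_Ioc f₂ p.2))).const_mul _

theorem integral_abs_cpow_mul_truncFourier (h₀ : 0 < u.re) (h₁ : u.re < 1)
    (hf₁ : HasDecay f₁ C₁) (hf₂ : HasDecay f₂ C₂) {R : ℝ} (hR : 0 ≤ R) :
    ∫ t : ℝ, ((|t| : ℝ) : ℂ) ^ (u - 1) * (truncFourier f₁ R t * conj (truncFourier f₂ R t)) =
      G₀ u * ∫ p : ℝ × ℝ, ((|p.1 - p.2| : ℝ) : ℂ) ^ (-u) *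
        ((Ioc (-R) R).indicator f₁ p.1 * conj ((Ioc (-R) R).indicator f₂ p.2)) := by
  have hfreq : Integrable (fun t : ℝ => ((|t| : ℝ) : ℂ) ^ (u - 1) *
      (truncFourier f₁ R t * conj (truncFourier f₂ R t))) := by
    refine ((integrable_frequencyMajorant h₀ h₁).const_mul (C₁ * C₂)).mono'
      (aestronglyMeasurable_abs_cpow_mul_truncFourier u hf₁ hf₂ hR) ?_
    filter_upwards [Measure.ae_ne volume 0] with t ht
    exact norm_abs_cpow_mul_truncFourier_le h₀ h₁ hf₁ hf₂ hR ht
  simp only [truncFourier_eq_fourier _ hR] at hfreq ⊢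
  exact integral_abs_cpow_mul_fourier h₀ h₁ (hf₁.integrable_indicator R)
    (hf₂.integrable_indicator R) hfreq (integrable_abs_sub_cpow_mul h₀ h₁ hf₁ hf₂
      (hf₁.integrable_indicator R).1 (hf₂.integrable_indicator R).1
      (fun _ => norm_indicator_le_norm_self _ _) fun _ => norm_indicator_le_norm_self _ _)

theorem integral_abs_cpow_mul_limFourier (h₀ : 0 < u.re) (h₁ : u.re < 1)
    (hf₁ : HasDecay f₁ C₁) (hf₂ : HasDecay f₂ C₂) :
    ∫ t : ℝ, ((|t| : ℝ) : ℂ) ^ (u - 1) * (limFourier f₁ t * conj (limFourier f₂ t)) =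
      G₀ u * rieszPairing u f₁ f₂ := by
  refine tendsto_nhds_unique (tendsto_integral_abs_cpow_mul_truncFourier h₀ h₁ hf₁ hf₂)
    (((tendsto_integral_abs_sub_cpow_mul_indicator h₀ h₁ hf₁ hf₂).const_mul (G₀ u)).congr' ?_)
  filter_upwards [eventually_ge_atTop 0] with R hR
  exact (integral_abs_cpow_mul_truncFourier h₀ h₁ hf₁ hf₂ hR).symm

end FourierDecay

end Fourier

/-! ### The Rankin–Selberg integral -/

theorem ofReal_sqrt_cpow_eq_exp (c : ℂ) (x : ℝ) :
    ((√(1 + x ^ 2) : ℝ) : ℂ) ^ c = Complex.exp (((log (1 + x ^ 2) / 2 : ℝ) : ℂ) * c) := by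
  have hx : 0 < √(1 + x ^ 2) := by positivity
  rw [Complex.cpow_def_of_ne_zero (by exact_mod_cast hx.ne'), ← Complex.ofReal_log hx.le,
    log_sqrt (by positivity)]

theorem contDiff_ofReal_sqrt_cpow (c : ℂ) {n : WithTop ℕ∞} :
    ContDiff ℝ n (fun x : ℝ => ((√(1 + x ^ 2) : ℝ) : ℂ) ^ c) := by
  simp only [ofReal_sqrt_cpow_eq_exp]
  have hlog : ContDiff ℝ n (fun x : ℝ => log (1 + x ^ 2) / 2) :=
    (ContDiff.log (by fun_prop) fun x => by positivity).div_const 2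
  exact ((Complex.ofRealCLM.contDiff.comp hlog).mul contDiff_const).cexp

theorem hasDerivAt_ofReal_sqrt_cpow (c : ℂ) (x : ℝ) :
    HasDerivAt (fun x : ℝ => ((√(1 + x ^ 2) : ℝ) : ℂ) ^ c)
      (((√(1 + x ^ 2) : ℝ) : ℂ) ^ c * (c * x * ((1 + x ^ 2)⁻¹ : ℝ))) x := by
  have hlog : HasDerivAt (fun x : ℝ => log (1 + x ^ 2) / 2) (x * (1 + x ^ 2)⁻¹) x := by
    have hsq : HasDerivAt (fun x : ℝ => 1 + x ^ 2) (2 * x) x := by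
      simpa using (hasDerivAt_pow 2 x).const_add 1
    exact ((hsq.log (by positivity)).div_const 2).congr_deriv (by field_simp)
  simp only [ofReal_sqrt_cpow_eq_exp]
  refine (hlog.ofReal_comp.mul_const c).cexp.congr_deriv ?_
  push_cast
  ring

theorem periodic_deriv_comp_rot (F : SLpm → ℂ) :
    Function.Periodic (deriv fun θ => F (rot θ)) (2 * π) := fun θ => by
  rw [← deriv_comp_add_const]
  simp only [rot_add_two_pi]

namespace IsLowerHomogeneous

variable {c : ℂ} {F : SLpm → ℂ}

theorem apply_rot_mul_unip (hF : IsLowerHomogeneous c F) (θ x : ℝ) :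
    F (rot θ * unip x) = ((√(1 + x ^ 2) : ℝ) : ℂ) ^ (-c) * F (rot (θ - arctan x)) := by
  rw [hF.apply_mul_unip, ← rot_add, ← sub_eq_add_neg]

theorem contDiff_rot_mul_unip (hF : IsLowerHomogeneous c F)
    (hs : ContDiff ℝ ∞ (fun θ => F (rot θ))) (θ : ℝ) :
    ContDiff ℝ ∞ (fun x => F (rot θ * unip x)) := by
  simp only [hF.apply_rot_mul_unip]
  exact (contDiff_ofReal_sqrt_cpow (-c)).mul (hs.comp (contDiff_const.sub contDiff_arctan))

theorem deriv_rot_mul_unip (hF : IsLowerHomogeneous c F)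
    (hs : Differentiable ℝ (fun θ => F (rot θ))) (θ x : ℝ) :
    deriv (fun x => F (rot θ * unip x)) x =
      ((√(1 + x ^ 2) : ℝ) : ℂ) ^ (-c) * ((1 + x ^ 2)⁻¹ : ℝ) *
        (-c * x * F (rot (θ - arctan x)) - deriv (fun θ => F (rot θ)) (θ - arctan x)) := by
  simp only [hF.apply_rot_mul_unip]
  have harg := (hs (θ - arctan x)).hasDerivAt.scomp x ((hasDerivAt_arctan x).const_sub θ)
  refine ((hasDerivAt_ofReal_sqrt_cpow (-c) x).mul harg).deriv.trans ?_
  simp only [Function.comp, Complex.real_smul]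
  push_cast
  ring

theorem norm_deriv_rot_mul_unip_le (hF : IsLowerHomogeneous c F) (hc : c.re = 1)
    (hs : Differentiable ℝ (fun θ => F (rot θ))) {H₀ H₁ : ℝ} (hH₀ : ∀ θ, ‖F (rot θ)‖ ≤ H₀)
    (hH₁ : ∀ θ, ‖deriv (fun θ => F (rot θ)) θ‖ ≤ H₁) (θ x : ℝ) :
    ‖deriv (fun x => F (rot θ * unip x)) x‖ ≤ (‖c‖ * H₀ + H₁) * (1 + x ^ 2)⁻¹ := by
  have hH₁_nonneg : 0 ≤ H₁ := (norm_nonneg _).trans (hH₁ 0)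
  have hX : 1 ≤ √(1 + x ^ 2) := one_le_sqrt.2 (by nlinarith [sq_nonneg x])
  have hxX : |x| ≤ √(1 + x ^ 2) := le_sqrt_of_sq_le (by rw [sq_abs]; linarith)
  have hbracket : ‖-c * x * F (rot (θ - arctan x)) - deriv (fun θ => F (rot θ)) (θ - arctan x)‖ ≤
      (‖c‖ * H₀ + H₁) * √(1 + x ^ 2) := by
    calc _ ≤ ‖c‖ * |x| * ‖F (rot (θ - arctan x))‖ +
            ‖deriv (fun θ => F (rot θ)) (θ - arctan x)‖ := by
          refine (norm_sub_le _ _).trans_eq ?_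
          rw [norm_mul, norm_mul, norm_neg, Complex.norm_real, norm_eq_abs]
      _ ≤ ‖c‖ * √(1 + x ^ 2) * H₀ + H₁ * √(1 + x ^ 2) := by
          gcongr
          · exact hH₀ _
          · exact (hH₁ _).trans (le_mul_of_one_le_right hH₁_nonneg hX)
      _ = (‖c‖ * H₀ + H₁) * √(1 + x ^ 2) := by ring
  rw [hF.deriv_rot_mul_unip hs, norm_mul, norm_mul, norm_ofReal_sqrt_cpow, Complex.neg_re, hc,
    rpow_neg_one, Complex.norm_real, norm_of_nonneg (by positivity)]
  calc _ ≤ (√(1 + x ^ 2))⁻¹ * (1 + x ^ 2)⁻¹ * ((‖c‖ * H₀ + H₁) * √(1 + x ^ 2)) := by gcongr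
    _ = (‖c‖ * H₀ + H₁) * (1 + x ^ 2)⁻¹ := by field_simp

theorem exists_hasDecay (hF : IsLowerHomogeneous c F) (hc : c.re = 1)
    (hs : ContDiff ℝ ∞ (fun θ => F (rot θ))) :
    ∃ C, ∀ θ, HasDecay (fun x => F (rot θ * unip x)) C := by
  obtain ⟨H₀, hH₀_nonneg, hH₀⟩ :=
    exists_norm_le_of_periodic (periodic_comp_rot F) two_pi_pos hs.continuous
  obtain ⟨H₁, hH₁_nonneg, hH₁⟩ := exists_norm_le_of_periodic (periodic_deriv_comp_rot F)
    two_pi_pos (hs.continuous_deriv (by simp))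
  refine ⟨H₀ + (‖c‖ * H₀ + H₁), fun θ =>
    ⟨(hF.contDiff_rot_mul_unip hs θ).of_le (by simp), fun x => ?_, fun x => ?_⟩⟩
  · rw [hF.apply_rot_mul_unip, norm_mul, norm_ofReal_sqrt_cpow, Complex.neg_re, hc, rpow_neg_one,
      mul_comm]
    gcongr
    exact (hH₀ _).trans (le_add_of_nonneg_right (by positivity))
  · refine (hF.norm_deriv_rot_mul_unip_le hc (hs.differentiable (by simp)) hH₀ hH₁ θ x).trans ?_
    exact mul_le_mul_of_nonneg_right (le_add_of_nonneg_left hH₀_nonneg) (by positivity)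

theorem tendsto_truncatedWhittaker (hF : IsLowerHomogeneous c F) (hc : c.re = 1)
    (hs : ContDiff ℝ ∞ (fun θ => F (rot θ))) (g : SLpm) :
    Tendsto (truncatedWhittaker (leftTranslate g⁻¹ F)) atTop (𝓝 (Wh F g)) := by
  have hs' : ContDiff ℝ ∞ (fun θ => leftTranslate g⁻¹ F (rot θ)) := by
    simpa using hF.contDiff_mul_rot hs g
  obtain ⟨C, hC⟩ := (hF.translate g⁻¹).exists_hasDecay hc hs'
  have htrunc : (fun R => truncFourier (fun x => leftTranslate g⁻¹ F (rot 0 * unip x)) R 1) =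
      truncatedWhittaker (leftTranslate g⁻¹ F) := by
    funext R
    simp only [truncFourier, truncatedWhittaker, noncompactPicture, rot_zero, one_mul,
      Complex.ofReal_one]
  have hlim := (hC 0).tendsto_truncFourier one_ne_zero
  rwa [limFourier, htrunc] at hlim

end IsLowerHomogeneous

theorem integral_comp_mul_mul_exp (f : ℝ → ℂ) {b : ℝ} (hb : b ≠ 0) (R : ℝ) :
    ∫ x in (-R)..R, f (b * x) * Complex.exp (-2 * π * Complex.I * x) =
      ((|b|⁻¹ : ℝ) : ℂ) * truncFourier f (|b| * R) b⁻¹ := by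
  have hbC : (b : ℂ) ≠ 0 := by exact_mod_cast hb
  have hsubst := intervalIntegral.integral_comp_mul_left (a := -R) (b := R)
    (fun y : ℝ => f y * Complex.exp (-2 * π * Complex.I * ((b⁻¹ : ℝ) * y))) hb
  have hcancel (x : ℝ) : (((b⁻¹ : ℝ) : ℂ) * ((b * x : ℝ) : ℂ)) = x := by
    push_cast
    field_simp
  simp only [hcancel] at hsubst
  rw [hsubst, truncFourier, Complex.real_smul]
  rcases lt_or_gt_of_ne hb with hb | hb
  · rw [abs_of_neg hb, intervalIntegral.integral_symm, show -(-b * R) = b * R by ring,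
      show -b * R = b * -R by ring, inv_neg, Complex.ofReal_neg]
    ring
  · rw [abs_of_pos hb, mul_neg]

namespace IsLowerHomogeneous

variable {c : ℂ} {F : SLpm → ℂ}

theorem truncatedWhittaker_rot_mul_diag (hF : IsLowerHomogeneous c F) (θ : ℝ) {a : ℝ} (ha : a ≠ 0)
    (R : ℝ) : truncatedWhittaker (leftTranslate (rot θ * diag a)⁻¹ F) R =
      ((|a| : ℝ) : ℂ) ^ (c - 2) *
        truncFourier (fun x => F (rot θ * unip x)) (|a * (|a|)| * R) (a * |a|)⁻¹ := by
  have haC : ((|a| : ℝ) : ℂ) ≠ 0 := by exact_mod_cast abs_ne_zero.2 ha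
  have hscale : truncatedWhittaker (leftTranslate (rot θ * diag a)⁻¹ F) R = ((|a| : ℝ) : ℂ) ^ c *
      ∫ x in (-R)..R, F (rot θ * unip (a * |a| * x)) * Complex.exp (-2 * π * Complex.I * x) := by
    simp only [truncatedWhittaker, noncompactPicture, leftTranslate_apply, inv_inv,
      hF.apply_mul_diag_mul_unip (rot θ) ha]
    simp only [mul_assoc (_ ^ c), intervalIntegral.integral_const_mul]
  rw [hscale, integral_comp_mul_mul_exp (fun x => F (rot θ * unip x))
    (mul_ne_zero ha (abs_ne_zero.2 ha)), ← mul_assoc, Complex.cpow_sub _ _ haC, div_eq_mul_inv]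
  congr 2
  rw [abs_mul, abs_abs, ← sq]
  norm_cast

theorem Wh_rot_mul_diag (hF : IsLowerHomogeneous c F) (hc : c.re = 1)
    (hs : ContDiff ℝ ∞ (fun θ => F (rot θ))) (θ : ℝ) {a : ℝ} (ha : a ≠ 0) :
    Wh F (rot θ * diag a) = ((|a| : ℝ) : ℂ) ^ (c - 2) *
      limFourier (fun x => F (rot θ * unip x)) (a * |a|)⁻¹ := by
  have hb : a * |a| ≠ 0 := mul_ne_zero ha (abs_ne_zero.2 ha)
  obtain ⟨C, hC⟩ := hF.exists_hasDecay hc hs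
  have hR : Tendsto (fun R => |a * (|a|)| * R) atTop atTop :=
    tendsto_id.const_mul_atTop (abs_pos.2 hb)
  have hlim := (((hC θ).tendsto_truncFourier (inv_ne_zero hb)).comp hR).const_mul
    (((|a| : ℝ) : ℂ) ^ (c - 2))
  refine tendsto_nhds_unique (hF.tendsto_truncatedWhittaker hc hs (rot θ * diag a))
    (hlim.congr fun R => ?_)
  rw [hF.truncatedWhittaker_rot_mul_diag θ ha, Function.comp]

theorem continuous_truncFourier (hF : IsLowerHomogeneous c F)
    (hs : Continuous (fun θ => F (rot θ))) (R : ℝ) :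
    Continuous (fun p : ℝ × ℝ => truncFourier (fun x => F (rot p.1 * unip x)) R p.2) := by
  unfold truncFourier
  apply intervalIntegral.continuous_parametric_intervalIntegral_of_continuous'
  simp only [hF.apply_rot_mul_unip]
  have hweight : Continuous (fun q : (ℝ × ℝ) × ℝ => ((√(1 + q.2 ^ 2) : ℝ) : ℂ) ^ (-c)) :=
    (continuous_ofReal_sqrt_cpow (-c)).comp continuous_snd
  have hrot : Continuous (fun q : (ℝ × ℝ) × ℝ => F (rot (q.1.1 - arctan q.2))) :=
    hs.comp (by fun_prop : Continuous fun q : (ℝ × ℝ) × ℝ => q.1.1 - arctan q.2)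
  exact (hweight.mul hrot).mul (by fun_prop)

theorem aestronglyMeasurable_Wh (hF : IsLowerHomogeneous c F) (hc : c.re = 1)
    (hs : ContDiff ℝ ∞ (fun θ => F (rot θ))) (μ : Measure ℝ) [SFinite μ] :
    AEStronglyMeasurable (fun p : ℝ × ℝ => Wh F (rot p.1 * diag p.2)) (μ.prod volume) := by
  obtain ⟨C, hC⟩ := hF.exists_hasDecay hc hs
  refine aestronglyMeasurable_of_tendsto_ae atTop (f := fun (n : ℕ) (p : ℝ × ℝ) =>
    ((|p.2| : ℝ) : ℂ) ^ (c - 2) *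
      truncFourier (fun x => F (rot p.1 * unip x)) n (p.2 * |p.2|)⁻¹) (fun n => ?_) ?_
  · have hpow : Measurable (fun p : ℝ × ℝ => ((|p.2| : ℝ) : ℂ) ^ (c - 2)) := by fun_prop
    have hfreq : Measurable (fun p : ℝ × ℝ => (p.1, (p.2 * |p.2|)⁻¹)) := by fun_prop
    exact (hpow.mul
      ((hF.continuous_truncFourier hs.continuous n).measurable.comp hfreq)).aestronglyMeasurable
  · have hsnd_ne : ∀ᵐ p : ℝ × ℝ ∂(μ.prod volume), p.2 ≠ 0 :=
      Measure.quasiMeasurePreserving_snd.ae (Measure.ae_ne volume 0)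
    filter_upwards [hsnd_ne] with p hp
    rw [hF.Wh_rot_mul_diag hc hs p.1 hp]
    have hfreq_ne : (p.2 * |p.2|)⁻¹ ≠ 0 := inv_ne_zero (mul_ne_zero hp (abs_ne_zero.2 hp))
    exact (((hC p.1).tendsto_truncFourier hfreq_ne).comp tendsto_natCast_atTop_atTop).const_mul _

end IsLowerHomogeneous

section InvMulAbs

theorem hasDerivAt_inv_mul_abs {a : ℝ} (ha : a ≠ 0) :
    HasDerivAt (fun a : ℝ => (a * |a|)⁻¹) (-(2 * |a|) / (a * |a|) ^ 2) a := by
  refine (((hasDerivAt_id a).mul (hasDerivAt_abs ha)).inv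
    (mul_ne_zero ha (abs_ne_zero.2 ha))).congr_deriv ?_
  simp only [id, one_mul]
  rw [self_mul_sign, two_mul]
  rfl

theorem abs_deriv_inv_mul_abs {a : ℝ} (ha : a ≠ 0) :
    |-(2 * |a|) / (a * |a|) ^ 2| = 2 * (|a| ^ 3)⁻¹ := by
  have ha' : |a| ≠ 0 := abs_ne_zero.2 ha
  rw [abs_div, abs_neg, abs_mul, abs_abs, abs_pow, abs_mul, abs_abs, abs_two]
  field_simp

theorem injOn_inv_mul_abs : InjOn (fun a : ℝ => (a * |a|)⁻¹) {0}ᶜ := by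
  intro a ha b hb h
  have hab : a * |a| = b * |b| := inv_injective h
  rcases lt_or_gt_of_ne (ha : a ≠ 0) with ha | ha <;>
    rcases lt_or_gt_of_ne (hb : b ≠ 0) with hb | hb <;>
    simp only [abs_of_neg, abs_of_pos, ha, hb] at hab <;> nlinarith

theorem image_inv_mul_abs : (fun a : ℝ => (a * |a|)⁻¹) '' {0}ᶜ = {0}ᶜ := by
  ext t
  constructor
  · rintro ⟨a, ha, rfl⟩
    exact inv_ne_zero (mul_ne_zero ha (abs_ne_zero.2 ha))
  · intro ht
    rcases lt_or_gt_of_ne (ht : t ≠ 0) with ht | ht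
    · have hs : 0 < √(-t) := sqrt_pos.2 (neg_pos.2 ht)
      refine ⟨-(√(-t))⁻¹, by simp [hs.ne'], ?_⟩
      simp only [abs_neg, abs_inv, abs_of_pos hs]
      rw [neg_mul, ← mul_inv, mul_self_sqrt (neg_nonneg.2 ht.le)]
      simp
    · have hs : 0 < √t := sqrt_pos.2 ht
      refine ⟨(√t)⁻¹, by simp [hs.ne'], ?_⟩
      simp only [abs_inv, abs_of_pos hs]
      rw [← mul_inv, mul_self_sqrt ht.le, inv_inv]

theorem restrict_compl_zero : (volume : Measure ℝ).restrict {0}ᶜ = volume :=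
  Measure.restrict_eq_self_of_ae_mem (Measure.ae_ne volume 0)

theorem integral_comp_inv_mul_abs (Q : ℝ → ℂ) :
    ∫ a : ℝ, (((|a| ^ 3)⁻¹ : ℝ) : ℂ) * Q (a * |a|)⁻¹ = 1 / 2 * ∫ t, Q t := by
  have hmeas : MeasurableSet ({0}ᶜ : Set ℝ) := (measurableSet_singleton 0).compl
  have hsubst := integral_image_eq_integral_abs_deriv_smul hmeas
    (fun a ha => (hasDerivAt_inv_mul_abs ha).hasDerivWithinAt) injOn_inv_mul_abs Q
  have hjac : ∫ a in {0}ᶜ, |-(2 * |a|) / (a * |a|) ^ 2| • Q (a * |a|)⁻¹ =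
      ∫ a in {0}ᶜ, (2 : ℂ) * ((((|a| ^ 3)⁻¹ : ℝ) : ℂ) * Q (a * |a|)⁻¹) :=
    setIntegral_congr_fun hmeas fun a ha => by
      simp only [abs_deriv_inv_mul_abs ha, Complex.real_smul]
      push_cast
      ring
  rw [image_inv_mul_abs, hjac, restrict_compl_zero, integral_const_mul] at hsubst
  rw [hsubst]
  ring

theorem integrable_comp_inv_mul_abs {Q : ℝ → ℝ} (hQ : Integrable Q) :
    Integrable (fun a : ℝ => (|a| ^ 3)⁻¹ * Q (a * |a|)⁻¹) := by
  have hmeas : MeasurableSet ({0}ᶜ : Set ℝ) := (measurableSet_singleton 0).compl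
  have hsubst := integrableOn_image_iff_integrableOn_abs_deriv_smul hmeas
    (fun a ha => (hasDerivAt_inv_mul_abs ha).hasDerivWithinAt) injOn_inv_mul_abs Q
  rw [image_inv_mul_abs] at hsubst
  have hjac := (hsubst.1 hQ.integrableOn).congr_fun
    (g := fun a => 2 * ((|a| ^ 3)⁻¹ * Q (a * |a|)⁻¹))
    (fun a ha => by simp only [abs_deriv_inv_mul_abs ha, smul_eq_mul]; ring) hmeas
  rw [IntegrableOn, restrict_compl_zero] at hjac
  simpa using hjac.const_mul (1 / 2)

end InvMulAbs

section RankinSelberg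

variable {l₁ l₂ : ℝ} {s : ℂ} {F₁ F₂ Φ : SLpm → ℂ}

theorem abs_cpow_rsIntegrand_eq {a : ℝ} (ha : a ≠ 0) :
    ((|a| : ℝ) : ℂ) ^ (Complex.I * l₁ + 1 - 2) *
        ((|a| : ℝ) : ℂ) ^ conj (Complex.I * l₂ + 1 - 2) * ((|a| : ℝ) : ℂ) ^ (-(2 * s)) *
        ((|a| ^ 2 / |a| : ℝ) : ℂ) =
      (((|a| ^ 3)⁻¹ : ℝ) : ℂ) * ((|(a * |a|)⁻¹| : ℝ) : ℂ) ^ (uParam l₁ l₂ s - 1) := by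
  have ha' : 0 < |a| := abs_pos.2 ha
  have haC : ((|a| : ℝ) : ℂ) ≠ 0 := by exact_mod_cast ha'.ne'
  have hfreq : ((|(a * |a|)⁻¹| : ℝ) : ℂ) ^ (uParam l₁ l₂ s - 1) =
      ((|a| : ℝ) : ℂ) ^ (-(uParam l₁ l₂ s - 1) + -(uParam l₁ l₂ s - 1)) := by
    rw [abs_inv, abs_mul, abs_abs, ofReal_inv_cpow (by positivity), Complex.ofReal_mul,
      Complex.mul_cpow_ofReal_nonneg ha'.le ha'.le, ← Complex.cpow_add _ _ haC]
  have hcube : (((|a| ^ 3)⁻¹ : ℝ) : ℂ) = ((|a| : ℝ) : ℂ) ^ (-3 : ℂ) := by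
    rw [Complex.cpow_neg]
    norm_cast
  have hdensity : ((|a| ^ 2 / |a| : ℝ) : ℂ) = ((|a| : ℝ) : ℂ) ^ (1 : ℂ) := by
    rw [Complex.cpow_one, sq, mul_self_div_self]
  simp only [hfreq, hcube, hdensity, ← Complex.cpow_add _ _ haC]
  congr 1
  simp [uParam, Complex.conj_ofNat]
  ring

theorem rsIntegrand_eq (hF₁ : IsLowerHomogeneous (Complex.I * l₁ + 1) F₁)
    (hF₂ : IsLowerHomogeneous (Complex.I * l₂ + 1) F₂) (hΦ : IsUpperHomogeneous (-(2 * s)) Φ)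
    (hs₁ : ContDiff ℝ ∞ (fun θ => F₁ (rot θ))) (hs₂ : ContDiff ℝ ∞ (fun θ => F₂ (rot θ)))
    (θ : ℝ) {a : ℝ} (ha : a ≠ 0) :
    rsIntegrand F₁ F₂ Φ (θ, a) = Φ (rot θ) / (2 * π) * ((((|a| ^ 3)⁻¹ : ℝ) : ℂ) *
      (((|(a * |a|)⁻¹| : ℝ) : ℂ) ^ (uParam l₁ l₂ s - 1) *
        (limFourier (fun x => F₁ (rot θ * unip x)) (a * |a|)⁻¹ *
          conj (limFourier (fun x => F₂ (rot θ * unip x)) (a * |a|)⁻¹)))) := by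
  have hdiag : Φ (rot θ * diag a) = ((|a| : ℝ) : ℂ) ^ (-(2 * s)) * Φ (rot θ) := by
    simpa [entry_diag ha] using hΦ (rot θ) (diag a) (by simp [entry_diag ha])
  rw [rsIntegrand, hF₁.Wh_rot_mul_diag (by simp) hs₁ θ ha, hF₂.Wh_rot_mul_diag (by simp) hs₂ θ ha,
    map_mul, conj_ofReal_cpow (abs_nonneg a), hdiag, Complex.ofReal_div _ (2 * π),
    Complex.ofReal_mul 2 π, Complex.ofReal_ofNat]
  linear_combination Φ (rot θ) / (2 * π) *
    (limFourier (fun x => F₁ (rot θ * unip x)) (a * |a|)⁻¹ *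
      conj (limFourier (fun x => F₂ (rot θ * unip x)) (a * |a|)⁻¹)) *
    abs_cpow_rsIntegrand_eq (l₁ := l₁) (l₂ := l₂) (s := s) ha

theorem aestronglyMeasurable_rsIntegrand (hF₁ : IsLowerHomogeneous (Complex.I * l₁ + 1) F₁)
    (hF₂ : IsLowerHomogeneous (Complex.I * l₂ + 1) F₂) (hΦ : IsUpperHomogeneous (-(2 * s)) Φ)
    (hs₁ : ContDiff ℝ ∞ (fun θ => F₁ (rot θ))) (hs₂ : ContDiff ℝ ∞ (fun θ => F₂ (rot θ)))
    (hΦc : Continuous (fun θ => Φ (rot θ))) (μ : Measure ℝ) [SFinite μ] :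
    AEStronglyMeasurable (rsIntegrand F₁ F₂ Φ) (μ.prod volume) := by
  have hsection : AEStronglyMeasurable (fun p : ℝ × ℝ => Φ (rot p.1 * diag p.2))
      (μ.prod volume) := by
    have hpow : Measurable (fun p : ℝ × ℝ => ((|p.2| : ℝ) : ℂ) ^ (-(2 * s))) := by fun_prop
    refine (hpow.aestronglyMeasurable.mul
      (hΦc.comp continuous_fst).aestronglyMeasurable).congr ?_
    filter_upwards [Measure.quasiMeasurePreserving_snd.ae (Measure.ae_ne volume 0)] with p hp
    have hp : p.2 ≠ 0 := hp
    simpa [entry_diag hp] using (hΦ (rot p.1) (diag p.2) (by simp [entry_diag hp])).symm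
  have hdensity : Measurable (fun p : ℝ × ℝ => ((|p.2| ^ 2 / |p.2| / (2 * π) : ℝ) : ℂ)) := by
    fun_prop
  exact (((hF₁.aestronglyMeasurable_Wh (by simp) hs₁ μ).mul
    (hF₂.aestronglyMeasurable_Wh (by simp) hs₂ μ).star).mul hsection).mul
    hdensity.aestronglyMeasurable

theorem integrable_rsIntegrand (h₀ : 0 < s.re) (h₁ : s.re < 1)
    (hF₁ : IsLowerHomogeneous (Complex.I * l₁ + 1) F₁)
    (hF₂ : IsLowerHomogeneous (Complex.I * l₂ + 1) F₂) (hΦ : IsUpperHomogeneous (-(2 * s)) Φ)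
    (hs₁ : ContDiff ℝ ∞ (fun θ => F₁ (rot θ))) (hs₂ : ContDiff ℝ ∞ (fun θ => F₂ (rot θ)))
    (hΦc : Continuous (fun θ => Φ (rot θ))) :
    Integrable (rsIntegrand F₁ F₂ Φ) (periodMeasure.prod volume) := by
  have hu₀ : 0 < (uParam l₁ l₂ s).re := by rwa [uParam_re]
  have hu₁ : (uParam l₁ l₂ s).re < 1 := by rwa [uParam_re]
  obtain ⟨S, hS₀, hS⟩ := exists_norm_le_of_periodic (periodic_comp_rot Φ) two_pi_pos hΦc
  obtain ⟨C₁, hC₁⟩ := hF₁.exists_hasDecay (by simp) hs₁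
  obtain ⟨C₂, hC₂⟩ := hF₂.exists_hasDecay (by simp) hs₂
  have hdom : Integrable (fun p : ℝ × ℝ => S / (2 * π) * ((|p.2| ^ 3)⁻¹ *
      (C₁ * C₂ * frequencyMajorant (uParam l₁ l₂ s).re (p.2 * |p.2|)⁻¹)))
      (periodMeasure.prod volume) :=
    ((integrable_comp_inv_mul_abs ((integrable_frequencyMajorant hu₀ hu₁).const_mul
      (C₁ * C₂))).comp_snd periodMeasure).const_mul _
  refine hdom.mono' (aestronglyMeasurable_rsIntegrand hF₁ hF₂ hΦ hs₁ hs₂ hΦc _) ?_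
  filter_upwards [Measure.quasiMeasurePreserving_snd.ae (Measure.ae_ne volume 0)]
    with ⟨θ, a⟩ (ha : a ≠ 0)
  have ht : (a * |a|)⁻¹ ≠ 0 := inv_ne_zero (mul_ne_zero ha (abs_ne_zero.2 ha))
  rw [rsIntegrand_eq hF₁ hF₂ hΦ hs₁ hs₂ θ ha, norm_mul, norm_mul, Complex.norm_real,
    norm_of_nonneg (by positivity : 0 ≤ (|a| ^ 3)⁻¹), norm_div,
    show ‖(2 * π : ℂ)‖ = 2 * π by simp [abs_of_pos pi_pos]]
  gcongr
  · exact hS θ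
  · exact norm_abs_cpow_mul_le_frequencyMajorant hu₀ hu₁ ht (hC₁ θ).nonneg (hC₂ θ).nonneg
      (fun _ => (hC₁ θ).norm_limFourier_le ht) (fun _ => (hC₂ θ).norm_limFourier_le ht)

theorem integral_rsIntegrand (h₀ : 0 < s.re) (h₁ : s.re < 1)
    (hF₁ : IsLowerHomogeneous (Complex.I * l₁ + 1) F₁)
    (hF₂ : IsLowerHomogeneous (Complex.I * l₂ + 1) F₂) (hΦ : IsUpperHomogeneous (-(2 * s)) Φ)
    (hs₁ : ContDiff ℝ ∞ (fun θ => F₁ (rot θ))) (hs₂ : ContDiff ℝ ∞ (fun θ => F₂ (rot θ)))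
    (θ : ℝ) :
    ∫ a, rsIntegrand F₁ F₂ Φ (θ, a) = G₀ (uParam l₁ l₂ s) / (4 * π) * (Φ (rot θ) *
      rieszPairing (uParam l₁ l₂ s) (fun x => F₁ (rot θ * unip x))
        (fun y => F₂ (rot θ * unip y))) := by
  obtain ⟨C₁, hC₁⟩ := hF₁.exists_hasDecay (by simp) hs₁
  obtain ⟨C₂, hC₂⟩ := hF₂.exists_hasDecay (by simp) hs₂
  have hπ : (π : ℂ) ≠ 0 := by exact_mod_cast pi_ne_zero
  rw [integral_congr_ae ((Measure.ae_ne volume (0 : ℝ)).mono fun a ha =>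
      rsIntegrand_eq hF₁ hF₂ hΦ hs₁ hs₂ θ ha),
    integral_const_mul, integral_comp_inv_mul_abs (fun t =>
      ((|t| : ℝ) : ℂ) ^ (uParam l₁ l₂ s - 1) * (limFourier (fun x => F₁ (rot θ * unip x)) t *
        conj (limFourier (fun x => F₂ (rot θ * unip x)) t))),
    integral_abs_cpow_mul_limFourier (by rwa [uParam_re]) (by rwa [uParam_re]) (hC₁ θ) (hC₂ θ)]
  field_simp
  ring

theorem restrict_rsDomain : (volume : Measure (ℝ × ℝ)).restrict rsDomain =
    periodMeasure.prod volume := by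
  rw [rsDomain, Measure.volume_eq_prod, ← Measure.prod_restrict, Measure.restrict_univ,
    periodMeasure]

theorem integrableOn_rsIntegrand (h₀ : 0 < s.re) (h₁ : s.re < 1) (f₁ : UnitarySeries l₁)
    (f₂ : UnitarySeries l₂) (φ : SmoothSeries (2 * s - 1)) (hs₁ : f₁.IsSmooth)
    (hs₂ : f₂.IsSmooth) : IntegrableOn (rsIntegrand f₁ f₂ φ) rsDomain := by
  rw [IntegrableOn, restrict_rsDomain]
  exact integrable_rsIntegrand h₀ h₁ f₁.isLowerHomogeneous f₂.isLowerHomogeneous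
    (by simpa using φ.isUpperHomogeneous) hs₁ hs₂ φ.continuous_rot

theorem rankinSelberg_eq_trilinearForm (h₀ : 0 < s.re) (h₁ : s.re < 1) (f₁ : UnitarySeries l₁)
    (f₂ : UnitarySeries l₂) (φ : SmoothSeries (2 * s - 1)) (hs₁ : f₁.IsSmooth)
    (hs₂ : f₂.IsSmooth) :
    rankinSelberg f₁ f₂ φ = trilinearForm l₁ l₂ (2 * s - 1) h₀ h₁ f₁ f₂ φ := by
  have hint := integrableOn_rsIntegrand h₀ h₁ f₁ f₂ φ hs₁ hs₂
  have hfibre := integral_rsIntegrand h₀ h₁ f₁.isLowerHomogeneous f₂.isLowerHomogeneous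
    (by simpa using φ.isUpperHomogeneous) hs₁ hs₂
  have hπ : (π : ℂ) ≠ 0 := by exact_mod_cast pi_ne_zero
  rw [IntegrableOn, restrict_rsDomain] at hint
  rw [rankinSelberg, restrict_rsDomain, integral_prod _ hint]
  simp only [hfibre]
  rw [integral_const_mul, integral_periodMeasure, trilinearForm_apply,
    tripleIntegral_eq_integral_rieszPairing f₁ f₂ φ h₀ h₁]
  field_simp
  ring

end RankinSelberg

theorem mainTheorem8 (l₁ l₂ : ℝ) (s : ℂ) (hs₀ : 0 < s.re) (hs₁ : s.re < 1) :
    -- absolute convergence for all `L²` vectors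
    (∀ (f₁ : UnitarySeries l₁) (f₂ : UnitarySeries l₂) (φ : SmoothSeries (2 * s - 1)),
      (∀ θ₁ θ₂ : ℝ, IntegrableOn (convIntegrand f₁ f₂ φ θ₁ θ₂) (Ioc 0 (2 * π))) ∧
      IntegrableOn (fun p : ℝ × ℝ => circleIntegrand l₁ l₂ s f₁ f₂ φ p.1 p.2)
        (Ioc 0 (2 * π) ×ˢ Ioc 0 (2 * π))) ∧
    -- the representations of `G` by left translation and the continuous equivariant form
    ∃ (ρ₁ : Representation ℂ SLpm (UnitarySeries l₁))
      (ρ₂ : Representation ℂ SLpm (UnitarySeries l₂))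
      (σ : Representation ℂ SLpm (SmoothSeries (2 * s - 1)))
      (T : UnitarySeries l₁ →ₗ[ℂ] UnitarySeries l₂ →ₗ⋆[ℂ] SmoothSeries (2 * s - 1) →ₗ[ℂ] ℂ),
      (∀ g f, (ρ₁ g f : SLpm → ℂ) = leftTranslate g f) ∧
      (∀ g f, (ρ₂ g f : SLpm → ℂ) = leftTranslate g f) ∧
      (∀ g φ, (σ g φ : SLpm → ℂ) = leftTranslate g φ) ∧
      -- the explicit formula
      (∀ f₁ f₂ φ, T f₁ f₂ φ = G₀ (uParam l₁ l₂ s) / 8 *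
        ∫ θ₂ in (0 : ℝ)..(2 * π), ∫ θ₁ in (0 : ℝ)..(2 * π),
          circleIntegrand l₁ l₂ s f₁ f₂ φ θ₁ θ₂) ∧
      Continuous (fun p : UnitarySeries l₁ × UnitarySeries l₂ × SmoothSeries (2 * s - 1) =>
        T p.1 p.2.1 p.2.2) ∧
      (∀ g f₁ f₂ φ, T (ρ₁ g f₁) (ρ₂ g f₂) (σ g φ) = T f₁ f₂ φ) ∧
      -- on smooth vectors the form is the Rankin–Selberg integral of Whittaker functions
      (∀ (f₁ : UnitarySeries l₁) (f₂ : UnitarySeries l₂) (φ : SmoothSeries (2 * s - 1)),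
        f₁.IsSmooth → f₂.IsSmooth →
        (∀ g, Tendsto (truncatedWhittaker (leftTranslate g⁻¹ f₁)) atTop (𝓝 (Wh f₁ g))) ∧
        (∀ g, Tendsto (truncatedWhittaker (leftTranslate g⁻¹ f₂)) atTop (𝓝 (Wh f₂ g))) ∧
        IntegrableOn (rsIntegrand f₁ f₂ φ) rsDomain ∧
        rankinSelberg f₁ f₂ φ = T f₁ f₂ φ) := by
  refine ⟨fun f₁ f₂ φ => ⟨integrable_convIntegrand f₁ f₂ φ, ?_⟩,
    unitaryRep l₁, unitaryRep l₂, smoothRep (2 * s - 1), trilinearForm l₁ l₂ _ hs₀ hs₁,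
    fun _ _ => rfl, fun _ _ => rfl, fun _ _ => rfl, trilinearForm_eq hs₀ hs₁,
    continuous_trilinearForm hs₀ hs₁, fun g f₁ f₂ φ => ?_,
    fun f₁ f₂ φ hf₁ hf₂ => ⟨f₁.isLowerHomogeneous.tendsto_truncatedWhittaker (by simp) hf₁,
      f₂.isLowerHomogeneous.tendsto_truncatedWhittaker (by simp) hf₂,
      integrableOn_rsIntegrand hs₀ hs₁ f₁ f₂ φ hf₁ hf₂,
      rankinSelberg_eq_trilinearForm hs₀ hs₁ f₁ f₂ φ hf₁ hf₂⟩⟩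
  · have hint := integrable_circleIntegrand f₁ f₂ φ hs₀ hs₁
    rwa [periodMeasure, Measure.prod_restrict, ← Measure.volume_eq_prod] at hint
  · rw [trilinearForm_apply, trilinearForm_apply, tripleIntegral_leftTranslate _ _ _ hs₀ hs₁]
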